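/- Let $\Delta$ be a (reduced, crystallographic) root system in a Euclidean space $E$ with base $\Sigma$, let $I_0\subsetneq\Sigma$, and let $R=\Delta/I_0=\{\pi_{I_0}(\beta) : \beta\in\Delta\setminus\operatorname{span} I_0\}$ be the corresponding quotient root system, where $\pi_J$ denotes the projection along $\operatorname{span} J$ onto $E/\operatorname{span} J\cong(\operatorname{span} J)^\perp$. Let $S$ be a base of $R$ (a subset of $R$ that is a basis of $\operatorname{span} R$ and such that every root is a combination of elements of $S$ with integer coefficients that are all $\ge 0$ or all $\le 0$); $R^+$ is the set of positive roots and $n=\operatorname{rk}R=|S|$. For $I\subseteq S$ let $R_I=R\cap\operatorname{span}I$, with base $I$, and let $R/I=\{\pi_I(\alpha) : \alpha\in R\setminus\operatorname{span}I\}$, with base $\pi_I(S\setminus I)$. A subset $\Phi\subseteq R^+$ is an inversion set if $\Phi$ and $\Phi^c=R^+\setminus\Phi$ are both closed under those sums of two elements that lie in $R^+$. For $\Psi\subseteq(R/I)^+$ and $X\subseteq R_I^+$ put $\inf_I^S(\Psi,X)=\{\alpha\in R^+ : \pi_I(\alpha)\in\Psi\}\cup X$. A subset $\Phi\subseteq R^+$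 is primitive if $\Phi\ne\emptyset$, $\Phi\neq R^+$ and $\Phi=\inf_I^S(\Psi,X)$ implies $I=\emptyset$ or $I=S$. A fine decomposition of $R^+$ is an expression $R^+=\Phi_1\sqcup\dots\sqcup\Phi_n$ of $R^+$ as a disjoint union of $n=\operatorname{rk}R$ non-empty inversion sets. Let $F(R)$ be the number of fine decompositions (up to the order of the parts; $F=1$ in rank $0$), and let $\Pi(R)=\frac12\,|\{\Psi\subset R^+ : \Psi\text{ is a primitive inversion set}\}|$. (1) Let $R^+=\Phi_1\sqcup\cdots\sqcup\Phi_n$ be a fine decomposition. Then: (i) $|\Phi_i\cap S|=1$ for each $1\le i\le n$. (ii) There is a subset $I\subseteq S$ with $\operatorname{rk}(R/I)\in\{1,2\}$ such that for every $1\le i\le n$, $\Phi_i=\inf_I^S(\Psi_i,\emptyset)$ for some $\Psi_i\subseteq(R/I)^+$ or $\Phi_i=\inf_I^S(\emptyset,X_i)$ for some $X_i\subseteq R_I^+$. (2) Suppose moreover that $R$ is connected, i.e. that the graph on $S$ in which $\theta,\theta'$ are adjacent if and only if $\langle\theta,\theta'\rangle<0$ is connected. Write $S=\{\theta_1,\dots,\theta_n\}$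 and let $J^c=S\setminus J$ for $J\subseteq S$. Then $$F(R)=\sum_{i=1}^nF(R_{\{\theta_i\}^c})+\sum_{i=1}^{n-1}\sum_{j=i+1}^n\Pi(R/\{\theta_i,\theta_j\}^c)\,F(R_{\{\theta_i,\theta_j\}^c}).$$ -/

import Mathlib

open scoped InnerProductSpace

noncomputable section

namespace QRS

variable {E : Type*} [NormedAddCommGroup E] [InnerProductSpace ℝ E] [FiniteDimensional ℝ E]

/-- The canonical projection `π_I : E → E / span I`, where `E / span I` is identified with the
orthogonal complement of `span I`; that is, the orthogonal projection onto `(span I)ᗮ`. -/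
def proj (I : Set E) : E →L[ℝ] E :=
  (Submodule.span ℝ I)ᗮ.starProjection

/-- The set `Δ / I = {π_I β | β ∈ Δ \ span I}` of non-zero images of the elements of `Δ`. -/
def quotientRoots (Δ I : Set E) : Set E :=
  proj I '' (Δ \ (Submodule.span ℝ I : Set E))

/-- `S` is a base of the set of vectors `R`: it is a subset of `R`, a basis of the span of `R`, and
every element of `R` is an integral combination of `S` with all coefficients non-negative or all
coefficients non-positive. -/
structure IsBase (S R : Set E) : Prop where
  subset : S ⊆ R
  linearIndepOn : LinearIndepOn ℝ id S
  span_eq : Submodule.span ℝ S = Submodule.span ℝ R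
  mem_or_neg_mem : ∀ α ∈ R, α ∈ AddSubmonoid.closure S ∨ -α ∈ AddSubmonoid.closure S

/-- A set of vectors ("roots") of `E` together with a chosen subset (the "base"). The theorem only
concerns those for which the roots form a quotient root system and the base is one of its bases;
all notions below are determined by these two sets. -/
structure BasedRoots (E : Type*) where
  /-- the set of roots -/
  roots : Set E
  /-- the set of simple roots -/
  base : Set E

namespace BasedRoots

/-- The set `R⁺` of positive roots. -/
def pos (R : BasedRoots E) : Set E :=
  {α ∈ R.roots | α ∈ AddSubmonoid.closure R.base}

/-- The rank: the dimension of the vector space spanned by the roots. -/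
def rank (R : BasedRoots E) : ℕ :=
  Module.finrank ℝ (Submodule.span ℝ R.roots)

/-- `R_I = R ∩ span I`, with base `I`. -/
def sub (R : BasedRoots E) (I : Set E) : BasedRoots E where
  roots := R.roots ∩ (Submodule.span ℝ I : Set E)
  base := I

/-- `R / I`, with base `S / I = {π_I θ | θ ∈ S \ I}`. -/
def quot (R : BasedRoots E) (I : Set E) : BasedRoots E where
  roots := quotientRoots R.roots I
  base := proj I '' (R.base \ I)

/-- The adjacency diagram: the graph on the simple roots in which `θ`, `θ'` are joined by an edge
if and only if `⟪θ, θ'⟫ < 0`. -/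
def adjacencyDiagram (R : BasedRoots E) : SimpleGraph R.base where
  Adj θ θ' := ⟪(θ : E), (θ' : E)⟫_ℝ < 0
  symm := ⟨fun θ θ' h => by rwa [real_inner_comm]⟩
  loopless := ⟨fun _ h => absurd h (not_lt.mpr real_inner_self_nonneg)⟩

/-- `R` is connected if its adjacency diagram is. -/
def Connected (R : BasedRoots E) : Prop :=
  R.adjacencyDiagram.Connected

/-- `Φ ⊆ R⁺` is closed: `α + β ∈ Φ` whenever `α, β ∈ Φ` and `α + β` is a (positive) root. -/
def IsClosed (R : BasedRoots E) (Φ : Set E) : Prop :=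
  ∀ α ∈ Φ, ∀ β ∈ Φ, α + β ∈ R.pos → α + β ∈ Φ

/-- An inversion set: a subset of `R⁺` which is closed and co-closed (its complement in `R⁺` is
closed). -/
structure IsInversionSet (R : BasedRoots E) (Φ : Set E) : Prop where
  subset_pos : Φ ⊆ R.pos
  closed : R.IsClosed Φ
  coclosed : R.IsClosed (R.pos \ Φ)

/-- `P` is the set of parts of a decomposition of `Φ` into non-empty pairwise disjoint inversion
sets. -/
structure IsDecomposition (R : BasedRoots E) (Φ : Set E) (P : Set (Set E)) : Prop where
  inversionSet : ∀ Ψ ∈ P, R.IsInversionSet Ψ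
  nonempty : ∀ Ψ ∈ P, Ψ.Nonempty
  pairwiseDisjoint : P.PairwiseDisjoint id
  sUnion_eq : ⋃₀ P = Φ

/-- `P` is the set of parts of a fine decomposition of `R⁺`: the number of parts is the rank. -/
structure IsFineDecomposition (R : BasedRoots E) (P : Set (Set E)) : Prop
    extends R.IsDecomposition R.pos P where
  finite : P.Finite
  ncard_eq : P.ncard = R.rank

/-- `inf_I^S(Ψ, X) = π_I⁻¹(Ψ) ∪ X`, the preimage being taken in `R⁺`. -/
def inflation (R : BasedRoots E) (I Ψ X : Set E) : Set E :=
  {α ∈ R.pos | proj I α ∈ Ψ} ∪ X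

/-- `Φ ⊆ R⁺` is primitive: `Φ ≠ ∅`, `Φ ≠ R⁺`, and `Φ = inf_I^S(Ψ, X)` implies `I = ∅` or `I = S`. -/
structure IsPrimitive (R : BasedRoots E) (Φ : Set E) : Prop where
  subset_pos : Φ ⊆ R.pos
  ne_empty : Φ ≠ ∅
  ne_pos : Φ ≠ R.pos
  eq_empty_or_eq_base : ∀ I ⊆ R.base, ∀ Ψ ⊆ (R.quot I).pos, ∀ X ⊆ (R.sub I).pos,
    Φ = R.inflation I Ψ X → I = ∅ ∨ I = R.base

/-- `F(R)`: the number of fine decompositions of `R⁺` (as unordered collections of parts). -/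
def numFine (R : BasedRoots E) : ℕ :=
  {P : Set (Set E) | R.IsFineDecomposition P}.ncard

/-- `Π(R)`: half the number of primitive inversion sets in `R⁺`. -/
def halfNumPrimitive (R : BasedRoots E) : ℚ :=
  ({Ψ : Set E | R.IsPrimitive Ψ ∧ R.IsInversionSet Ψ}.ncard : ℚ) / 2

end BasedRoots

end QRS

end

set_option linter.unusedSectionVars false

noncomputable section

namespace QRS

variable {E : Type*} [NormedAddCommGroup E] [InnerProductSpace ℝ E] [FiniteDimensional ℝ E]

/-! ### Admissible root sets and colorings -/

namespace BasedRoots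

/-- The linear functional with prescribed values on the simple roots. -/
def functional (R : BasedRoots E) (f : E → ℝ) : E →ₗ[ℝ] ℝ :=
  open Classical in
  if h : LinearIndepOn ℝ id R.base then (Module.Basis.extend h).constr ℝ (fun x => f x) else 0

/-- The coefficient of a simple root. -/
def coef (R : BasedRoots E) (θ : E) : E →ₗ[ℝ] ℝ :=
  open Classical in R.functional (Pi.single θ 1)

/-- The height: the sum of all coefficients. -/
def ht (R : BasedRoots E) : E →ₗ[ℝ] ℝ :=
  R.functional 1

/-- The properties of quotient root systems on which the combinatorial arguments rest. -/
structure IsAdmissible (R : BasedRoots E) : Prop where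
  finite : R.roots.Finite
  zero_notMem : (0 : E) ∉ R.roots
  neg_mem_roots : ∀ α ∈ R.roots, -α ∈ R.roots
  add_mem_roots : ∀ α ∈ R.roots, ∀ β ∈ R.roots, ⟪α, β⟫_ℝ < 0 → α + β ≠ 0 → α + β ∈ R.roots
  sub_mem_of_inner_eq_zero : ∀ α ∈ R.roots, ∀ β ∈ R.roots, ⟪α, β⟫_ℝ = 0 → α + β ∈ R.roots →
    α - β ∈ R.roots
  isBase : IsBase R.base R.roots

/-- A coloring of the positive roots by simple roots; its color classes form a fine
decomposition. -/
structure IsColoring (R : BasedRoots E) (c : E → E) : Prop where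
  base : ∀ θ ∈ R.base, c θ = θ
  add : ∀ α ∈ R.pos, ∀ β ∈ R.pos, α + β ∈ R.pos → c (α + β) = c α ∨ c (α + β) = c β

/-- The color of a positive root outside `span I` does not change when a positive root of `R_I`
is added. -/
def FibConst (R : BasedRoots E) (c : E → E) (I : Set E) : Prop :=
  ∀ α ∈ R.pos, α ∉ Submodule.span ℝ I → ∀ β ∈ R.pos, β ∈ Submodule.span ℝ I →
    α + β ∈ R.roots → c (α + β) = c α

/-! ### Coefficients, heights and descent for positive roots -/

namespace IsAdmissible

variable {R : BasedRoots E} (hR : R.IsAdmissible)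
include hR

theorem functional_base (f : E → ℝ) {θ : E} (hθ : θ ∈ R.base) : R.functional f θ = f θ := by
  have h := hR.isBase.linearIndepOn
  rw [functional, dif_pos h]
  have := (Module.Basis.extend h).constr_basis ℝ (fun x => f x) ⟨θ, h.subset_extend _ hθ⟩
  rwa [Module.Basis.extend_apply_self] at this

theorem base_subset {θ : E} (hθ : θ ∈ R.base) : θ ∈ R.roots :=
  hR.isBase.subset hθ

theorem base_pos {θ : E} (hθ : θ ∈ R.base) : θ ∈ R.pos :=
  ⟨hR.base_subset hθ, AddSubmonoid.subset_closure hθ⟩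

theorem pos_finite : R.pos.Finite :=
  hR.finite.subset fun _ h => h.1

theorem base_finite : R.base.Finite :=
  hR.finite.subset hR.isBase.subset

theorem ne_zero {α : E} (hα : α ∈ R.roots) : α ≠ 0 :=
  fun h => hR.zero_notMem (h ▸ hα)

theorem sub_mem_roots {α β : E} (hα : α ∈ R.roots) (hβ : β ∈ R.roots) (h : 0 < ⟪α, β⟫_ℝ)
    (hne : α ≠ β) : α - β ∈ R.roots := by
  rw [sub_eq_add_neg]
  refine hR.add_mem_roots α hα (-β) (hR.neg_mem_roots β hβ) ?_ ?_
  · rw [inner_neg_right]; linarith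
  · rwa [← sub_eq_add_neg, sub_ne_zero]

/-- A positive inner product would make θ - φ a root with coefficients of both signs. -/
theorem inner_base_nonpos {θ φ : E} (hθ : θ ∈ R.base) (hφ : φ ∈ R.base) (hne : θ ≠ φ) :
    ⟪θ, φ⟫_ℝ ≤ 0 := by
  by_contra! h
  have h1 := hR.sub_mem_roots (hR.base_subset hθ) (hR.base_subset hφ) h hne
  have hθ' : R.functional (open Classical in Pi.single θ 1) θ = 1 := by
    rw [hR.functional_base _ hθ]; simp
  have hφ' : R.functional (open Classical in Pi.single θ 1) φ = 0 := by
    rw [hR.functional_base _ hφ]; simp [hne.symm]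
  have hθ2 : R.functional (open Classical in Pi.single φ 1) θ = 0 := by
    rw [hR.functional_base _ hθ]; simp [hne]
  have hφ2 : R.functional (open Classical in Pi.single φ 1) φ = 1 := by
    rw [hR.functional_base _ hφ]; simp
  have key : ∀ f : E → ℝ, (∀ x, 0 ≤ f x) → ∀ v ∈ AddSubmonoid.closure R.base,
      0 ≤ R.functional f v := by
    intro f hf v hv
    induction hv using AddSubmonoid.closure_induction with
    | mem x hx => rw [hR.functional_base f hx]; exact hf x
    | zero => simp
    | add x y _ _ hx hy => rw [map_add]; linarith
  have hs : ∀ (ψ x : E), 0 ≤ (open Classical in Pi.single ψ (1 : ℝ) : E → ℝ) x := by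
    classical
    intro ψ x
    by_cases hx : x = ψ
    · subst hx; simp
    · simp [hx]
  rcases hR.isBase.mem_or_neg_mem _ h1 with h2 | h2
  · have := key _ (hs φ) _ h2
    rw [map_sub, hθ2, hφ2] at this; linarith
  · have := key _ (hs θ) _ h2
    rw [map_neg, map_sub, hθ', hφ'] at this; linarith

theorem coef_self {θ : E} (hθ : θ ∈ R.base) : R.coef θ θ = 1 := by
  rw [coef, hR.functional_base _ hθ]; simp

theorem coef_of_ne {θ φ : E} (hφ : φ ∈ R.base) (h : φ ≠ θ) : R.coef θ φ = 0 := by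
  rw [coef, hR.functional_base _ hφ]; simp [h]

theorem ht_base {θ : E} (hθ : θ ∈ R.base) : R.ht θ = 1 := by
  rw [ht, hR.functional_base _ hθ]; rfl

theorem coef_nat (θ : E) {v : E} (hv : v ∈ AddSubmonoid.closure R.base) :
    ∃ n : ℕ, R.coef θ v = n := by
  induction hv using AddSubmonoid.closure_induction with
  | mem x hx =>
    by_cases h : x = θ
    · subst h; exact ⟨1, by simp [hR.coef_self hx]⟩
    · exact ⟨0, by simp [hR.coef_of_ne hx h]⟩
  | zero => exact ⟨0, by simp⟩
  | add x y _ _ hx hy =>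
    obtain ⟨a, ha⟩ := hx
    obtain ⟨b, hb⟩ := hy
    exact ⟨a + b, by simp [ha, hb]⟩

theorem coef_nonneg (θ : E) {v : E} (hv : v ∈ AddSubmonoid.closure R.base) :
    0 ≤ R.coef θ v := by
  obtain ⟨n, hn⟩ := hR.coef_nat θ hv
  rw [hn]; positivity

theorem coef_int (θ : E) {α : E} (hα : α ∈ R.roots) : ∃ n : ℤ, R.coef θ α = n := by
  rcases hR.isBase.mem_or_neg_mem α hα with h | h
  · obtain ⟨n, hn⟩ := hR.coef_nat θ h
    exact ⟨n, by simp [hn]⟩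
  · obtain ⟨n, hn⟩ := hR.coef_nat θ h
    refine ⟨-n, ?_⟩
    rw [map_neg] at hn
    push_cast
    linarith

theorem one_le_coef {θ v : E} (hv : v ∈ AddSubmonoid.closure R.base) (h : 0 < R.coef θ v) :
    1 ≤ R.coef θ v := by
  obtain ⟨n, hn⟩ := hR.coef_nat θ hv
  rw [hn] at h ⊢
  exact_mod_cast h

theorem eq_zero_or_one_le_ht {v : E} (hv : v ∈ AddSubmonoid.closure R.base) :
    v = 0 ∨ 1 ≤ R.ht v := by
  induction hv using AddSubmonoid.closure_induction with
  | mem x hx => right; rw [hR.ht_base hx]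
  | zero => left; rfl
  | add x y _ _ hx hy =>
    rcases hx with rfl | hx
    · simpa using hy
    · rcases hy with rfl | hy
      · simpa using Or.inr hx
      · right; rw [map_add]; linarith

theorem one_le_ht {α : E} (hα : α ∈ R.pos) : 1 ≤ R.ht α :=
  (hR.eq_zero_or_one_le_ht hα.2).resolve_left (hR.ne_zero hα.1)

theorem pos_or_neg_pos {α : E} (hα : α ∈ R.roots) : α ∈ R.pos ∨ -α ∈ R.pos :=
  (hR.isBase.mem_or_neg_mem α hα).imp (fun h => ⟨hα, h⟩) (fun h => ⟨hR.neg_mem_roots α hα, h⟩)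

theorem pos_of_coef_pos {θ α : E} (hα : α ∈ R.roots) (h : 0 < R.coef θ α) : α ∈ R.pos := by
  refine (hR.pos_or_neg_pos hα).resolve_right fun h' => ?_
  have := hR.coef_nonneg θ h'.2
  rw [map_neg] at this; linarith

theorem notMem_of_mixed {α : E} (θ φ : E) (h : 0 < R.coef θ α) (h' : R.coef φ α < 0) :
    α ∉ R.roots := fun hα => by
  have := hR.coef_nonneg φ (hR.pos_of_coef_pos hα h).2
  linarith

theorem add_pos {α β : E} (hα : α ∈ R.pos) (hβ : β ∈ R.pos) (h : α + β ∈ R.roots) :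
    α + β ∈ R.pos := ⟨h, add_mem hα.2 hβ.2⟩

theorem add_ne_zero {α β : E} (hα : α ∈ R.pos) (hβ : β ∈ R.pos) : α + β ≠ 0 := fun h => by
  have h1 := hR.one_le_ht hα
  have h2 := hR.one_le_ht hβ
  have h3 : R.ht (α + β) = 0 := by rw [h, map_zero]
  rw [map_add] at h3; linarith

theorem add_pos_of_inner_neg {α β : E} (hα : α ∈ R.pos) (hβ : β ∈ R.pos)
    (h : ⟪α, β⟫_ℝ < 0) : α + β ∈ R.pos :=
  hR.add_pos hα hβ (hR.add_mem_roots α hα.1 β hβ.1 h (hR.add_ne_zero hα hβ))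

theorem sub_base_pos {α θ : E} (hα : α ∈ R.pos) (hθ : θ ∈ R.base) (h : α - θ ∈ R.roots) :
    α - θ ∈ R.pos := by
  refine (hR.pos_or_neg_pos h).resolve_right fun h' => ?_
  have h1 := hR.one_le_ht h'
  have h2 := hR.one_le_ht hα
  rw [map_neg, map_sub, hR.ht_base hθ] at h1; linarith

/-- Strong induction on the height of positive roots. -/
theorem pos_induction {p : E → Prop}
    (h : ∀ α ∈ R.pos, (∀ β ∈ R.pos, R.ht β < R.ht α → p β) → p α) : ∀ α ∈ R.pos, p α := by
  by_contra! hcon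
  obtain ⟨α, ⟨hα, hp⟩, hmin⟩ := Set.exists_min_image {α | α ∈ R.pos ∧ ¬ p α} R.ht
    (hR.pos_finite.subset fun _ h => h.1) hcon
  refine hp (h α hα fun β hβ hlt => ?_)
  by_contra hpβ
  exact absurd (hmin β ⟨hβ, hpβ⟩) (not_le.mpr hlt)

/-- A sum of simple roots is a sum of simple roots with a positive coefficient. -/
theorem mem_closure_supp {v : E} (hv : v ∈ AddSubmonoid.closure R.base) :
    v ∈ AddSubmonoid.closure {θ ∈ R.base | 0 < R.coef θ v} := by
  induction hv using AddSubmonoid.closure_induction with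
  | mem x hx =>
    refine AddSubmonoid.subset_closure ⟨hx, ?_⟩
    rw [hR.coef_self hx]; norm_num
  | zero => exact zero_mem _
  | add x y hx' hy' hx hy =>
    refine add_mem (AddSubmonoid.closure_mono ?_ hx) (AddSubmonoid.closure_mono ?_ hy)
    · rintro θ ⟨h1, h2⟩
      refine ⟨h1, ?_⟩
      have := hR.coef_nonneg θ hy'
      rw [map_add]; linarith
    · rintro θ ⟨h1, h2⟩
      refine ⟨h1, ?_⟩
      have := hR.coef_nonneg θ hx'
      rw [map_add]; linarith

theorem exists_coef_inner_pos {v w : E} (hv : v ∈ AddSubmonoid.closure R.base)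
    (h : 0 < ⟪w, v⟫_ℝ) : ∃ θ ∈ R.base, 0 < R.coef θ v ∧ 0 < ⟪w, θ⟫_ℝ := by
  by_contra! hcon
  have key : ∀ u ∈ AddSubmonoid.closure {θ ∈ R.base | 0 < R.coef θ v}, ⟪w, u⟫_ℝ ≤ 0 := by
    intro u hu
    induction hu using AddSubmonoid.closure_induction with
    | mem x hx => exact hcon x hx.1 hx.2
    | zero => simp
    | add x y _ _ hx hy => rw [inner_add_right]; linarith
  exact absurd (key v (hR.mem_closure_supp hv)) (not_le.mpr h)

theorem inner_self_pos {α : E} (hα : α ∈ R.roots) : 0 < ⟪α, α⟫_ℝ :=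
  real_inner_self_pos.mpr (hR.ne_zero hα)

/-- A positive root that is not simple stays positive after subtracting some simple root. -/
theorem exists_sub_base_pos {α : E} (hα : α ∈ R.pos) (h : α ∉ R.base) :
    ∃ θ ∈ R.base, 0 < R.coef θ α ∧ 0 < ⟪α, θ⟫_ℝ ∧ α - θ ∈ R.pos := by
  obtain ⟨θ, hθ, h1, h2⟩ := hR.exists_coef_inner_pos hα.2 (hR.inner_self_pos hα.1)
  refine ⟨θ, hθ, h1, h2, hR.sub_base_pos hα hθ (hR.sub_mem_roots hα.1 (hR.base_subset hθ) h2 ?_)⟩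
  rintro rfl
  exact h hθ

theorem mem_span_of_coef {J : Set E} {v : E} (hv : v ∈ AddSubmonoid.closure R.base)
    (h : ∀ θ ∈ R.base, 0 < R.coef θ v → θ ∈ J) : v ∈ Submodule.span ℝ J := by
  have h1 := AddSubmonoid.closure_mono (t := J) (by rintro θ ⟨h1, h2⟩; exact h θ h1 h2)
    (hR.mem_closure_supp hv)
  exact Submodule.closure_subset_span h1

theorem coef_eq_zero_of_mem_span {J : Set E} (hJ : J ⊆ R.base) {v θ : E}
    (hv : v ∈ Submodule.span ℝ J) (hθ : θ ∉ J) : R.coef θ v = 0 := by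
  induction hv using Submodule.span_induction with
  | mem x hx => exact hR.coef_of_ne (hJ hx) (fun h => hθ (h ▸ hx))
  | zero => simp
  | add x y _ _ hx hy => rw [map_add, hx, hy, add_zero]
  | smul a x _ hx => rw [map_smul, hx, smul_zero]

theorem base_mem_span_iff {J : Set E} (hJ : J ⊆ R.base) {θ : E} (hθ : θ ∈ R.base) :
    θ ∈ Submodule.span ℝ J ↔ θ ∈ J := by
  refine ⟨fun h => ?_, fun h => Submodule.subset_span h⟩
  by_contra hn
  have := hR.coef_eq_zero_of_mem_span hJ h hn
  rw [hR.coef_self hθ] at this; norm_num at this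

theorem mem_span_iff {J : Set E} (hJ : J ⊆ R.base) {α : E} (hα : α ∈ R.pos) :
    α ∈ Submodule.span ℝ J ↔ ∀ θ ∈ R.base, 0 < R.coef θ α → θ ∈ J := by
  refine ⟨fun h θ _ hpos => ?_, fun h => hR.mem_span_of_coef hα.2 h⟩
  by_contra hn
  rw [hR.coef_eq_zero_of_mem_span hJ h hn] at hpos
  exact lt_irrefl _ hpos

theorem exists_of_notMem_span {J : Set E} {α : E} (hα : α ∈ R.pos)
    (h : α ∉ Submodule.span ℝ J) : ∃ θ ∈ R.base, θ ∉ J ∧ 0 < R.coef θ α := by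
  by_contra! hcon
  refine h (hR.mem_span_of_coef hα.2 fun θ hθ hpos => ?_)
  by_contra hn
  exact absurd (hcon θ hθ hn) (not_le.mpr hpos)

theorem add_notMem_span {J : Set E} (hJ : J ⊆ R.base) {α β : E} (hα : α ∈ R.pos)
    (hβ : β ∈ R.pos) (h : α ∉ Submodule.span ℝ J) : α + β ∉ Submodule.span ℝ J := by
  obtain ⟨θ, hθ, h1, h2⟩ := hR.exists_of_notMem_span hα h
  intro hs
  have h3 := hR.coef_eq_zero_of_mem_span hJ hs h1
  have := hR.coef_nonneg θ hβ.2
  rw [map_add] at h3; linarith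

/-- The exchange property of four roots `α`, `β`, `γ`, `α + β + γ`. -/
theorem exchange {α β γ : E} (hα : α ∈ R.roots) (hβ : β ∈ R.roots) (hγ : γ ∈ R.roots)
    (h : α + β + γ ∈ R.roots) (hne : β + γ ≠ 0) :
    (α + β ∈ R.roots ∨ α + β = 0) ∨ (α + γ ∈ R.roots ∨ α + γ = 0) := by
  -- If all alternatives fail, then ⟪α, β + γ⟫ ≥ 0 while ⟪α + β + γ, β + γ⟫ ≤ 0, so the norm of β +
  -- γ would vanish.
  by_contra! hcon
  obtain ⟨⟨h1, h2⟩, h3, h4⟩ := hcon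
  have i1 : 0 ≤ ⟪α, β⟫_ℝ := by
    by_contra! hlt
    exact h1 (hR.add_mem_roots α hα β hβ hlt h2)
  have i2 : 0 ≤ ⟪α, γ⟫_ℝ := by
    by_contra! hlt
    exact h3 (hR.add_mem_roots α hα γ hγ hlt h4)
  have i3 : ⟪α + β + γ, β⟫_ℝ ≤ 0 := by
    by_contra! hlt
    have := hR.sub_mem_roots h hβ hlt (fun h => h4 (by
      have : α + γ = α + β + γ - β := by abel
      rw [this, h, sub_self]))
    exact h3 (by convert this using 1; abel)
  have i4 : ⟪α + β + γ, γ⟫_ℝ ≤ 0 := by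
    by_contra! hlt
    have := hR.sub_mem_roots h hγ hlt (fun h => h2 (by
      have : α + β = α + β + γ - γ := by abel
      rw [this, h, sub_self]))
    exact h1 (by convert this using 1; abel)
  have i5 : 0 < ⟪β + γ, β + γ⟫_ℝ := real_inner_self_pos.mpr hne
  simp only [inner_add_left, inner_add_right] at i3 i4 i5
  linarith

/-- Supports of positive roots are connected. -/
theorem mem_span_or_mem_span {A B : Set E} (hA : A ⊆ R.base) (hB : B ⊆ R.base)
    (hAB : ∀ a ∈ A, ∀ b ∈ B, ⟪a, b⟫_ℝ = 0) : ∀ α ∈ R.pos,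
    (∀ θ ∈ R.base, 0 < R.coef θ α → θ ∈ A ∪ B) →
    α ∈ Submodule.span ℝ A ∨ α ∈ Submodule.span ℝ B := by
  refine hR.pos_induction fun α hα ih hsupp => ?_
  by_cases hb : α ∈ R.base
  · exact (hsupp α hb (by rw [hR.coef_self hb]; norm_num)).imp
      (fun h => Submodule.subset_span h) (fun h => Submodule.subset_span h)
  obtain ⟨θ, hθ, hθα, -, hpos⟩ := hR.exists_sub_base_pos hα hb
  have key : ∀ A B : Set E, A ⊆ R.base → B ⊆ R.base → (∀ a ∈ A, ∀ b ∈ B, ⟪a, b⟫_ℝ = 0) →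
      θ ∈ A → α - θ ∈ Submodule.span ℝ A ∨ α - θ ∈ Submodule.span ℝ B →
      α ∈ Submodule.span ℝ A := by
    intro A B hA hB hAB hθA h
    rcases h with h | h
    · simpa using add_mem h (Submodule.subset_span hθA)
    · exfalso
      have hθB : θ ∉ B := fun hθB =>
        (hR.ne_zero (hR.base_subset hθ)) (inner_self_eq_zero (𝕜 := ℝ).mp (hAB θ hθA θ hθB))
      -- α - θ lies in span B and is orthogonal to θ. Their sum is a root, hence so is their
      -- difference α - 2θ, which has coefficient -1 at θ and a positive one in B.
      have h0 : ⟪α - θ, θ⟫_ℝ = 0 := by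
        clear hpos
        generalize α - θ = u at h
        induction h using Submodule.span_induction with
        | mem x hx => rw [real_inner_comm]; exact hAB θ hθA x hx
        | zero => simp
        | add x y _ _ hx hy => rw [inner_add_left, hx, hy, add_zero]
        | smul a x _ hx => rw [inner_smul_left, hx, mul_zero]
      have h1 := hR.sub_mem_of_inner_eq_zero _ hpos.1 θ (hR.base_subset hθ) h0 (by simpa using hα.1)
      obtain ⟨φ, hφ, hφpos⟩ : ∃ φ ∈ B, 0 < R.coef φ (α - θ) := by
        by_contra! hcon
        have := hR.mem_span_of_coef (J := ∅) hpos.2 (fun φ hφ hp => by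
          by_cases hφB : φ ∈ B
          · exact absurd (hcon φ hφB) (not_le.mpr hp)
          · rw [hR.coef_eq_zero_of_mem_span hB h hφB] at hp; exact absurd hp (lt_irrefl _))
        rw [Submodule.span_empty] at this
        exact hR.ne_zero hpos.1 this
      refine hR.notMem_of_mixed φ θ ?_ ?_ h1
      · rw [map_sub, hR.coef_of_ne (φ := θ) hθ (fun h => hθB (h ▸ hφ)), sub_zero]; exact hφpos
      · rw [map_sub, hR.coef_eq_zero_of_mem_span hB h hθB, hR.coef_self hθ]; norm_num
  have ih' := ih _ hpos (by rw [map_sub, hR.ht_base hθ]; linarith) (fun φ hφ hp => by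
    refine hsupp φ hφ ?_
    have := hR.coef_nonneg φ (hR.base_pos hθ).2
    rw [map_sub] at hp; linarith)
  rcases hsupp θ hθ hθα with h | h
  · exact Or.inl (key A B hA hB hAB h ih')
  · exact Or.inr (key B A hB hA (fun a ha b hb => by rw [real_inner_comm]; exact hAB b hb a ha)
      h ih'.symm)

/-- If `α - v` is a root, one can descend from `α` by a simple root in the support of `v`. -/
theorem exists_sub_base_of_sub {α : E} (hα : α ∈ R.roots) : ∀ v ∈ R.pos, α - v ∈ R.roots →
    ∃ θ ∈ R.base, 0 < R.coef θ v ∧ (α - θ ∈ R.roots ∨ α = θ) := by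
  refine hR.pos_induction fun v hv ih hsub => ?_
  by_cases hb : v ∈ R.base
  · exact ⟨v, hb, by rw [hR.coef_self hb]; norm_num, Or.inl hsub⟩
  obtain ⟨θ, hθ, hθv, -, hpos⟩ := hR.exists_sub_base_pos hv hb
  have hlt : R.ht (v - θ) < R.ht v := by rw [map_sub, hR.ht_base hθ]; linarith
  have hle : ∀ φ, R.coef φ (v - θ) ≤ R.coef φ v := fun φ => by
    have := hR.coef_nonneg φ (hR.base_pos hθ).2
    rw [map_sub]; linarith
  -- By exchange, α - (v - θ) or α - θ is a root or zero. The first alternative continues the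
  -- descent with the lower root v - θ.
  have he := hR.exchange (α := α) (β := -(v - θ)) (γ := -θ) hα (hR.neg_mem_roots _ hpos.1)
    (hR.neg_mem_roots _ (hR.base_subset hθ)) (by convert hsub using 1; abel)
    (by
      have : -(v - θ) + -θ = -v := by abel
      rw [this]; exact neg_ne_zero.mpr (hR.ne_zero hv.1))
  rcases he with (h | h) | (h | h)
  · obtain ⟨φ, hφ, h1, h2⟩ := ih _ hpos hlt (by rwa [sub_eq_add_neg])
    exact ⟨φ, hφ, lt_of_lt_of_le h1 (hle φ), h2⟩
  · have hα' : α = v - θ := by rwa [← sub_eq_add_neg, sub_eq_zero] at h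
    rw [← hα'] at hpos hle
    by_cases hb' : α ∈ R.base
    · exact ⟨α, hb', lt_of_lt_of_le (by rw [hR.coef_self hb']; norm_num) (hle α), Or.inr rfl⟩
    · obtain ⟨φ, hφ, h1, -, h2⟩ := hR.exists_sub_base_pos hpos hb'
      exact ⟨φ, hφ, lt_of_lt_of_le h1 (hle φ), Or.inl h2.1⟩
  · exact ⟨θ, hθ, hθv, Or.inl (by rwa [sub_eq_add_neg])⟩
  · exact ⟨θ, hθ, hθv, Or.inr (by rwa [← sub_eq_add_neg, sub_eq_zero] at h)⟩

/-- A positive root with coefficient one at `i` can be lowered by a simple root other than `i`. -/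
theorem exists_sub_base_pos_of_coef_eq_one {α i : E} (hα : α ∈ R.pos) (hi : i ∈ R.base)
    (h1 : R.coef i α = 1) (hne : α ≠ i) :
    ∃ θ ∈ R.base, θ ≠ i ∧ 0 < R.coef θ α ∧ α - θ ∈ R.pos := by
  -- If ⟪α, i⟫ > 0, then v = α - i is a root not involving i and α - v = i is a root, so a simple
  -- root in the support of v can be subtracted. Otherwise ⟪α, α⟫ > 0 must come from a simple root
  -- other than i.
  by_cases hin : 0 < ⟪α, i⟫_ℝ
  · have hv := hR.sub_base_pos hα hi (hR.sub_mem_roots hα.1 (hR.base_subset hi) hin hne)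
    have hc0 : R.coef i (α - i) = 0 := by rw [map_sub, h1, hR.coef_self hi, sub_self]
    obtain ⟨θ, hθ, hp, h⟩ := hR.exists_sub_base_of_sub hα.1 (α - i) hv
      (by simpa using hR.base_subset hi)
    have hθi : θ ≠ i := by
      rintro rfl
      rw [hc0] at hp; exact lt_irrefl _ hp
    have hp' : 0 < R.coef θ α := by
      rwa [map_sub, hR.coef_of_ne hi hθi.symm, sub_zero] at hp
    rcases h with h | h
    · exact ⟨θ, hθ, hθi, hp', hR.sub_base_pos hα hθ h⟩
    · rw [h, hR.coef_of_ne hθ hθi] at h1; norm_num at h1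
  · have hw : 0 < ⟪α, α - i⟫_ℝ := by
      have := hR.inner_self_pos hα.1
      rw [inner_sub_right]; linarith
    by_cases hb : α ∈ R.base
    · rw [hR.coef_of_ne hb hne] at h1; norm_num at h1
    by_contra! hcon
    have key : ∀ u ∈ AddSubmonoid.closure {θ ∈ R.base | 0 < R.coef θ α}, ⟪α, u⟫_ℝ ≤ 0 := by
      intro u hu
      induction hu using AddSubmonoid.closure_induction with
      | mem x hx =>
        by_cases hxi : x = i
        · rw [hxi]; exact not_lt.mp hin
        · by_contra! hlt
          exact hcon x hx.1 hxi hx.2 (hR.sub_base_pos hα hx.1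
            (hR.sub_mem_roots hα.1 (hR.base_subset hx.1) hlt (fun h => hb (h ▸ hx.1))))
      | zero => simp
      | add x y _ _ hx hy => rw [inner_add_right]; linarith
    exact absurd (key α (hR.mem_closure_supp hα.2)) (not_le.mpr (hR.inner_self_pos hα.1))

end IsAdmissible
end BasedRoots

/-! ### Connected sets of simple roots -/

/-- A finite set of vectors that is not the union of two non-empty sets without negative inner
products between them. -/
def CutConnected (J : Finset E) : Prop :=
  ∀ A ⊆ J, A.Nonempty → A ≠ J → ∃ a ∈ A, ∃ b ∈ J, b ∉ A ∧ ⟪a, b⟫_ℝ < 0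

-- Used to build up the sum of a connected set of simple roots one neighbour at a time.
open Classical in
theorem CutConnected.induction {J : Finset E} (hJ : CutConnected J) {P : Finset E → Prop}
    {K : Finset E} (hK : K.Nonempty) (hKJ : K ⊆ J) (h0 : P K)
    (step : ∀ K' ⊆ J, K ⊆ K' → ∀ a ∈ K', ∀ b ∈ J, b ∉ K' → ⟪a, b⟫_ℝ < 0 → P K' →
      P (insert b K')) : P J := by
  obtain ⟨n, hn⟩ : ∃ n, J.card - K.card = n := ⟨_, rfl⟩
  suffices H : ∀ n, ∀ K' ⊆ J, K ⊆ K' → P K' → J.card - K'.card = n → P J from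
    H n K hKJ subset_rfl h0 hn
  intro n
  induction n with
  | zero =>
    intro K' hK' _ hP hc
    have : K' = J := Finset.eq_of_subset_of_card_le hK' (by omega)
    rwa [← this]
  | succ n ih =>
    intro K' hK' hKK' hP hc
    obtain ⟨a, ha, b, hb, hbK, hab⟩ := hJ K' hK' (hK.mono hKK') (by rintro rfl; omega)
    refine ih (insert b K') (Finset.insert_subset hb hK')
      (hKK'.trans (Finset.subset_insert b K')) (step K' hK' hKK' a ha b hb hbK hab hP) ?_
    rw [Finset.card_insert_of_notMem hbK]
    omega

namespace BasedRoots

namespace IsAdmissible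

variable {R : BasedRoots E} (hR : R.IsAdmissible)
include hR

theorem pos_of_pos_add {θ : E} {v w : E} (hw : w ∈ R.pos)
    (h : 0 < R.coef θ v) : 0 < R.coef θ (v + w) := by
  have := hR.coef_nonneg θ hw.2
  rw [map_add]; linarith

theorem mem_span_of_add {J : Set E} (hJ : J ⊆ R.base) {v w : E} (hv : v ∈ R.pos)
    (hw : w ∈ R.pos) (h : v + w ∈ Submodule.span ℝ J) : v ∈ Submodule.span ℝ J := by
  by_contra hn
  exact hR.add_notMem_span hJ hv hw hn h

theorem ht_pos {v : E} (hv : v ∈ R.pos) : 0 < R.ht v := by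
  linarith [hR.one_le_ht hv]

/-- Each partial sum has negative inner product with a neighbour not yet included, so the neighbour
may be added. -/
theorem sum_mem_pos {J : Finset E} (hJ : ∀ x ∈ J, x ∈ R.base) (hne : J.Nonempty)
    (hconn : CutConnected J) : ∑ x ∈ J, x ∈ R.pos := by
  classical
  obtain ⟨i, hi⟩ := hne
  refine hconn.induction (P := fun K => ∑ x ∈ K, x ∈ R.pos) (K := {i}) (by simp) (by simpa)
    (by simpa using hR.base_pos (hJ i hi)) fun K hK _ a ha b hb hbK hab hP => ?_
  rw [Finset.sum_insert hbK, add_comm]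
  refine hR.add_pos_of_inner_neg hP (hR.base_pos (hJ b hb)) ?_
  rw [sum_inner]
  refine Finset.sum_neg' (fun x hx => ?_) ⟨a, ha, hab⟩
  exact hR.inner_base_nonpos (hJ x (hK hx)) (hJ b hb) (fun h => hbK (h ▸ hx))

/-- The support of a positive root is connected. -/
theorem cutConnected_of_supp {α : E} (hα : α ∈ R.pos) {J : Finset E}
    (hJ : ∀ θ, θ ∈ J ↔ θ ∈ R.base ∧ 0 < R.coef θ α) : CutConnected J := by
  classical
  intro A hA hne hAJ
  by_contra! hcon
  have hA' : (A : Set E) ⊆ R.base := fun x hx => ((hJ x).1 (hA hx)).1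
  have hB' : ((J \ A : Finset E) : Set E) ⊆ R.base := fun x hx =>
    ((hJ x).1 (Finset.sdiff_subset hx)).1
  have := hR.mem_span_or_mem_span hA' hB' (fun a ha b hb => ?_) α hα fun θ hθ h => ?_
  · rcases this with h | h
    · apply hAJ
      refine subset_antisymm hA fun x hx => ?_
      exact (hR.mem_span_iff hA' hα).1 h x ((hJ x).1 hx).1 ((hJ x).1 hx).2
    · obtain ⟨x, hx⟩ := hne
      have := (hR.mem_span_iff hB' hα).1 h x ((hJ x).1 (hA hx)).1 ((hJ x).1 (hA hx)).2
      simp only [Finset.coe_sdiff, Set.mem_sdiff, Finset.mem_coe] at this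
      exact this.2 hx
  · have hb2 : b ∈ J ∧ b ∉ A := by simpa using hb
    refine le_antisymm (hR.inner_base_nonpos (hA' ha) (hB' hb) ?_) (hcon a ha b hb2.1 hb2.2)
    rintro rfl
    exact hb2.2 ha
  · have : θ ∈ J := (hJ θ).2 ⟨hθ, h⟩
    by_cases hθA : θ ∈ A
    · exact Or.inl hθA
    · right; simp [this, hθA]

/-- It locates a simple root responsible for the positivity of an inner product, and shows that a
vector of the span with all coefficients zero vanishes. -/
theorem inner_eq_sum {v : E} (hv : v ∈ Submodule.span ℝ R.base) (w : E) :
    ⟪w, v⟫_ℝ = ∑ θ ∈ hR.base_finite.toFinset, R.coef θ v * ⟪w, θ⟫_ℝ := by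
  induction hv using Submodule.span_induction with
  | mem x hx =>
    rw [Finset.sum_eq_single x]
    · rw [hR.coef_self hx, one_mul]
    · intro y _ hy
      rw [hR.coef_of_ne hx hy.symm, zero_mul]
    · intro h
      exact absurd (hR.base_finite.mem_toFinset.2 hx) h
  | zero => simp
  | add x y _ _ hx hy => simp only [inner_add_right, hx, hy, map_add, add_mul, Finset.sum_add_distrib]
  | smul a x _ hx =>
    rw [inner_smul_right, hx, Finset.mul_sum]
    exact Finset.sum_congr rfl fun θ _ => by rw [map_smul, smul_eq_mul, mul_assoc]

/-! ### Peeling arguments -/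

/-- Peeling off elements of `Z` from a root all of whose decompositions have a part in `Z`. -/
theorem exists_sub_mem_closure {Z : Set E} (hZ : Z ⊆ R.pos) {Q : E → Prop}
    (hQ : ∀ x ∈ R.pos, Q x → ∀ z ∈ Z, x - z ∈ R.pos → Q (x - z)) : ∀ x ∈ R.pos,
    (∀ y ∈ R.pos, ∀ y' ∈ R.pos, x = y + y' → y ∈ Z ∨ y' ∈ Z) → Q x →
    ∃ θ ∈ R.base, Q θ ∧ x - θ ∈ AddSubmonoid.closure Z := by
  refine hR.pos_induction fun x hx ih hdec hQx => ?_
  by_cases hb : x ∈ R.base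
  · exact ⟨x, hb, hQx, by simp⟩
  obtain ⟨θ, hθ, -, -, hpos⟩ := hR.exists_sub_base_pos hx hb
  have hex : {z | z ∈ Z ∧ x - z ∈ R.pos}.Nonempty := by
    rcases hdec _ hpos θ (hR.base_pos hθ) (by abel) with h | h
    · exact ⟨x - θ, h, by simpa using hR.base_pos hθ⟩
    · exact ⟨θ, h, hpos⟩
  -- Maximal height of z makes the hypothesis pass to x - z. If x - z = y + y' and z + y is a root,
  -- then z + y is too high to lie in Z, so the other part y' of x = (z + y) + y' does.
  obtain ⟨z, ⟨hzZ, hz⟩, hmax⟩ := Set.exists_max_image _ R.ht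
    (hR.pos_finite.subset fun _ h => hZ h.1) hex
  have hres := ih _ hz (by rw [map_sub]; linarith [hR.ht_pos (hZ hzZ)])
    (fun y hy y' hy' he => ?_) (hQ x hx hQx z hzZ hz)
  · obtain ⟨φ, hφ, hQφ, hcl⟩ := hres
    refine ⟨φ, hφ, hQφ, ?_⟩
    have : x - φ = z + (x - z - φ) := by abel
    rw [this]
    exact add_mem (AddSubmonoid.subset_closure hzZ) hcl
  · have key : ∀ y ∈ R.pos, ∀ y' ∈ R.pos, x - z = y + y' → z + y ∈ R.roots → y' ∈ Z := by
      intro y hy y' hy' he hzy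
      have hx' : x = (z + y) + y' := by rw [add_assoc, ← he]; abel
      refine (hdec _ (hR.add_pos (hZ hzZ) hy hzy) y' hy' hx').resolve_left fun h => ?_
      have := hmax (z + y) ⟨h, by rw [hx']; simpa using hy'⟩
      rw [map_add] at this
      linarith [hR.ht_pos hy]
    have hx' : z + y + y' = x := by rw [add_assoc, ← he]; abel
    rcases hR.exchange (hZ hzZ).1 hy.1 hy'.1 (by rw [hx']; exact hx.1)
      (hR.add_ne_zero hy hy') with (h | h) | (h | h)
    · exact Or.inr (key y hy y' hy' he h)
    · exact absurd h (hR.add_ne_zero (hZ hzZ) hy)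
    · exact Or.inl (key y' hy' y hy (by rw [he, add_comm]) h)
    · exact absurd h (hR.add_ne_zero (hZ hzZ) hy')

/-- If every decomposition of an element of `Φ` has a part in `Φ`, then a closed symmetric set of
roots containing `Φ` contains the simple roots in the supports of the elements of `Φ`. -/
theorem base_mem_of_closed {Φ Q : Set E} (hΦ : Φ ⊆ R.pos)
    (hdec : ∀ x ∈ R.pos, ∀ y ∈ R.pos, x + y ∈ Φ → x ∈ Φ ∨ y ∈ Φ)
    (hΦQ : Φ ⊆ Q) (hneg : ∀ x ∈ Q, -x ∈ Q)
    (hadd : ∀ x ∈ Q, ∀ y ∈ Q, x + y ∈ R.roots → x + y ∈ Q) : ∀ x ∈ R.pos, x ∈ Φ →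
    ∀ θ ∈ R.base, 0 < R.coef θ x → θ ∈ Q := by
  refine hR.pos_induction fun x hx ih hxΦ => ?_
  by_contra! hcon
  -- By induction every decomposition of x has a part in Z. Peeling off elements of Z stays inside Q
  -- and preserves the simple roots of the support that are not in Q. The simple root left at the
  -- end would be both in Q and outside it.
  set Z : Set E := {z ∈ Φ | ∀ θ ∈ R.base, 0 < R.coef θ z → θ ∈ Q}
  have hres := hR.exists_sub_mem_closure (Z := Z)
    (Q := fun x => x ∈ Q ∧ ∃ θ ∈ R.base, 0 < R.coef θ x ∧ θ ∉ Q) (fun z hz => hΦ hz.1)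
    (fun x hx hQx z hz hxz => ?_) x hx (fun y hy y' hy' he => ?_) ⟨hΦQ hxΦ, hcon⟩
  · obtain ⟨θ, hθ, ⟨hQ1, φ, hφ, hφθ, hφQ⟩, -⟩ := hres
    by_cases h : φ = θ
    · exact hφQ (h ▸ hQ1)
    · rw [hR.coef_of_ne hθ (Ne.symm h)] at hφθ; exact lt_irrefl _ hφθ
  · obtain ⟨hxQ, θ, hθ, h1, h2⟩ := hQx
    refine ⟨?_, θ, hθ, ?_, h2⟩
    · rw [sub_eq_add_neg]
      exact hadd _ hxQ _ (hneg z (hΦQ hz.1)) (by rw [← sub_eq_add_neg]; exact hxz.1)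
    · have : R.coef θ z = 0 := by
        refine le_antisymm ?_ (hR.coef_nonneg θ (hΦ hz.1).2)
        by_contra! h
        exact h2 (hz.2 θ hθ h)
      rwa [map_sub, this, sub_zero]
  · have h1 := hR.ht_pos hy
    have h2 := hR.ht_pos hy'
    subst he
    rcases hdec y hy y' hy' hxΦ with h | h
    · exact Or.inl ⟨h, ih y hy (by rw [map_add]; linarith) h⟩
    · exact Or.inr ⟨h, ih y' hy' (by rw [map_add]; linarith) h⟩

/-! ### Colors, supports and fibers -/

section Coloring

variable {c : E → E} (hc : R.IsColoring c)
include hc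

/-- A non-simple α splits as (α - θ) + θ and takes the color of one of the summands; the support of
either is contained in that of α. -/
theorem color_mem_supp : ∀ α ∈ R.pos, c α ∈ R.base ∧ 0 < R.coef (c α) α := by
  refine hR.pos_induction fun α hα ih => ?_
  by_cases hb : α ∈ R.base
  · rw [hc.base α hb, hR.coef_self hb]
    exact ⟨hb, by norm_num⟩
  obtain ⟨θ, hθ, hθα, -, hpos⟩ := hR.exists_sub_base_pos hα hb
  have h := hc.add _ hpos θ (hR.base_pos hθ) (by simpa using hα)
  rw [sub_add_cancel] at h
  rcases h with h | h
  · have := ih _ hpos (by rw [map_sub, hR.ht_base hθ]; linarith)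
    rw [h]
    refine ⟨this.1, ?_⟩
    have h2 := hR.coef_nonneg (c (α - θ)) (hR.base_pos hθ).2
    have h3 := this.2
    rw [map_sub] at h3; linarith
  · rw [h, hc.base θ hθ]
    exact ⟨hθ, hθα⟩

theorem color_mem {α : E} (hα : α ∈ R.pos) : c α ∈ R.base := (hR.color_mem_supp hc α hα).1

theorem coef_color_pos {α : E} (hα : α ∈ R.pos) : 0 < R.coef (c α) α :=
  (hR.color_mem_supp hc α hα).2

theorem color_add {α β : E} (hα : α ∈ R.pos) (hβ : β ∈ R.pos) (h : α + β ∈ R.roots) :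
    c (α + β) = c α ∨ c (α + β) = c β :=
  hc.add α hα β hβ (hR.add_pos hα hβ h)

/-- A root of color `j` and minimal height among those in `span T` that involve `i` differs from
`i` by a sum of roots of color `j` that do not involve `i`. -/
theorem exists_color_sub_mem_closure {T : Set E} (hT : T ⊆ R.base) {i j : E}
    (hex : ∃ γ ∈ R.pos, γ ∈ Submodule.span ℝ T ∧ c γ = j ∧ 0 < R.coef i γ) :
    ∃ γ ∈ R.pos, γ ∈ Submodule.span ℝ T ∧ c γ = j ∧ R.coef i γ = 1 ∧ i ∈ R.base ∧
      γ - i ∈ AddSubmonoid.closure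
        {y | y ∈ R.pos ∧ y ∈ Submodule.span ℝ T ∧ c y = j ∧ R.coef i y = 0} := by
  obtain ⟨γ, ⟨hγ, hγT, hγc, hγi⟩, hmin⟩ := Set.exists_min_image
    {γ | γ ∈ R.pos ∧ γ ∈ Submodule.span ℝ T ∧ c γ = j ∧ 0 < R.coef i γ} R.ht
    (hR.pos_finite.subset fun _ h => h.1) hex
  have hlow : ∀ y ∈ R.pos, ∀ y' ∈ R.pos, γ = y + y' → c y = j →
      y ∈ {y | y ∈ R.pos ∧ y ∈ Submodule.span ℝ T ∧ c y = j ∧ R.coef i y = 0} := by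
    intro y hy y' hy' he hcy
    have hyT := hR.mem_span_of_add hT hy hy' (he ▸ hγT)
    refine ⟨hy, hyT, hcy, ?_⟩
    refine le_antisymm ?_ (hR.coef_nonneg i hy.2)
    by_contra! hlt
    have := hmin y ⟨hy, hyT, hcy, hlt⟩
    rw [he, map_add] at this
    linarith [hR.ht_pos hy']
  -- Every decomposition of γ has a part of color j, which by minimality does not involve i and so
  -- can be peeled off. The remainder always involves i, hence ends as i itself.
  have hres := hR.exists_sub_mem_closure
    (Z := {y | y ∈ R.pos ∧ y ∈ Submodule.span ℝ T ∧ c y = j ∧ R.coef i y = 0})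
    (Q := fun x => 0 < R.coef i x) (fun z hz => hz.1)
    (fun x _ hx z hz _ => by rw [map_sub, hz.2.2.2, sub_zero]; exact hx) γ hγ
    (fun y hy y' hy' he => ?_) hγi
  · obtain ⟨θ, hθ, hθi, hcl⟩ := hres
    have hiθ : i = θ := by
      by_contra h
      rw [hR.coef_of_ne hθ (Ne.symm h)] at hθi; exact lt_irrefl _ hθi
    subst hiθ
    refine ⟨γ, hγ, hγT, hγc, ?_, hθ, hcl⟩
    have h0 : R.coef i (γ - i) = 0 := by
      generalize γ - i = u at hcl
      induction hcl using AddSubmonoid.closure_induction with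
      | mem x hx => exact hx.2.2.2
      | zero => simp
      | add x y _ _ hx hy => rw [map_add, hx, hy, add_zero]
    rw [map_sub, hR.coef_self hθ] at h0; linarith
  · rcases hR.color_add hc hy hy' (he ▸ hγ.1) with h | h
    · exact Or.inl (hlow y hy y' hy' he (by rw [← h, ← he, hγc]))
    · exact Or.inr (hlow y' hy' y hy (by rw [he, add_comm]) (by rw [← h, ← he, hγc]))

/-- A coloring is constant along the union of the supports of the roots of a given color. -/
theorem fibConst_supp (ψ : E) :
    R.FibConst c {θ ∈ R.base | ∃ α ∈ R.pos, c α = ψ ∧ 0 < R.coef θ α} := by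
  set J := {θ ∈ R.base | ∃ α ∈ R.pos, c α = ψ ∧ 0 < R.coef θ α} with hJdef
  have hJ : J ⊆ R.base := fun θ h => h.1
  -- The roots of span J whose addition or subtraction never changes a color outside span J.
  -- Exchange makes Q closed under sums; it contains the roots of color ψ, therefore the simple
  -- roots of J, therefore the positive roots of R_J.
  set Q : Set E := {β | β ∈ R.roots ∧ β ∈ Submodule.span ℝ J ∧ ∀ α ∈ R.pos,
    α ∉ Submodule.span ℝ J → (α + β ∈ R.roots → c (α + β) = c α) ∧
      (α - β ∈ R.roots → c (α - β) = c α)} with hQdef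
  have hout : ∀ α ∈ R.pos, α ∉ Submodule.span ℝ J → ∀ β ∈ Submodule.span ℝ J,
      α + β ∈ R.roots → α + β ∈ R.pos ∧ α + β ∉ Submodule.span ℝ J := by
    intro α hα hαJ β hβ h
    obtain ⟨θ, hθ, h1, h2⟩ := hR.exists_of_notMem_span hα hαJ
    refine ⟨hR.pos_of_coef_pos (θ := θ) h ?_, fun hs => hαJ ?_⟩
    · rwa [map_add, hR.coef_eq_zero_of_mem_span hJ hβ h1, add_zero]
    · simpa using sub_mem hs hβ
  have hneg : ∀ x ∈ Q, -x ∈ Q := by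
    rintro x ⟨h1, h2, h3⟩
    refine ⟨hR.neg_mem_roots x h1, neg_mem h2, fun α hα hαJ => ?_⟩
    rw [← sub_eq_add_neg, sub_neg_eq_add]
    exact ⟨(h3 α hα hαJ).2, (h3 α hα hαJ).1⟩
  have hadd' : ∀ x ∈ Q, ∀ y ∈ Q, x + y ∈ R.roots → ∀ α ∈ R.pos, α ∉ Submodule.span ℝ J →
      α + (x + y) ∈ R.roots → c (α + (x + y)) = c α := by
    rintro x ⟨hx1, hx2, hx3⟩ y ⟨hy1, hy2, hy3⟩ hxy α hα hαJ hsum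
    have key : ∀ x ∈ Submodule.span ℝ J, (α + x ∈ R.roots → c (α + x) = c α) →
        ∀ y, (∀ α ∈ R.pos, α ∉ Submodule.span ℝ J →
          (α + y ∈ R.roots → c (α + y) = c α)) → α + (x + y) ∈ R.roots →
        α + x ∈ R.roots → c (α + (x + y)) = c α := by
      intro x hx hcx y hcy hsum h
      have h2 := hout α hα hαJ x hx h
      rw [← add_assoc] at hsum ⊢
      rw [hcy _ h2.1 h2.2 hsum, hcx h]
    have hnz : ∀ x ∈ Submodule.span ℝ J, α + x ≠ 0 := fun x hx h =>
      hαJ (by rw [eq_neg_of_add_eq_zero_left h]; exact neg_mem hx)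
    rcases hR.exchange hα.1 hx1 hy1 (by rwa [add_assoc]) (hR.ne_zero hxy) with (h | h) | (h | h)
    · exact key x hx2 (hx3 α hα hαJ).1 y (fun α hα hαJ => (hy3 α hα hαJ).1) hsum h
    · exact absurd h (hnz x hx2)
    · rw [add_comm x y] at hsum ⊢
      exact key y hy2 (hy3 α hα hαJ).1 x (fun α hα hαJ => (hx3 α hα hαJ).1) hsum h
    · exact absurd h (hnz y hy2)
  have hadd : ∀ x ∈ Q, ∀ y ∈ Q, x + y ∈ R.roots → x + y ∈ Q := by
    intro x hx y hy hxy
    refine ⟨hxy, add_mem hx.2.1 hy.2.1, fun α hα hαJ => ⟨hadd' x hx y hy hxy α hα hαJ, ?_⟩⟩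
    have h := hadd' (-x) (hneg x hx) (-y) (hneg y hy)
      (by rw [← neg_add]; exact hR.neg_mem_roots _ hxy) α hα hαJ
    rwa [← neg_add, ← sub_eq_add_neg] at h
  have hspan : ∀ α ∈ R.pos, c α = ψ → α ∈ Submodule.span ℝ J := fun α hα h =>
    hR.mem_span_of_coef hα.2 fun θ hθ hp => ⟨hθ, α, hα, h, hp⟩
  -- All roots of color ψ lie in span J, so neither α nor α ± β can have the color ψ of β.
  have hsub : {α | α ∈ R.pos ∧ c α = ψ} ⊆ Q := by
    rintro β ⟨hβ, hβc⟩
    refine ⟨hβ.1, hspan β hβ hβc, fun α hα hαJ => ⟨fun h => ?_, fun h => ?_⟩⟩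
    · refine (hR.color_add hc hα hβ h).resolve_right fun h' => ?_
      exact (hout α hα hαJ β (hspan β hβ hβc) h).2 (hspan _ (hR.add_pos hα hβ h) (by rw [h', hβc]))
    · have h2 := hout α hα hαJ (-β) (neg_mem (hspan β hβ hβc)) (by rwa [← sub_eq_add_neg])
      rw [← sub_eq_add_neg] at h2
      have h3 := hR.color_add hc h2.1 hβ (by simpa using hα.1)
      rw [sub_add_cancel] at h3
      refine (h3.resolve_right fun h' => ?_).symm
      exact hαJ (hspan α hα (by rw [h', hβc]))
  have hbase : ∀ θ ∈ J, θ ∈ Q := by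
    rintro θ ⟨hθ, α, hα, hαc, hp⟩
    refine hR.base_mem_of_closed (Φ := {α | α ∈ R.pos ∧ c α = ψ}) (fun _ h => h.1) ?_ hsub hneg
      hadd α hα ⟨hα, hαc⟩ θ hθ hp
    rintro x hx y hy ⟨h1, h2⟩
    exact (hc.add x hx y hy h1).imp (fun h => ⟨hx, by rw [← h, h2]⟩)
      (fun h => ⟨hy, by rw [← h, h2]⟩)
  have hall : ∀ β ∈ R.pos, β ∈ Submodule.span ℝ J → β ∈ Q := by
    refine hR.pos_induction fun β hβ ih hβJ => ?_
    by_cases hb : β ∈ R.base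
    · exact hbase β ((hR.base_mem_span_iff hJ hb).1 hβJ)
    obtain ⟨θ, hθ, hθβ, -, hpos⟩ := hR.exists_sub_base_pos hβ hb
    have hθJ := (hR.mem_span_iff hJ hβ).1 hβJ θ hθ hθβ
    have := hadd (β - θ) (ih _ hpos (by rw [map_sub, hR.ht_base hθ]; linarith)
      (sub_mem hβJ (Submodule.subset_span hθJ))) θ (hbase θ hθJ) (by simpa using hβ.1)
    simpa using this
  intro α hα hαJ β hβ hβJ h
  exact ((hall β hβ hβJ).2.2 α hα hαJ).1 h

/-- A coloring that is constant along `I` is constant on the fibers of the projection. -/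
theorem color_eq_of_sub_mem_span {I : Set E} (hI : I ⊆ R.base) (hfib : R.FibConst c I)
    {α β : E} (hα : α ∈ R.pos) (hβ : β ∈ R.pos) (hαI : α ∉ Submodule.span ℝ I)
    (h : α - β ∈ Submodule.span ℝ I) : c α = c β := by
  -- Induction on the sum of the absolute values of the coefficients of α - β. As ⟪α - β, α - β⟫ >
  -- 0, some θ ∈ I has coefficient in α - β and inner product with α - β of the same sign. If both
  -- are positive, α can be lowered or β raised by θ, which brings them closer; the other case is
  -- symmetric.
  suffices H : ∀ n : ℕ, ∀ α ∈ R.pos, ∀ β ∈ R.pos, α ∉ Submodule.span ℝ I →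
      α - β ∈ Submodule.span ℝ I →
      ∑ θ ∈ hR.base_finite.toFinset, |R.coef θ (α - β)| ≤ n → c α = c β by
    obtain ⟨n, hn⟩ := exists_nat_ge (∑ θ ∈ hR.base_finite.toFinset, |R.coef θ (α - β)|)
    exact H n α hα β hβ hαI h hn
  intro n
  induction n with
  | zero =>
    intro α hα β hβ _ hd hn
    have hz : α - β = 0 := by
      by_contra hne
      have h1 : (0 : ℝ) < ⟪α - β, α - β⟫_ℝ := real_inner_self_pos.mpr hne
      rw [hR.inner_eq_sum (Submodule.span_mono hI hd)] at h1
      refine absurd h1 (not_lt.mpr (le_of_eq (Finset.sum_eq_zero fun θ hθ => ?_)))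
      have h2 := (Finset.single_le_sum (f := fun θ => |R.coef θ (α - β)|)
        (fun i _ => abs_nonneg _) hθ).trans hn
      rw [abs_nonpos_iff.mp (h2.trans_eq Nat.cast_zero), zero_mul]
    rw [sub_eq_zero.mp hz]
  | succ n ih =>
    have key : ∀ α ∈ R.pos, ∀ β ∈ R.pos, α ∉ Submodule.span ℝ I → β ∉ Submodule.span ℝ I →
        α - β ∈ Submodule.span ℝ I →
        ∑ θ ∈ hR.base_finite.toFinset, |R.coef θ (α - β)| ≤ (n + 1 : ℕ) →
        ∀ θ ∈ R.base, 0 < R.coef θ (α - β) → 0 < ⟪α - β, θ⟫_ℝ → c α = c β := by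
      intro α hα β hβ hαI hβI hd hn θ hθ h1 h2
      have hθI : θ ∈ I := by
        by_contra hn
        rw [hR.coef_eq_zero_of_mem_span hI hd hn] at h1; exact lt_irrefl _ h1
      have hθs := Submodule.subset_span (R := ℝ) hθI
      have hdec : ∑ φ ∈ hR.base_finite.toFinset, |R.coef φ (α - β - θ)| ≤ n := by
        have h3 : ∑ φ ∈ hR.base_finite.toFinset,
            (|R.coef φ (α - β)| - |R.coef φ (α - β - θ)|) = 1 := by
          rw [Finset.sum_eq_single θ]
          · obtain ⟨a, ha⟩ := hR.coef_int θ hα.1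
            obtain ⟨b, hb⟩ := hR.coef_int θ hβ.1
            have h4 : (1 : ℝ) ≤ R.coef θ (α - β) := by
              rw [map_sub, ha, hb] at h1 ⊢
              have h5 : (0 : ℤ) < a - b := by exact_mod_cast h1
              exact_mod_cast h5
            rw [map_sub _ (α - β), hR.coef_self hθ, abs_of_pos h1, abs_of_nonneg (by linarith)]
            ring
          · intro φ _ hφ
            rw [map_sub _ (α - β), hR.coef_of_ne hθ hφ.symm, sub_zero, sub_self]
          · intro h
            exact absurd (hR.base_finite.mem_toFinset.2 hθ) h
        rw [Finset.sum_sub_distrib] at h3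
        push_cast at hn
        linarith
      rw [inner_sub_left] at h2
      by_cases h3 : 0 < ⟪α, θ⟫_ℝ
      · have h4 := hR.sub_base_pos hα hθ (hR.sub_mem_roots hα.1 (hR.base_subset hθ) h3
          (fun h => hαI (h ▸ hθs)))
        have h5 : α - θ ∉ Submodule.span ℝ I := fun h => hαI (by simpa using add_mem h hθs)
        have h6 := hfib _ h4 h5 θ (hR.base_pos hθ) hθs (by simpa using hα.1)
        rw [sub_add_cancel] at h6
        rw [h6]
        have h7 : α - θ - β = α - β - θ := by abel
        exact ih _ h4 β hβ h5 (by rw [h7]; exact sub_mem hd hθs) (by rwa [h7])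
      · have h4 := hR.add_pos_of_inner_neg hβ (hR.base_pos hθ) (by linarith)
        rw [← hfib β hβ hβI θ (hR.base_pos hθ) hθs h4.1]
        have h7 : α - (β + θ) = α - β - θ := by abel
        exact ih α hα _ h4 hαI (by rw [h7]; exact sub_mem hd hθs) (by rwa [h7])
    intro α hα β hβ hαI hd hn
    by_cases hne : α = β
    · rw [hne]
    have hβI : β ∉ Submodule.span ℝ I := fun h => hαI (by simpa using add_mem hd h)
    have h1 : (0 : ℝ) < ⟪α - β, α - β⟫_ℝ := real_inner_self_pos.mpr (sub_ne_zero.mpr hne)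
    rw [hR.inner_eq_sum (Submodule.span_mono hI hd)] at h1
    obtain ⟨θ, hθ, h2⟩ : ∃ θ ∈ hR.base_finite.toFinset,
        0 < R.coef θ (α - β) * ⟪α - β, θ⟫_ℝ := by
      by_contra! hcon
      exact absurd (Finset.sum_nonpos hcon) (not_le.mpr h1)
    rw [hR.base_finite.mem_toFinset] at hθ
    rcases pos_and_pos_or_neg_and_neg_of_mul_pos h2 with ⟨h3, h4⟩ | ⟨h3, h4⟩
    · exact key α hα β hβ hαI hβI hd hn θ hθ h3 h4
    · have hs : β - α = -(α - β) := by abel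
      refine (key β hβ α hα hβI hαI ?_ ?_ θ hθ ?_ ?_).symm
      · rw [hs]; exact neg_mem hd
      · simpa only [hs, map_neg, abs_neg] using hn
      · rw [hs, map_neg]; linarith
      · rw [hs, inner_neg_left]; linarith

/-- Split α as (α - θ) + θ. If one summand lies in span I, the other one dictates the color; if
neither does, both of their colors lie outside I by induction. -/
theorem color_notMem_of_notMem_span {I : Set E} (hI : I ⊆ R.base) (hfib : R.FibConst c I) :
    ∀ α ∈ R.pos, α ∉ Submodule.span ℝ I → c α ∉ I := by
  refine hR.pos_induction fun α hα ih hαI => ?_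
  by_cases hb : α ∈ R.base
  · rw [hc.base α hb]
    exact fun h => hαI (Submodule.subset_span h)
  obtain ⟨θ, hθ, hθα, -, hpos⟩ := hR.exists_sub_base_pos hα hb
  have hlt : R.ht (α - θ) < R.ht α := by rw [map_sub, hR.ht_base hθ]; linarith
  have he : α - θ + θ = α := by abel
  by_cases hθI : θ ∈ I
  · have h1 : α - θ ∉ Submodule.span ℝ I := fun h =>
      hαI (by simpa using add_mem h (Submodule.subset_span hθI))
    have h2 := hfib _ hpos h1 θ (hR.base_pos hθ) (Submodule.subset_span hθI) (by rw [he]; exact hα.1)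
    rw [he] at h2
    rw [h2]
    exact ih _ hpos hlt h1
  · have hθs : θ ∉ Submodule.span ℝ I := fun h => hθI ((hR.base_mem_span_iff hI hθ).1 h)
    by_cases h1 : α - θ ∈ Submodule.span ℝ I
    · have h2 := hfib θ (hR.base_pos hθ) hθs _ hpos h1 (by rw [add_comm, he]; exact hα.1)
      rw [add_comm, he, hc.base θ hθ] at h2
      rwa [h2]
    · have h2 := hR.color_add hc hpos (hR.base_pos hθ) (by rw [he]; exact hα.1)
      rw [he] at h2
      rcases h2 with h2 | h2
      · rw [h2]; exact ih _ hpos hlt h1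
      · rw [h2, hc.base θ hθ]; exact hθI

/-- The color of the sum of a connected set of simple roots containing the color of the sum of all
simple roots. -/
theorem color_sum {J S : Finset E} (hS : ∀ x ∈ S, x ∈ R.base) (hconn : CutConnected S)
    (hJS : J ⊆ S) (hJ : ∑ x ∈ J, x ∈ R.pos) (hτ : c (∑ x ∈ S, x) ∈ J) :
    c (∑ x ∈ J, x) = c (∑ x ∈ S, x) := by
  classical
  by_contra hne
  -- Neighbours b are added one at a time. The color of the full sum already lies in J, so it
  -- differs from every added b, and a partial sum without that color can never acquire it.
  have := hconn.induction
    (P := fun K => ∑ x ∈ K, x ∈ R.pos ∧ c (∑ x ∈ K, x) ≠ c (∑ x ∈ S, x)) (K := J)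
    ⟨_, hτ⟩ hJS ⟨hJ, hne⟩ fun K hK hJK a ha b hb hbK hab hP => ?_
  · exact this.2 rfl
  rw [Finset.sum_insert hbK, add_comm]
  have hb' := hR.base_pos (hS b hb)
  have h1 : (∑ x ∈ K, x) + b ∈ R.pos := by
    refine hR.add_pos_of_inner_neg hP.1 hb' ?_
    rw [sum_inner]
    refine Finset.sum_neg' (fun x hx => ?_) ⟨a, ha, hab⟩
    exact hR.inner_base_nonpos (hS x (hK hx)) (hS b hb) (fun h => hbK (h ▸ hx))
  refine ⟨h1, ?_⟩
  rcases hc.add _ hP.1 b hb' h1 with h | h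
  · rw [h]; exact hP.2
  · rw [h, hc.base b (hS b hb)]
    rintro rfl
    exact hbK (hJK hτ)

end Coloring

end IsAdmissible
end BasedRoots

/-! ### Strings of roots and configurations of three simple roots -/

namespace BasedRoots
namespace IsAdmissible

variable {R : BasedRoots E} (hR : R.IsAdmissible)
include hR

/-- With coefficient one at i, the root can be lowered by a simple root other than i, which can only
be j. -/
theorem add_nsmul_pos {i j : E} (hi : i ∈ R.base) (hj : j ∈ R.base) (hij : i ≠ j) {s : ℕ}
    (hs : i + s • j ∈ R.pos) : ∀ t ≤ s, i + t • j ∈ R.pos := by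
  intro t ht
  induction ht using Nat.decreasingInduction with
  | self => exact hs
  | of_succ t _ h =>
    obtain ⟨θ, hθ, hθi, hp, hsub⟩ := hR.exists_sub_base_pos_of_coef_eq_one h hi
      (by simp [hR.coef_self hi, hR.coef_of_ne hj hij.symm])
      (by
        intro h
        have h2 : (t + 1) • j = 0 := by simpa using h
        have h3 := congrArg (R.coef j) h2
        rw [map_nsmul, hR.coef_self hj, map_zero, nsmul_eq_mul] at h3
        push_cast at h3
        have : (0 : ℝ) ≤ t := by positivity
        linarith)
    have hθj : θ = j := by
      by_contra hne
      rw [map_add, map_nsmul, hR.coef_of_ne hi hθi.symm, hR.coef_of_ne hj (Ne.symm hne)] at hp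
      simp at hp
    subst hθj
    convert hsub using 1
    module

section Coloring

variable {c : E → E} (hc : R.IsColoring c)
include hc

theorem color_eq_or_eq {i j : E} {v : E} (hv : v ∈ R.pos)
    (h : ∀ θ ∈ R.base, θ ≠ i → θ ≠ j → R.coef θ v = 0) : c v = i ∨ c v = j := by
  obtain ⟨h1, h2⟩ := hR.color_mem_supp hc v hv
  by_contra! hcon
  rw [h _ h1 hcon.1 hcon.2] at h2
  exact lt_irrefl _ h2

/-- The least multiple of `j` whose sum with `i` has color `j`, if there is one. -/
theorem exists_min_string {i j : E} (hi : i ∈ R.base) (hj : j ∈ R.base) (hij : i ≠ j)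
    (hs : ∃ s : ℕ, i + s • j ∈ R.pos ∧ c (i + s • j) = j) :
    ∃ s : ℕ, 1 ≤ s ∧ (∀ t ≤ s, i + t • j ∈ R.pos) ∧ c (i + s • j) = j ∧
      ∀ t < s, c (i + t • j) = i := by
  classical
  have h := Nat.find_spec hs
  refine ⟨Nat.find hs, ?_, hR.add_nsmul_pos hi hj hij h.1, h.2, fun t ht => ?_⟩
  · by_contra! h0
    have h0' : Nat.find hs = 0 := by omega
    have h2 := h.2
    rw [h0', zero_nsmul, add_zero, hc.base i hi] at h2
    exact hij h2
  · have hp := hR.add_nsmul_pos hi hj hij h.1 t ht.le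
    refine (hR.color_eq_or_eq hc (j := j) hp fun θ _ h1 h2 => ?_).resolve_right fun h' =>
      Nat.find_min hs ht ⟨hp, h'⟩
    simp [hR.coef_of_ne hi h1.symm, hR.coef_of_ne hj h2.symm]

/-- Take s minimal. For 1 ≤ t < s the root i + t j + k has color i: beyond t = 1, the decompositions
(i + t j) + k and (i + (t - 1) j + k) + j leave no other choice. For t = s, these two and (i + (s -
1) j) + (j + k) allow {j, k}, {i, j} and {i, k}, which have no common element. -/
theorem false_of_string {i j k : E} (hi : i ∈ R.base) (hj : j ∈ R.base) (hk : k ∈ R.base)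
    (hij : i ≠ j) (hik : i ≠ k) (hjk : j ≠ k) (hσ : i + j + k ∈ R.pos) (hcσ : c (i + j + k) = i)
    (hneg : ⟪j, k⟫_ℝ < 0) (hcjk : c (j + k) = k)
    (hs : ∃ s : ℕ, i + s • j ∈ R.pos ∧ c (i + s • j) = j) : False := by
  obtain ⟨s, hs1, hroot, hcs, hct⟩ := hR.exists_min_string hc hi hj hij hs
  have hs2 : s ≠ 1 := by
    rintro rfl
    have h1 := hroot 1 le_rfl
    rw [one_nsmul] at hcs h1
    rcases hc.add _ h1 k (hR.base_pos hk) hσ with h | h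
    · rw [hcσ, hcs] at h; exact hij h
    · rw [hcσ, hc.base k hk] at h; exact hik h
  have hjk' := hR.add_pos_of_inner_neg (hR.base_pos hj) (hR.base_pos hk) hneg
  have hw : ∀ t, 1 ≤ t → t ≤ s → i + t • j + k ∈ R.pos := by
    intro t h1 h2
    refine hR.add_pos_of_inner_neg (hroot t h2) (hR.base_pos hk) ?_
    have h3 := hR.inner_base_nonpos hi hk hik
    have h4 : (1 : ℝ) ≤ t := by exact_mod_cast h1
    rw [inner_add_left, ← Nat.cast_smul_eq_nsmul ℝ, inner_smul_left]
    simp only [conj_trivial]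
    nlinarith
  have hcw : ∀ t, 1 ≤ t → t < s → c (i + t • j + k) = i := by
    intro t h1
    induction t, h1 using Nat.le_induction with
    | base => intro _; rwa [one_nsmul]
    | succ t h1 ih =>
      intro h2
      have e : i + (t + 1) • j + k = i + t • j + k + j := by module
      have h3 := hw (t + 1) (by omega) h2.le
      have h4 := hc.add _ (hroot (t + 1) h2.le) k (hR.base_pos hk) h3
      have h5 := hc.add _ (hw t h1 (by omega)) j (hR.base_pos hj) (e ▸ h3)
      rw [hct (t + 1) h2, hc.base k hk] at h4
      rw [← e, ih (by omega), hc.base j hj] at h5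
      rcases h4 with h4 | h4
      · exact h4
      · rcases h5 with h5 | h5
        · exact h5
        · exact absurd (h5.symm.trans h4) hjk
  obtain ⟨t, rfl⟩ : ∃ t, s = t + 2 := ⟨s - 2, by omega⟩
  have h3 := hw (t + 2) (by omega) le_rfl
  have e1 : i + (t + 2) • j + k = i + (t + 1) • j + k + j := by module
  have e2 : i + (t + 2) • j + k = i + (t + 1) • j + (j + k) := by module
  have h4 := hc.add _ (hroot (t + 2) le_rfl) k (hR.base_pos hk) h3
  have h5 := hc.add _ (hw (t + 1) (by omega) (by omega)) j (hR.base_pos hj) (e1 ▸ h3)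
  have h6 := hc.add _ (hroot (t + 1) (by omega)) _ hjk' (e2 ▸ h3)
  rw [hcs, hc.base k hk] at h4
  rw [← e1, hcw (t + 1) (by omega) (by omega), hc.base j hj] at h5
  rw [← e2, hct (t + 1) (by omega), hcjk] at h6
  rcases h4 with h4 | h4 <;> rcases h5 with h5 | h5 <;> rcases h6 with h6 | h6 <;>
    rw [h4] at h5 h6 <;> simp_all

/-- With r and s minimal, 2i + r j + s k is a root. As the sum of the two string ends it has color j
or k; splitting off k or j from it leaves a root of color i, which allows only {i, k} and {i, j}. -/
theorem false_of_two_strings {i j k : E} (hi : i ∈ R.base) (hj : j ∈ R.base) (hk : k ∈ R.base)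
    (hij : i ≠ j) (hik : i ≠ k) (hjk : j ≠ k) (hσ : i + j + k ∈ R.pos) (hcσ : c (i + j + k) = i)
    (horth : ⟪j, k⟫_ℝ = 0) (hnegj : ⟪i, j⟫_ℝ < 0) (hnegk : ⟪i, k⟫_ℝ < 0)
    (hr : ∃ r : ℕ, i + r • j ∈ R.pos ∧ c (i + r • j) = j)
    (hs : ∃ s : ℕ, i + s • k ∈ R.pos ∧ c (i + s • k) = k) : False := by
  obtain ⟨r, hr1, hrootj, hcr, hcj⟩ := hR.exists_min_string hc hi hj hij hr
  obtain ⟨s, hs1, hrootk, hcs, hck⟩ := hR.exists_min_string hc hi hk hik hs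
  have e0 : i + j + k = i + k + j := by abel
  have hr2 : r ≠ 1 := by
    rintro rfl
    have h1 := hrootj 1 le_rfl
    rw [one_nsmul] at hcr h1
    rcases hc.add _ h1 k (hR.base_pos hk) hσ with h | h
    · rw [hcσ, hcr] at h; exact hij h
    · rw [hcσ, hc.base k hk] at h; exact hik h
  have hs2 : s ≠ 1 := by
    rintro rfl
    have h1 := hrootk 1 le_rfl
    rw [one_nsmul] at hcs h1
    rcases hc.add _ h1 j (hR.base_pos hj) (e0 ▸ hσ) with h | h
    · rw [← e0, hcσ, hcs] at h; exact hik h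
    · rw [← e0, hcσ, hc.base j hj] at h; exact hij h
  have hkj : ⟪k, j⟫_ℝ = 0 := by rw [real_inner_comm]; exact horth
  -- The difference of the two roots has coefficient t > 0 at j and -u < 0 at k, so it cannot be a
  -- root.
  have hle : ∀ t u, 1 ≤ t → t ≤ r → 1 ≤ u → u ≤ s → ⟪i + t • j, i + u • k⟫_ℝ ≤ 0 := by
    intro t u h1 h2 h3 h4
    by_contra! hlt
    have cj : R.coef j (i + t • j - (i + u • k)) = t := by
      simp [hR.coef_self hj, hR.coef_of_ne hk hjk.symm]
    have ck : R.coef k (i + t • j - (i + u • k)) = -u := by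
      simp [hR.coef_self hk, hR.coef_of_ne hj hjk]
    have h1' : (0 : ℝ) < t := by exact_mod_cast h1
    have h3' : (0 : ℝ) < u := by exact_mod_cast h3
    refine hR.notMem_of_mixed j k (by rw [cj]; exact h1') (by rw [ck]; linarith)
      (hR.sub_mem_roots (hrootj t h2).1 (hrootk u h4).1 hlt fun h => ?_)
    rw [h, sub_self, map_zero] at cj
    linarith
  have hexpand : ∀ t u : ℕ, ⟪i + t • j, i + u • k⟫_ℝ = ⟪i, i⟫_ℝ + t * ⟪i, j⟫_ℝ + u * ⟪i, k⟫_ℝ := by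
    intro t u
    simp only [← Nat.cast_smul_eq_nsmul ℝ, inner_add_left, inner_add_right, inner_smul_left,
      inner_smul_right, conj_trivial, horth, real_inner_comm i j]
    ring
  -- The inner product is at most zero for t = u = 1 and strictly decreases in t and in u, so it is
  -- negative as soon as t + u > 2.
  have hroot2 : ∀ t u, 1 ≤ t → t ≤ r → 1 ≤ u → u ≤ s → 2 < t + u →
      i + t • j + (i + u • k) ∈ R.pos := by
    intro t u h1 h2 h3 h4 h5
    refine hR.add_pos_of_inner_neg (hrootj t h2) (hrootk u h4) ?_
    have h6 := hle 1 1 le_rfl hr1 le_rfl hs1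
    rw [hexpand] at h6 ⊢
    have h1' : (1 : ℝ) ≤ t := by exact_mod_cast h1
    have h3' : (1 : ℝ) ≤ u := by exact_mod_cast h3
    have h5' : (2 : ℝ) < t + u := by exact_mod_cast h5
    push_cast at h6
    rcases lt_or_eq_of_le h1' with h | h
    · nlinarith
    · have : (1 : ℝ) < u := by linarith
      nlinarith
  have hijpos : c (i + j) = i := by
    have := hcj 1 (by omega)
    rwa [one_nsmul] at this
  have hikpos : c (i + k) = i := by
    have := hck 1 (by omega)
    rwa [one_nsmul] at this
  have hju : ∀ u ≤ s, i + u • k + j ∈ R.pos := fun u hu => by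
    refine hR.add_pos_of_inner_neg (hrootk u hu) (hR.base_pos hj) ?_
    rw [inner_add_left, ← Nat.cast_smul_eq_nsmul ℝ, inner_smul_left, hkj]
    linarith
  have hkt : ∀ t ≤ r, i + t • j + k ∈ R.pos := fun u hu => by
    refine hR.add_pos_of_inner_neg (hrootj u hu) (hR.base_pos hk) ?_
    rw [inner_add_left, ← Nat.cast_smul_eq_nsmul ℝ, inner_smul_left, horth]
    linarith
  have hcju : ∀ u < s, c (i + u • k + j) = i := by
    intro u
    induction u with
    | zero => intro _; rwa [zero_nsmul, add_zero]
    | succ u ih =>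
      intro h2
      have e : i + (u + 1) • k + j = i + u • k + j + k := by module
      have h3 := hju (u + 1) h2.le
      have h4 := hc.add _ (hrootk (u + 1) h2.le) j (hR.base_pos hj) h3
      have h5 := hc.add _ (hju u (by omega)) k (hR.base_pos hk) (e ▸ h3)
      rw [hck (u + 1) h2, hc.base j hj] at h4
      rw [← e, ih (by omega), hc.base k hk] at h5
      rcases h4 with h4 | h4
      · exact h4
      · rcases h5 with h5 | h5
        · exact h5
        · exact absurd (h4.symm.trans h5) hjk
  have hckt : ∀ u < r, c (i + u • j + k) = i := by
    intro u
    induction u with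
    | zero => intro _; rwa [zero_nsmul, add_zero]
    | succ u ih =>
      intro h2
      have e : i + (u + 1) • j + k = i + u • j + k + j := by module
      have h3 := hkt (u + 1) h2.le
      have h4 := hc.add _ (hrootj (u + 1) h2.le) k (hR.base_pos hk) h3
      have h5 := hc.add _ (hkt u (by omega)) j (hR.base_pos hj) (e ▸ h3)
      rw [hcj (u + 1) h2, hc.base k hk] at h4
      rw [← e, ih (by omega), hc.base j hj] at h5
      rcases h4 with h4 | h4
      · exact h4
      · rcases h5 with h5 | h5
        · exact h5
        · exact absurd (h5.symm.trans h4) hjk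
  obtain ⟨r, rfl⟩ : ∃ t, r = t + 2 := ⟨r - 2, by omega⟩
  obtain ⟨s, rfl⟩ : ∃ t, s = t + 2 := ⟨s - 2, by omega⟩
  have h1 : c (i + (r + 2) • j + (i + (s + 1) • k)) = i := by
    have e : i + (r + 2) • j + (i + (s + 1) • k) = i + (r + 1) • j + (i + (s + 1) • k + j) := by
      module
    have h := hroot2 (r + 2) (s + 1) (by omega) le_rfl (by omega) (by omega) (by omega)
    rw [e] at h ⊢
    have h2 := hc.add _ (hrootj (r + 1) (by omega)) _ (hju (s + 1) (by omega)) h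
    rwa [hcj _ (by omega), hcju _ (by omega), or_self] at h2
  have h2 : c (i + (r + 1) • j + (i + (s + 2) • k)) = i := by
    have e : i + (r + 1) • j + (i + (s + 2) • k) = i + (s + 1) • k + (i + (r + 1) • j + k) := by
      module
    have h := hroot2 (r + 1) (s + 2) (by omega) (by omega) (by omega) le_rfl (by omega)
    rw [e] at h ⊢
    have h2 := hc.add _ (hrootk (s + 1) (by omega)) _ (hkt (r + 1) (by omega)) h
    rwa [hck _ (by omega), hckt _ (by omega), or_self] at h2
  have h3 := hroot2 (r + 2) (s + 2) (by omega) le_rfl (by omega) le_rfl (by omega)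
  have e1 : i + (r + 2) • j + (i + (s + 2) • k) = i + (r + 2) • j + (i + (s + 1) • k) + k := by
    module
  have e2 : i + (r + 2) • j + (i + (s + 2) • k) = i + (r + 1) • j + (i + (s + 2) • k) + j := by
    module
  have h4 := hc.add _ (hrootj (r + 2) le_rfl) _ (hrootk (s + 2) le_rfl) h3
  have h5 := hc.add _ (hroot2 (r + 2) (s + 1) (by omega) le_rfl (by omega) (by omega) (by omega)) k
    (hR.base_pos hk) (e1 ▸ h3)
  have h6 := hc.add _ (hroot2 (r + 1) (s + 2) (by omega) (by omega) (by omega) le_rfl (by omega)) j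
    (hR.base_pos hj) (e2 ▸ h3)
  rw [hcr, hcs] at h4
  rw [← e1, h1, hc.base k hk] at h5
  rw [← e2, h2, hc.base j hj] at h6
  rcases h4 with h4 | h4 <;> rcases h5 with h5 | h5 <;> rcases h6 with h6 | h6 <;>
    rw [h4] at h5 h6 <;> simp_all

end Coloring

end IsAdmissible
end BasedRoots

/-! ### The lexicographic argument in rank three -/

namespace BasedRoots
namespace IsAdmissible

variable {R : BasedRoots E} (hR : R.IsAdmissible)
include hR

section Coloring

variable {c : E → E} (hc : R.IsColoring c)
include hc

/-- The setting of the rank three argument: simple roots `p`, `a`, `b`, the sum of which has color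
`p`, such that `a + b` has color `a` and a minimal multiple `m` for which `a + m b` has color `b`;
moreover a root `ζ` which is lexicographically minimal among the roots with coefficient one at `p`
that are not of color `p`. -/
theorem false_of_lexMin {p a b : E} (hp : p ∈ R.base) (ha : a ∈ R.base) (hb : b ∈ R.base)
    (hpa : p ≠ a) (hpb : p ≠ b) (hab : a ≠ b) (hbase : ∀ θ ∈ R.base, θ = p ∨ θ = a ∨ θ = b)
    (hσ : p + a + b ∈ R.pos) (hcσ : c (p + a + b) = p)
    (hneg : ⟪a, b⟫_ℝ < 0) (hcab : c (a + b) = a)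
    (hm : ∃ m : ℕ, a + m • b ∈ R.pos ∧ c (a + m • b) = b)
    {ζ : E} (hζ : ζ ∈ R.pos) (hζ1 : R.coef p ζ = 1) (hcζ : c ζ ≠ p)
    (hmin : ∀ α ∈ R.pos, R.coef p α = 1 → (R.coef a α < R.coef a ζ ∨
      R.coef a α = R.coef a ζ ∧ R.coef b α < R.coef b ζ) → c α = p) : False := by
  obtain ⟨m, hm1, hy, hcm, hcy⟩ := hR.exists_min_string hc ha hb hab hm
  have hpp := hR.coef_self hp
  have haa := hR.coef_self ha
  have hbb := hR.coef_self hb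
  have cpa : R.coef p a = 0 := hR.coef_of_ne ha hpa.symm
  have cpb : R.coef p b = 0 := hR.coef_of_ne hb hpb.symm
  have cap : R.coef a p = 0 := hR.coef_of_ne hp hpa
  have cab : R.coef a b = 0 := hR.coef_of_ne hb hab.symm
  have cbp : R.coef b p = 0 := hR.coef_of_ne hp hpb
  have cba : R.coef b a = 0 := hR.coef_of_ne ha hab
  have hab' := hR.add_pos_of_inner_neg (hR.base_pos ha) (hR.base_pos hb) hneg
  have hba : ⟪b, a⟫_ℝ < 0 := by rwa [real_inner_comm]
  have hζp : ζ ≠ p := by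
    rintro rfl
    exact hcζ (hc.base _ hp)
  have low : ∀ α ∈ R.pos, R.coef p α = 1 → α ≠ p → α - a ∈ R.pos ∨ α - b ∈ R.pos := by
    intro α hα h1 hne
    obtain ⟨θ, hθ, hθp, -, h⟩ := hR.exists_sub_base_pos_of_coef_eq_one hα hp h1 hne
    rcases hbase θ hθ with rfl | rfl | rfl
    · exact absurd rfl hθp
    · exact Or.inl h
    · exact Or.inr h
  have hcols : c ζ = a ∨ c ζ = b := (hbase _ (hR.color_mem hc hζ)).resolve_left hcζ
  rcases hcols with hcζ' | hcζ'
  · -- `ζ` has color `a`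
    have hB1 : 1 ≤ R.coef a ζ := by
      have := hR.coef_color_pos hc hζ
      rw [hcζ'] at this
      exact hR.one_le_coef hζ.2 this
    -- Otherwise ζ - b has color p by minimality, and ζ = (ζ - b) + b has color p or b.
    have hζb : ζ - b ∉ R.roots := by
      intro h
      have h1 := hR.sub_base_pos hζ hb h
      have h2 := hmin _ h1 (by rw [map_sub, hζ1, cpb, sub_zero])
        (Or.inr ⟨by rw [map_sub, cab, sub_zero], by rw [map_sub, hbb]; linarith⟩)
      have h3 := hc.add _ h1 b (hR.base_pos hb) (by simpa using hζ)
      rw [sub_add_cancel, h2, hc.base b hb, hcζ'] at h3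
      rcases h3 with h3 | h3
      · exact hpa h3.symm
      · exact hab h3
    have hx0 : ζ - a ∈ R.pos := (low ζ hζ hζ1 hζp).resolve_right fun h => hζb h.1
    -- Here ζ = p + C b + a. The values C = 0 and C = 1 contradict the color p of p + a + b; for C ≥
    -- 2 the vector ζ - b would be a root.
    by_cases hB : R.coef a ζ = 1
    · obtain ⟨C, hC⟩ := hR.coef_nat b hx0.2
      have hsum : ζ - a = p + C • b := by
        have h0 : ζ - a - (p + C • b) = 0 := by
          have hs : ζ - a - (p + C • b) ∈ Submodule.span ℝ R.base := by
            have h1 : ζ ∈ Submodule.span ℝ R.base := Submodule.closure_subset_span hζ.2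
            have hsub := fun x hx => Submodule.subset_span (R := ℝ) (s := R.base) (a := x) hx
            exact sub_mem (sub_mem h1 (hsub a ha))
              (add_mem (hsub p hp) (nsmul_mem (hsub b hb) C))
          rw [← inner_self_eq_zero (𝕜 := ℝ), hR.inner_eq_sum hs]
          refine Finset.sum_eq_zero fun θ hθ => ?_
          rw [hR.base_finite.mem_toFinset] at hθ
          have : R.coef θ (ζ - a - (p + C • b)) = 0 := by
            rw [map_sub _ (ζ - a)]
            rcases hbase θ hθ with rfl | rfl | rfl
            · simp [hζ1, cpa, cpb, hpp]
            · simp [hB, haa, cap, cab]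
            · rw [hC]; simp [cbp, hbb]
          rw [this, zero_mul]
        exact sub_eq_zero.mp h0
      have hζe : ζ = p + C • b + a := by rw [← hsum]; abel
      rw [hsum] at hx0
      match C, hζe, hx0 with
      | 0, hζe, hx0 =>
        rw [zero_nsmul, add_zero] at hζe
        have h := hc.add ζ hζ b (hR.base_pos hb) (by rw [hζe]; exact hσ)
        rw [hcζ', hζe, hcσ, hc.base b hb] at h
        rcases h with h | h
        · exact hpa h
        · exact hpb h
      | 1, hζe, hx0 =>
        refine hcζ ?_
        rw [hζe, one_nsmul, add_right_comm, hcσ]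
      | C + 2, hζe, hx0 =>
        have h1 := hR.add_nsmul_pos hp hb hpb hx0 (C + 1) (by omega)
        refine hζb ?_
        have h2 : ζ - b = p + (C + 1) • b + a := by rw [hζe]; module
        rw [h2]
        refine (hR.add_pos_of_inner_neg h1 (hR.base_pos ha) ?_).1
        have h3 := hR.inner_base_nonpos hp ha hpa
        rw [inner_add_left, ← Nat.cast_smul_eq_nsmul ℝ, inner_smul_left]
        simp only [conj_trivial]
        push_cast
        have : (0 : ℝ) ≤ C := by positivity
        nlinarith
    · have hB2 : 1 < R.coef a ζ := lt_of_le_of_ne hB1 (Ne.symm hB)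
      -- Walk up the string a + s b, keeping a root z = x + (a + s b) of color a. As b + z - x is a
      -- root, exchange lets z grow by b or x shrink by b. In the first case the new color lies in
      -- {a, b} and in {p, a}.
      have hind : ∀ s < m, ∃ z ∈ R.pos, ∃ x ∈ R.pos, z = x + (a + s • b) ∧
          R.coef a x = R.coef a ζ - 1 ∧ R.coef p x = 1 ∧ c z = a := by
        intro s
        induction s with
        | zero =>
          intro _
          exact ⟨ζ, hζ, ζ - a, hx0, by simp, by rw [map_sub, haa],
            by rw [map_sub, hζ1, cpa, sub_zero], hcζ'⟩
        | succ s ih =>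
          intro hs
          obtain ⟨z, hz, x, hx, hzx, hxa, hxp, hcz⟩ := ih (by omega)
          have hys := hy (s + 1) (by omega)
          have h1 := hR.exchange (α := b) (β := z) (γ := -x) (hR.base_subset hb) hz.1
            (hR.neg_mem_roots x hx.1) (by convert hys.1 using 1; rw [hzx]; module)
            (by
              rw [hzx]
              have : x + (a + s • b) + -x = a + s • b := by abel
              rw [this]
              exact hR.ne_zero (hy s (by omega)).1)
          rcases h1 with (h1 | h1) | (h1 | h1)
          · have h2 := hR.add_pos (hR.base_pos hb) hz h1
            refine ⟨b + z, h2, x, hx, by rw [hzx]; module, hxa, hxp, ?_⟩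
            have e : b + z = x + (a + (s + 1) • b) := by rw [hzx]; module
            have h3 := hc.add b (hR.base_pos hb) z hz h2
            have h4 := hc.add x hx _ hys (e ▸ h2)
            rw [hcz, hc.base b hb] at h3
            rw [← e, hcy (s + 1) hs, hmin x hx hxp (Or.inl (by linarith))] at h4
            rcases h3 with h3 | h3
            · rcases h4 with h4 | h4
              · exact absurd (h4.symm.trans h3) hpb
              · exact h4
            · exact h3
          · exact absurd h1 (hR.add_ne_zero (hR.base_pos hb) hz)
          · have h2 : x - b ∈ R.roots := by
              convert hR.neg_mem_roots _ h1 using 1; abel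
            exact ⟨z, hz, x - b, hR.sub_base_pos hx hb h2, by rw [hzx]; module,
              by rw [map_sub, cab, sub_zero, hxa], by rw [map_sub, cpb, sub_zero, hxp], hcz⟩
          · have h2 : R.coef p (b + -x) = 0 := by rw [h1, map_zero]
            rw [map_add, map_neg, cpb, hxp] at h2
            norm_num at h2
      obtain ⟨n, rfl⟩ : ∃ n, m = n + 1 := ⟨m - 1, by omega⟩
      obtain ⟨z, hz, x, hx, hzx, hxa, hxp, hcz⟩ := hind n (by omega)
      -- κ is the end of the string, of color b. Roots with coefficient one at p and a smaller
      -- coefficient at a than ζ have color p. Hence x - b is not a root, as z = (x - b) + κ has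
      -- color a, and x + b is not a root, as z + b = (x + b) + (a + n b) will have color b.
      set κ := a + (n + 1) • b with hκ
      have hκpos : κ ∈ R.pos := hy (n + 1) le_rfl
      have hlow : ∀ α ∈ R.pos, R.coef p α = 1 → R.coef a α < R.coef a ζ → c α = p :=
        fun α hα h1 h2 => hmin α hα h1 (Or.inl h2)
      have hcx : c x = p := hlow x hx hxp (by linarith)
      have hxb : x - b ∉ R.roots := by
        intro h
        have h1 := hR.sub_base_pos hx hb h
        have e : z = x - b + κ := by rw [hzx, hκ]; module
        have h2 := hc.add _ h1 κ hκpos (e ▸ hz)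
        rw [← e, hcz, hcm, hlow _ h1 (by rw [map_sub, hxp, cpb, sub_zero])
          (by rw [map_sub, cab]; linarith)] at h2
        rcases h2 with h2 | h2
        · exact hpa h2.symm
        · exact hab h2
      have hbx : b + -x ≠ 0 := by
        intro h
        have h2 : R.coef p (b + -x) = 0 := by rw [h, map_zero]
        rw [map_add, map_neg, cpb, hxp] at h2
        norm_num at h2
      have hzb : z + b ∈ R.pos := by
        have h1 := hR.exchange (α := b) (β := z) (γ := -x) (hR.base_subset hb) hz.1
          (hR.neg_mem_roots x hx.1) (by convert hκpos.1 using 1; rw [hzx, hκ]; module)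
          (by
            rw [hzx]
            have : x + (a + n • b) + -x = a + n • b := by abel
            rw [this]
            exact hR.ne_zero (hy n (by omega)).1)
        rcases h1 with (h1 | h1) | (h1 | h1)
        · rw [add_comm]; exact hR.add_pos (hR.base_pos hb) hz h1
        · exact absurd h1 (hR.add_ne_zero (hR.base_pos hb) hz)
        · exact absurd (by convert hR.neg_mem_roots _ h1 using 1; abel) hxb
        · exact absurd h1 hbx
      have ezb : z + b = x + κ := by rw [hzx, hκ]; module
      have hczb : c (z + b) = b := by
        have h3 := hc.add z hz b (hR.base_pos hb) hzb
        have h4 := hc.add x hx _ hκpos (ezb ▸ hzb)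
        rw [hcz, hc.base b hb] at h3
        rw [← ezb, hcm, hcx] at h4
        rcases h3 with h3 | h3
        · rcases h4 with h4 | h4
          · exact absurd (h4.symm.trans h3) hpa
          · exact h4
        · exact h3
      have hxb' : x + b ∉ R.roots := by
        intro h
        have h1 := hR.add_pos hx (hR.base_pos hb) h
        have e : z + b = x + b + (a + n • b) := by rw [hzx]; module
        have h2 := hc.add _ h1 _ (hy n (by omega)) (e ▸ hzb)
        rw [← e, hczb, hcy n (by omega), hlow _ h1 (by rw [map_add, hxp, cpb, add_zero])
          (by rw [map_add, cab]; linarith)] at h2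
        rcases h2 with h2 | h2
        · exact hpb h2.symm
        · exact hab h2.symm
      have hxb0 : x + b ≠ 0 := hR.add_ne_zero hx (hR.base_pos hb)
      have hxp' : x ≠ p := by
        rintro rfl
        linarith
      have hxa' : x - a ∈ R.pos := (low x hx hxp hxp').resolve_right fun h => hxb h.1
      have hxy : ∀ s ≤ n + 1, x - (a + s • b) ∈ R.roots := by
        intro s
        induction s with
        | zero => intro _; simpa using hxa'.1
        | succ s ih =>
          intro hs
          have h0 := ih (by omega)
          have h1 := hR.exchange (α := x) (β := -(a + (s + 1) • b)) (γ := b) hx.1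
            (hR.neg_mem_roots _ (hy _ hs).1) (hR.base_subset hb)
            (by convert h0 using 1; module)
            (by
              have : -(a + (s + 1) • b) + b = -(a + s • b) := by module
              rw [this]
              exact neg_ne_zero.mpr (hR.ne_zero (hy s (by omega)).1))
          rcases h1 with (h1 | h1) | (h1 | h1)
          · rwa [sub_eq_add_neg]
          · have h2 : R.coef p (x + -(a + (s + 1) • b)) = 0 := by rw [h1, map_zero]
            simp [hxp, cpa, cpb] at h2
          · exact absurd h1 hxb'
          · exact absurd h1 hxb0
      have hxyp : ∀ s ≤ n, x + (a + s • b) ∈ R.pos ∧ c (x + (a + s • b)) = a := by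
        intro s hs
        induction hs using Nat.decreasingInduction with
        | self => rw [← hzx]; exact ⟨hz, hcz⟩
        | of_succ s hs ih =>
          have hys := hy s (by omega)
          have e : x + (a + s • b) + b = x + (a + (s + 1) • b) := by module
          have h1 := hR.exchange (α := x) (β := a + s • b) (γ := b) hx.1 hys.1
            (hR.base_subset hb) (by rw [e]; exact ih.1.1)
            (hR.add_ne_zero hys (hR.base_pos hb))
          have h2 : x + (a + s • b) ∈ R.pos := by
            rcases h1 with (h1 | h1) | (h1 | h1)
            · exact hR.add_pos hx hys h1
            · exact absurd h1 (hR.add_ne_zero hx hys)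
            · exact absurd h1 hxb'
            · exact absurd h1 hxb0
          have h3 := hc.add _ h2 b (hR.base_pos hb) (by rw [e]; exact ih.1)
          rw [e, ih.2, hc.base b hb] at h3
          exact ⟨h2, (h3.resolve_right hab).symm⟩
      have hxa2 := hxyp 0 (by omega)
      rw [zero_nsmul, add_zero] at hxa2
      have horth : ⟪x, b⟫_ℝ = 0 := by
        refine le_antisymm ?_ ?_
        · by_contra! h
          refine hxb (hR.sub_mem_roots hx.1 (hR.base_subset hb) h ?_)
          rintro rfl
          linarith
        · by_contra! h
          exact hxb' (hR.add_mem_roots _ hx.1 _ (hR.base_subset hb) h hxb0)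
      have hstr : ∀ t : ℕ, x - (t + 1) • b ∉ R.roots := by
        intro t
        induction t with
        | zero => rw [zero_add, one_nsmul]; exact hxb
        | succ t ih =>
          intro h
          refine ih ?_
          have e : x - (t + 1) • b = x - (t + 1 + 1) • b + b := by module
          rw [e]
          refine hR.add_mem_roots _ h b (hR.base_subset hb) ?_ ?_
          · rw [inner_sub_left, horth, ← Nat.cast_smul_eq_nsmul ℝ, inner_smul_left]
            simp only [conj_trivial]
            push_cast
            have h5 := hR.inner_self_pos (hR.base_subset hb)
            have : (0 : ℝ) ≤ t := by positivity
            nlinarith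
          · rw [← e]
            intro h1
            have h2 : R.coef p (x - (t + 1) • b) = 0 := by rw [h1, map_zero]
            simp [hxp, cpb] at h2
      have hxκ := hxy (n + 1) le_rfl
      rw [← hκ] at hxκ
      have hxκp : x - κ ∈ R.pos := hR.pos_of_coef_pos (θ := p) hxκ (by
        rw [hκ]; simp [hxp, cpa, cpb])
      -- Exchange for the root x + a = a + (x - κ) + κ. The alternative a + (x - κ) = x - (n + 1) b
      -- is not a root, since no positive multiple of b can be subtracted from x.
      have haκ : a + κ ∈ R.pos := by
        have h1 := hR.exchange (α := a) (β := x - κ) (γ := κ) (hR.base_subset ha) hxκ hκpos.1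
          (by convert hxa2.1.1 using 1; abel) (by rw [sub_add_cancel]; exact hR.ne_zero hx.1)
        rcases h1 with (h1 | h1) | (h1 | h1)
        · exact absurd (by convert h1 using 1; rw [hκ]; abel) (hstr n)
        · have h2 : R.coef p (a + (x - κ)) = 0 := by rw [h1, map_zero]
          rw [hκ] at h2
          simp [hxp, cpa, cpb] at h2
        · exact hR.add_pos (hR.base_pos ha) hκpos h1
        · exact absurd h1 (hR.add_ne_zero (hR.base_pos ha) hκpos)
      have hcaκ : c (a + κ) = a := by
        have e : x + a = x - κ + (a + κ) := by abel
        have h1 := hc.add _ hxκp _ haκ (e ▸ hxa2.1)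
        rw [← e, hxa2.2, hlow _ hxκp (by rw [hκ]; simp [hxp, cpa, cpb])
          (by rw [hκ]; simp [haa, cab, hxa]; linarith)] at h1
        rcases h1 with h1 | h1
        · exact absurd h1.symm hpa
        · exact h1.symm
      -- The final conflict: z + b has color b, but is the sum of x - a of color p and a + κ of
      -- color a.
      have e : z + b = x - a + (a + κ) := by rw [ezb]; abel
      have h1 := hc.add _ hxa' _ haκ (e ▸ hzb)
      rw [← e, hczb, hcaκ, hlow _ hxa' (by rw [map_sub, hxp, cpa, sub_zero])
        (by rw [map_sub, hxa, haa]; linarith)] at h1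
      rcases h1 with h1 | h1
      · exact hpb h1.symm
      · exact hab h1.symm
  · -- `ζ` has color `b`
    -- Such a root ζ - y would have a smaller coefficient at a, hence color p, and ζ would have
    -- color p or a.
    have F1 : ∀ y ∈ R.pos, R.coef p y = 0 → c y = a → ζ - y ∉ R.roots := by
      intro y hyp hy0 hcy h
      have h1 := hR.pos_of_coef_pos (θ := p) h (by rw [map_sub, hζ1, hy0]; norm_num)
      have hya : 1 ≤ R.coef a y := by
        have := hR.coef_color_pos hc hyp
        rw [hcy] at this
        exact hR.one_le_coef hyp.2 this
      have h2 := hmin _ h1 (by rw [map_sub, hζ1, hy0, sub_zero])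
        (Or.inl (by rw [map_sub]; linarith))
      have h3 := hc.add _ h1 y hyp (by simpa using hζ)
      rw [sub_add_cancel, hcζ', h2, hcy] at h3
      rcases h3 with h3 | h3
      · exact hpb h3.symm
      · exact hab h3.symm
    have hx : ζ - b ∈ R.pos := (low ζ hζ hζ1 hζp).resolve_left fun h =>
      F1 a (hR.base_pos ha) cpa (hc.base a ha) h.1
    have hcx : c (ζ - b) = p := hmin _ hx (by rw [map_sub, hζ1, cpb, sub_zero])
      (Or.inr ⟨by rw [map_sub, cab, sub_zero], by rw [map_sub, hbb]; linarith⟩)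
    by_cases h0 : R.coef a ζ = 0
    · obtain ⟨C, hC⟩ := hR.coef_nat b hζ.2
      have hsum : ζ = p + C • b := by
        have h0 : ζ - (p + C • b) = 0 := by
          have hs : ζ - (p + C • b) ∈ Submodule.span ℝ R.base := by
            have h1 : ζ ∈ Submodule.span ℝ R.base := Submodule.closure_subset_span hζ.2
            have hsub := fun x hx => Submodule.subset_span (R := ℝ) (s := R.base) (a := x) hx
            exact sub_mem h1 (add_mem (hsub p hp) (nsmul_mem (hsub b hb) C))
          rw [← inner_self_eq_zero (𝕜 := ℝ), hR.inner_eq_sum hs]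
          refine Finset.sum_eq_zero fun θ hθ => ?_
          rw [hR.base_finite.mem_toFinset] at hθ
          have : R.coef θ (ζ - (p + C • b)) = 0 := by
            rcases hbase θ hθ with rfl | rfl | rfl
            · simp [hζ1, cpb, hpp]
            · simp [h0, cap, cab]
            · simp [hC, cbp, hbb]
          rw [this, zero_mul]
        exact sub_eq_zero.mp h0
      have e1 : p + b + a = p + a + b := by abel
      exact hR.false_of_string hc hp hb ha hpb hpa hab.symm (e1 ▸ hσ) (by rw [e1, hcσ]) hba
        (by rw [add_comm, hcab]) ⟨C, hsum ▸ hζ, by rw [← hsum, hcζ']⟩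
    · have ha1 : 0 < R.coef a ζ := lt_of_le_of_ne (hR.coef_nonneg a hζ.2) (Ne.symm h0)
      -- Otherwise ζ - (a + b) is a root although a + b has color a, against `F1`.
      have hxa : ⟪ζ - b, a⟫_ℝ ≤ 0 := by
        by_contra! h
        have h1 := hR.sub_mem_roots hx.1 (hR.base_subset ha) h (fun h => by
          have : R.coef p (ζ - b) = R.coef p a := by rw [h]
          rw [map_sub, hζ1, cpb, cpa] at this; norm_num at this)
        exact F1 (a + b) hab' (by rw [map_add, cpa, cpb, add_zero]) hcab
          (by convert h1 using 1; abel)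
      have hζa : ζ + a ∈ R.pos := by
        refine hR.add_pos_of_inner_neg hζ (hR.base_pos ha) ?_
        rw [inner_sub_left] at hxa
        linarith
      have hcζa : c (ζ + a) = a := by
        have e : ζ + a = ζ - b + (a + b) := by abel
        have h1 := hc.add ζ hζ a (hR.base_pos ha) hζa
        have h2 := hc.add _ hx _ hab' (e ▸ hζa)
        rw [← e, hcx, hcab] at h2
        rw [hcζ', hc.base a ha] at h1
        rcases h1 with h1 | h1
        · rcases h2 with h2 | h2
          · exact absurd (h2.symm.trans h1) hpb
          · exact h2
        · exact h1
      -- Each ζ - k b can be lowered by a or by b, and lowering by a would subtract a + k b, of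
      -- color a, from ζ. At k = m the decomposition ζ + a = (ζ - m b) + (a + m b) gives color p or
      -- b, against the color a of ζ + a.
      have hk : ∀ k ≤ m, ζ - k • b ∈ R.pos := by
        intro k
        induction k with
        | zero => intro _; simpa using hζ
        | succ k ih =>
          intro hk
          have h1 := low _ (ih (by omega)) (by simp [hζ1, cpb]) (fun h => by
            have : R.coef a (ζ - k • b) = R.coef a p := by rw [h]
            simp [cab, cap] at this
            exact h0 this)
          have e1 : ζ - k • b - a = ζ - (a + k • b) := by abel
          have e2 : ζ - k • b - b = ζ - (k + 1) • b := by module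
          rw [e1, e2] at h1
          exact h1.resolve_left fun h => F1 _ (hy k (by omega)) (by simp [cpa, cpb])
            (hcy k (by omega)) h.1
      have hm' := hk m le_rfl
      have hm1' : (1 : ℝ) ≤ m := by exact_mod_cast hm1
      have e : ζ + a = ζ - m • b + (a + m • b) := by abel
      have h1 := hc.add _ hm' _ (hy m le_rfl) (e ▸ hζa)
      rw [← e, hcζa, hcm, hmin _ hm' (by simp [hζ1, cpb])
        (Or.inr ⟨by simp [cab], by simp [hbb]; linarith⟩)] at h1
      rcases h1 with h1 | h1
      · exact hpa h1.symm
      · exact hab h1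

/-- A counterexample can be chosen with least coefficient at a and then with least coefficient at b,
which `false_of_lexMin` excludes. -/
theorem color_eq_of_coef_eq_one {p a b : E} (hp : p ∈ R.base) (ha : a ∈ R.base) (hb : b ∈ R.base)
    (hpa : p ≠ a) (hpb : p ≠ b) (hab : a ≠ b) (hbase : ∀ θ ∈ R.base, θ = p ∨ θ = a ∨ θ = b)
    (hσ : p + a + b ∈ R.pos) (hcσ : c (p + a + b) = p)
    (hneg : ⟪a, b⟫_ℝ < 0) (hcab : c (a + b) = a)
    (hm : ∃ m : ℕ, a + m • b ∈ R.pos ∧ c (a + m • b) = b)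
    {α : E} (hα : α ∈ R.pos) (h1 : R.coef p α = 1) : c α = p := by
  by_contra hne
  obtain ⟨ζ₁, ⟨h2, h3, h4⟩, hmin₁⟩ := Set.exists_min_image
    {α | α ∈ R.pos ∧ R.coef p α = 1 ∧ c α ≠ p} (R.coef a)
    (hR.pos_finite.subset fun _ h => h.1) ⟨α, hα, h1, hne⟩
  obtain ⟨ζ, ⟨h5, h6, h7, h8⟩, hmin₂⟩ := Set.exists_min_image
    {α | α ∈ R.pos ∧ R.coef p α = 1 ∧ c α ≠ p ∧ R.coef a α = R.coef a ζ₁} (R.coef b)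
    (hR.pos_finite.subset fun _ h => h.1) ⟨ζ₁, h2, h3, h4, rfl⟩
  refine hR.false_of_lexMin hc hp ha hb hpa hpb hab hbase hσ hcσ hneg hcab hm h5 h6 h7
    fun β hβ hβ1 hlt => ?_
  by_contra hβp
  rcases hlt with hlt | ⟨he, hlt⟩
  · rw [h8] at hlt
    exact absurd (hmin₁ β ⟨hβ, hβ1, hβp⟩) (not_le.mpr hlt)
  · exact absurd (hmin₂ β ⟨hβ, hβ1, hβp, he.trans h8⟩) (not_le.mpr hlt)

end Coloring

end IsAdmissible
end BasedRoots

/-! ### Existence of a color with proper support -/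

open Classical in
theorem CutConnected.union {J K : Finset E} (hJ : CutConnected J) (hK : CutConnected K) {x : E}
    (hxJ : x ∈ J) (hxK : x ∈ K) : CutConnected (J ∪ K) := by
  intro A hA hne hAJK
  have key : ∀ J K : Finset E, CutConnected J → CutConnected K → x ∈ J → x ∈ K → A ⊆ J ∪ K →
      A ≠ J ∪ K → (A ∩ J).Nonempty → ∃ a ∈ A, ∃ b ∈ J ∪ K, b ∉ A ∧ ⟪a, b⟫_ℝ < 0 := by
    intro J K hJ hK hxJ hxK hA hAJK hAJ
    by_cases h1 : A ∩ J = J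
    · have hxA : x ∈ A := Finset.inter_eq_right.mp h1 hxJ
      obtain ⟨a, ha, b, hb, hbA, hab⟩ := hK (A ∩ K) Finset.inter_subset_right
        ⟨x, Finset.mem_inter.2 ⟨hxA, hxK⟩⟩ fun h => hAJK (subset_antisymm hA
          (Finset.union_subset (Finset.inter_eq_right.mp h1) (Finset.inter_eq_right.mp h)))
      exact ⟨a, (Finset.mem_inter.1 ha).1, b, Finset.mem_union_right _ hb,
        fun h => hbA (Finset.mem_inter.2 ⟨h, hb⟩), hab⟩
    · obtain ⟨a, ha, b, hb, hbA, hab⟩ := hJ (A ∩ J) Finset.inter_subset_right hAJ h1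
      exact ⟨a, (Finset.mem_inter.1 ha).1, b, Finset.mem_union_left _ hb,
        fun h => hbA (Finset.mem_inter.2 ⟨h, hb⟩), hab⟩
  obtain ⟨y, hy⟩ := hne
  rcases Finset.mem_union.1 (hA hy) with h | h
  · exact key J K hJ hK hxJ hxK hA hAJK ⟨y, Finset.mem_inter.2 ⟨hy, h⟩⟩
  · rw [Finset.union_comm] at hA hAJK ⊢
    exact key K J hK hJ hxK hxJ hA hAJK ⟨y, Finset.mem_inter.2 ⟨hy, h⟩⟩

namespace BasedRoots

/-- There is a set of all but one or two simple roots along which the coloring is constant. -/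
def HasFibration (R : BasedRoots E) (c : E → E) : Prop :=
  ∃ I ⊆ R.base, ((R.base \ I).ncard = 1 ∨ (R.base \ I).ncard = 2) ∧ R.FibConst c I

namespace IsAdmissible

variable {R : BasedRoots E} (hR : R.IsAdmissible)
include hR

theorem mem_closure_of_mem_span {J : Set E} (hJ : J ⊆ R.base) {α : E}
    (hα : α ∈ AddSubmonoid.closure R.base) (h : α ∈ Submodule.span ℝ J) :
    α ∈ AddSubmonoid.closure J := by
  refine AddSubmonoid.closure_mono ?_ (hR.mem_closure_supp hα)
  rintro θ ⟨-, h2⟩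
  by_contra hn
  rw [hR.coef_eq_zero_of_mem_span hJ h hn] at h2
  exact lt_irrefl _ h2

theorem pos_sub {J : Set E} (hJ : J ⊆ R.base) :
    (R.sub J).pos = R.pos ∩ (Submodule.span ℝ J : Set E) := by
  ext α
  constructor
  · rintro ⟨⟨h1, h2⟩, h3⟩
    exact ⟨⟨h1, AddSubmonoid.closure_mono hJ h3⟩, h2⟩
  · rintro ⟨⟨h1, h2⟩, h3⟩
    exact ⟨⟨h1, h3⟩, hR.mem_closure_of_mem_span hJ h2 h3⟩

theorem sub {J : Set E} (hJ : J ⊆ R.base) : (R.sub J).IsAdmissible where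
  finite := hR.finite.subset Set.inter_subset_left
  zero_notMem h := hR.zero_notMem h.1
  neg_mem_roots α h := ⟨hR.neg_mem_roots α h.1, neg_mem (S := Submodule ℝ E) h.2⟩
  add_mem_roots α hα β hβ h hne :=
    ⟨hR.add_mem_roots α hα.1 β hβ.1 h hne, add_mem (S := Submodule ℝ E) hα.2 hβ.2⟩
  sub_mem_of_inner_eq_zero α hα β hβ h hs :=
    ⟨hR.sub_mem_of_inner_eq_zero α hα.1 β hβ.1 h hs.1, sub_mem (S := Submodule ℝ E) hα.2 hβ.2⟩
  isBase := by
    refine ⟨fun θ hθ => ⟨hR.base_subset (hJ hθ), Submodule.subset_span hθ⟩,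
      hR.isBase.linearIndepOn.mono hJ, ?_, ?_⟩
    · refine le_antisymm (Submodule.span_mono fun θ hθ =>
        ⟨hR.base_subset (hJ hθ), Submodule.subset_span hθ⟩) ?_
      rw [Submodule.span_le]
      exact fun x hx => hx.2
    · rintro α ⟨h1, h2⟩
      rcases hR.isBase.mem_or_neg_mem α h1 with h | h
      · exact Or.inl (hR.mem_closure_of_mem_span hJ h h2)
      · exact Or.inr (hR.mem_closure_of_mem_span hJ h (neg_mem (S := Submodule ℝ E) h2))

theorem isColoring_sub {c : E → E} (hc : R.IsColoring c) {J : Set E} (hJ : J ⊆ R.base) :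
    (R.sub J).IsColoring c where
  base θ hθ := hc.base θ (hJ hθ)
  add α hα β hβ h := by
    rw [hR.pos_sub hJ] at hα hβ h
    exact hc.add α hα.1 β hβ.1 h.1

section Coloring

variable {c : E → E} (hc : R.IsColoring c)
include hc

theorem color_mem_of_mem_span {J : Set E} (hJ : J ⊆ R.base) {α : E} (hα : α ∈ R.pos)
    (h : α ∈ Submodule.span ℝ J) : c α ∈ J :=
  (hR.mem_span_iff hJ hα).1 h _ (hR.color_mem hc hα) (hR.coef_color_pos hc hα)

/-- Applied to the proper subsystems R_T of the induction: the roots of R_T outside span I are left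
with the one or two colors in T \ I. -/
theorem fibration_color {T I : Set E} (hT : T ⊆ R.base) (hI : I ⊆ T)
    (hfib : (R.sub T).FibConst c I) {α : E} (hα : α ∈ R.pos) (hαT : α ∈ Submodule.span ℝ T)
    (hαI : α ∉ Submodule.span ℝ I) : c α ∈ T \ I := by
  have hα' : α ∈ (R.sub T).pos := by rw [hR.pos_sub hT]; exact ⟨hα, hαT⟩
  exact ⟨hR.color_mem_of_mem_span hc hT hα hαT,
    (hR.sub hT).color_notMem_of_notMem_span (hR.isColoring_sub hc hT) hI hfib α hα' hαI⟩

/-- Were the union T of the two supports proper, the structure theorem for R_T would allow at most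
two colors outside span I. But the sum of T is a root of color τ, so τ ∉ I, and it is joined by β
and β' as a third and different color. -/
theorem coef_pos_or_coef_pos {S : Finset E} (hS : ∀ x, x ∈ S ↔ x ∈ R.base)
    (hconn : CutConnected S)
    (hind : ∀ T ⊆ R.base, T ≠ R.base → T.Nonempty → (R.sub T).HasFibration c)
    {β β' : E} (hβ : β ∈ R.pos) (hβ' : β' ∈ R.pos) (hτ : 0 < R.coef (c (∑ x ∈ S, x)) β)
    (hτ' : 0 < R.coef (c (∑ x ∈ S, x)) β') (hne : c β ≠ c (∑ x ∈ S, x))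
    (hne' : c β' ≠ c (∑ x ∈ S, x)) (hββ : c β ≠ c β') {θ : E} (hθ : θ ∈ R.base) :
    0 < R.coef θ β ∨ 0 < R.coef θ β' := by
  classical
  by_contra! hcon
  set τ := c (∑ x ∈ S, x) with hτdef
  set A := S.filter fun θ => 0 < R.coef θ β
  set B := S.filter fun θ => 0 < R.coef θ β'
  have hA : ∀ θ, θ ∈ A ↔ θ ∈ R.base ∧ 0 < R.coef θ β := fun θ => by
    simp only [A, Finset.mem_filter, hS]
  have hB : ∀ θ, θ ∈ B ↔ θ ∈ R.base ∧ 0 < R.coef θ β' := fun θ => by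
    simp only [B, Finset.mem_filter, hS]
  have hτbase : τ ∈ R.base := by
    by_contra h
    have : R.coef τ β = 0 := by
      refine hR.coef_eq_zero_of_mem_span subset_rfl (Submodule.closure_subset_span hβ.2) h
    linarith
  have hABconn : CutConnected (A ∪ B) := (hR.cutConnected_of_supp hβ hA).union
    (hR.cutConnected_of_supp hβ' hB) ((hA τ).2 ⟨hτbase, hτ⟩) ((hB τ).2 ⟨hτbase, hτ'⟩)
  have hABS : A ∪ B ⊆ S := Finset.union_subset (Finset.filter_subset _ _) (Finset.filter_subset _ _)
  have hτAB : τ ∈ A ∪ B := Finset.mem_union_left _ ((hA τ).2 ⟨hτbase, hτ⟩)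
  have hTbase : ((A ∪ B : Finset E) : Set E) ⊆ R.base := fun x hx => (hS x).1 (hABS hx)
  have hpos := hR.sum_mem_pos (fun x hx => hTbase hx) ⟨τ, hτAB⟩ hABconn
  obtain ⟨I, hI, hcard, hfib⟩ := hind _ hTbase
    (fun h => by
      have : θ ∈ A ∪ B := by rw [← Finset.mem_coe, h]; exact hθ
      rcases Finset.mem_union.1 this with h | h
      · linarith [((hA θ).1 h).2]
      · linarith [((hB θ).1 h).2]) ⟨τ, hτAB⟩
  change I ⊆ ((A ∪ B : Finset E) : Set E) at hI
  set T : Set E := ((A ∪ B : Finset E) : Set E) with hT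
  change (T \ I).ncard = 1 ∨ (T \ I).ncard = 2 at hcard
  have hsumT : (∑ x ∈ A ∪ B, x) ∈ Submodule.span ℝ T :=
    sum_mem fun x hx => Submodule.subset_span hx
  have hcoefsum : ∀ ψ ∈ T, R.coef ψ (∑ x ∈ A ∪ B, x) = 1 := by
    intro ψ hψ
    rw [map_sum, Finset.sum_eq_single ψ, hR.coef_self (hTbase hψ)]
    · intro x hx hne
      exact hR.coef_of_ne (hTbase hx) hne
    · intro h
      exact absurd hψ h
  have h1 : τ ∈ T \ I := by
    have h2 : ∑ x ∈ A ∪ B, x ∉ Submodule.span ℝ I := by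
      intro h
      obtain ⟨u, hu⟩ : (T \ I).Nonempty := by
        rw [Set.nonempty_iff_ne_empty]
        intro h0
        rw [h0] at hcard
        simp at hcard
      have h3 := hR.coef_eq_zero_of_mem_span (hI.trans hTbase) h hu.2
      rw [hcoefsum u hu.1] at h3
      norm_num at h3
    have h3 := hR.color_sum hc (fun x hx => (hS x).1 hx) hconn hABS hpos hτAB
    have := hR.fibration_color hc hTbase hI hfib hpos hsumT h2
    rwa [h3] at this
  have hmem : ∀ γ ∈ R.pos, 0 < R.coef τ γ → (∀ θ ∈ R.base, 0 < R.coef θ γ → θ ∈ T) →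
      c γ ∈ T \ I := by
    intro γ hγ hγτ hsupp
    refine hR.fibration_color hc hTbase hI hfib hγ ((hR.mem_span_iff hTbase hγ).2 hsupp) fun h => ?_
    rw [hR.coef_eq_zero_of_mem_span (hI.trans hTbase) h h1.2] at hγτ
    exact lt_irrefl _ hγτ
  have h2 := hmem β hβ hτ fun θ hθ h => Finset.mem_union_left _ ((hA θ).2 ⟨hθ, h⟩)
  have h3 := hmem β' hβ' hτ' fun θ hθ h => Finset.mem_union_right _ ((hB θ).2 ⟨hθ, h⟩)
  have hfin : (T \ I).Finite := (Finset.finite_toSet _).subset Set.sdiff_subset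
  have h4 : ({τ, c β, c β'} : Finset E).card ≤ (T \ I).ncard := by
    rw [← Set.ncard_coe_finset]
    refine Set.ncard_le_ncard ?_ hfin
    intro x hx
    simp only [Finset.coe_insert, Finset.coe_singleton, Set.mem_insert_iff,
      Set.mem_singleton_iff] at hx
    rcases hx with rfl | rfl | rfl <;> assumption
  rw [Finset.card_eq_three.2 ⟨τ, c β, c β', hne.symm, hne'.symm, hββ, rfl⟩] at h4
  omega

theorem color_three {S : Finset E} (hS : ∀ x, x ∈ S ↔ x ∈ R.base) (hconn : CutConnected S)
    {i j k : E} (hi : i ∈ R.base) (hj : j ∈ R.base) (hk : k ∈ R.base)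
    (hij : i ≠ j) (hik : i ≠ k) (hjk : j ≠ k) (hσ : i + j + k ∈ R.pos)
    (hτ : c (∑ x ∈ S, x) = i) : c (i + j + k) = i := by
  classical
  have e : ∑ x ∈ ({i, j, k} : Finset E), x = i + j + k := by
    rw [Finset.sum_insert (by simp [hij, hik]), Finset.sum_pair hjk, add_assoc]
  have := hR.color_sum hc (J := {i, j, k}) (fun x hx => (hS x).1 hx) hconn
    (by
      intro x hx
      simp only [Finset.mem_insert, Finset.mem_singleton] at hx
      rcases hx with rfl | rfl | rfl <;> rwa [hS]) (e ▸ hσ) (by rw [hτ]; simp)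
  rwa [e, hτ] at this

/-- If the roots of color `j` that do not involve `i` are multiples of `j`, then some `i + s j` has
color `j`. -/
theorem exists_string_of_color_mem_span {i j : E} (hj : j ∈ R.base)
    (hex : ∃ γ ∈ R.pos, c γ = j ∧ 0 < R.coef i γ)
    (h : ∀ y ∈ R.pos, c y = j → R.coef i y = 0 → y ∈ Submodule.span ℝ {j}) :
    ∃ s : ℕ, i + s • j ∈ R.pos ∧ c (i + s • j) = j := by
  obtain ⟨γ, hγ, hγc, hγi⟩ := hex
  obtain ⟨γ, hγ, -, hγc, -, -, hcl⟩ := hR.exists_color_sub_mem_closure hc (T := R.base) subset_rfl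
    ⟨γ, hγ, Submodule.closure_subset_span hγ.2, hγc, hγi⟩
  have h1 : γ - i ∈ AddSubmonoid.closure {j} := by
    refine AddSubmonoid.closure_le.2 ?_ hcl
    rintro y ⟨hy, -, hyc, hyi⟩
    exact hR.mem_closure_of_mem_span (by simpa using hj) hy.2 (h y hy hyc hyi)
  obtain ⟨n, hn⟩ := AddSubmonoid.mem_closure_singleton.1 h1
  have e : i + n • j = γ := by rw [hn]; abel
  exact ⟨n, by rwa [e], by rwa [e]⟩

/-- The string passes through i + j. If i and j were orthogonal, i - j would also be a root, with
coefficients of both signs. -/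
theorem inner_neg_of_string {i j : E} (hi : i ∈ R.base) (hj : j ∈ R.base) (hij : i ≠ j)
    (h : ∃ s : ℕ, i + s • j ∈ R.pos ∧ c (i + s • j) = j) : ⟪i, j⟫_ℝ < 0 := by
  obtain ⟨s, hs1, hroot, -, -⟩ := hR.exists_min_string hc hi hj hij h
  refine lt_of_le_of_ne (hR.inner_base_nonpos hi hj hij) fun h0 => ?_
  have h1 := hroot 1 hs1
  rw [one_nsmul] at h1
  have h2 := hR.sub_mem_of_inner_eq_zero i (hR.base_subset hi) j (hR.base_subset hj) h0 h1.1
  refine hR.notMem_of_mixed i j ?_ ?_ h2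
  · rw [map_sub, hR.coef_self hi, hR.coef_of_ne hj hij.symm]; norm_num
  · rw [map_sub, hR.coef_self hj, hR.coef_of_ne hi hij]; norm_num

/-- For a coloring of rank at least three, some color does not involve all simple roots. -/
theorem exists_supp_ne_base (hcard : 3 ≤ R.base.ncard)
    (hind : ∀ T ⊆ R.base, T ≠ R.base → T.Nonempty → (R.sub T).HasFibration c) :
    ∃ ψ ∈ R.base, {θ ∈ R.base | ∃ α ∈ R.pos, c α = ψ ∧ 0 < R.coef θ α} ≠ R.base := by
  classical
  by_contra! hcon
  have hall : ∀ ψ ∈ R.base, ∀ θ ∈ R.base, ∃ α ∈ R.pos, c α = ψ ∧ 0 < R.coef θ α := by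
    intro ψ hψ θ hθ
    rw [← hcon ψ hψ] at hθ
    exact hθ.2
  set S := hR.base_finite.toFinset with hSdef
  have hS : ∀ x, x ∈ S ↔ x ∈ R.base := fun x => hR.base_finite.mem_toFinset
  have hScard : S.card = R.base.ncard := (Set.ncard_eq_toFinset_card _ _).symm
  have hconn : CutConnected S := by
    intro A hA hne hAS
    by_contra! hab
    obtain ⟨ψ, hψ⟩ := hne
    obtain ⟨θ, hθS, hθA⟩ : ∃ θ ∈ S, θ ∉ A := by
      by_contra! h
      exact hAS (subset_antisymm hA h)
    have hA' : (A : Set E) ⊆ R.base := fun x hx => (hS x).1 (hA hx)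
    obtain ⟨α, hα, hαc, hαθ⟩ := hall ψ (hA' hψ) θ ((hS θ).1 hθS)
    have hB' : R.base \ (A : Set E) ⊆ R.base := Set.sdiff_subset
    rcases hR.mem_span_or_mem_span hA' hB' (fun a ha b hb =>
      le_antisymm (hR.inner_base_nonpos (hA' ha) hb.1 (fun h => hb.2 (h ▸ ha)))
        (hab a ha b ((hS b).2 hb.1) hb.2)) α hα (fun θ hθ _ => by
          by_cases h : θ ∈ A
          · exact Or.inl h
          · exact Or.inr ⟨hθ, h⟩) with h | h
    · rw [hR.coef_eq_zero_of_mem_span hA' h hθA] at hαθ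
      exact lt_irrefl _ hαθ
    · have h1 := hR.coef_color_pos hc hα
      rw [hαc, hR.coef_eq_zero_of_mem_span hB' h (fun h => h.2 hψ)] at h1
      exact lt_irrefl _ h1
  have hSne : S.Nonempty := by rw [← Finset.card_pos]; omega
  have hσS := hR.sum_mem_pos (fun x hx => (hS x).1 hx) hSne hconn
  obtain ⟨τ, hτ⟩ : ∃ τ, c (∑ x ∈ S, x) = τ := ⟨_, rfl⟩
  have hτb : τ ∈ R.base := hτ ▸ hR.color_mem hc hσS
  -- Apart from τ, the support of β j consists of simple roots in the supports of roots of color j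
  -- not involving τ, which are controlled by the coloring of S \ {τ}.
  have hβ : ∀ j ∈ R.base, ∃ β ∈ R.pos, c β = j ∧ R.coef τ β = 1 ∧
      β - τ ∈ AddSubmonoid.closure {y | y ∈ R.pos ∧ c y = j ∧ R.coef τ y = 0} := by
    intro j hj
    obtain ⟨γ, hγ, hγc, hγτ⟩ := hall j hj τ hτb
    obtain ⟨γ, hγ, -, hγc, hγτ, -, hcl⟩ := hR.exists_color_sub_mem_closure hc (T := R.base)
      subset_rfl ⟨γ, hγ, Submodule.closure_subset_span hγ.2, hγc, hγτ⟩
    exact ⟨γ, hγ, hγc, hγτ, AddSubmonoid.closure_mono (t := {y | y ∈ R.pos ∧ c y = j ∧ R.coef τ y = 0})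
      (fun y hy => ⟨hy.1, hy.2.2⟩) hcl⟩
  choose! β hβpos hβc hβτ hβcl using hβ
  have hβsupp : ∀ j ∈ R.base, ∀ J : Set E, (∀ y ∈ R.pos, c y = j → R.coef τ y = 0 →
      y ∈ Submodule.span ℝ J) → J ⊆ R.base → ∀ θ ∈ R.base, θ ≠ τ → 0 < R.coef θ (β j) → θ ∈ J := by
    intro j hj J hJ hJb θ hθ hθτ hp
    have h1 : β j - τ ∈ Submodule.span ℝ J := by
      have : AddSubmonoid.closure {y | y ∈ R.pos ∧ c y = j ∧ R.coef τ y = 0} ≤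
          (Submodule.span ℝ J).toAddSubmonoid := by
        rw [AddSubmonoid.closure_le]
        rintro y ⟨h1, h2, h3⟩
        exact hJ y h1 h2 h3
      exact this (hβcl j hj)
    by_contra hn
    have h2 := hR.coef_eq_zero_of_mem_span hJb h1 hn
    rw [map_sub, hR.coef_of_ne hτb hθτ.symm] at h2
    linarith
  have pair : ∀ j ∈ R.base, ∀ k ∈ R.base, j ≠ τ → k ≠ τ → j ≠ k → ∀ θ ∈ R.base,
      0 < R.coef θ (β j) ∨ 0 < R.coef θ (β k) := by
    intro j hj k hk hjτ hkτ hjk θ hθ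
    refine hR.coef_pos_or_coef_pos hc hS hconn hind (hβpos j hj) (hβpos k hk) ?_ ?_ ?_ ?_ ?_ hθ
    · rw [hτ, hβτ j hj]; norm_num
    · rw [hτ, hβτ k hk]; norm_num
    · rwa [hτ, hβc j hj]
    · rwa [hτ, hβc k hk]
    · rwa [hβc j hj, hβc k hk]
  have string : ∀ j ∈ R.base, (∀ y ∈ R.pos, c y = j → R.coef τ y = 0 → y ∈ Submodule.span ℝ {j}) →
      ∃ s : ℕ, τ + s • j ∈ R.pos ∧ c (τ + s • j) = j := by
    intro j hj h
    exact hR.exists_string_of_color_mem_span hc hj (hall j hj τ hτb) h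
  have hsum3 : ∀ j ∈ R.base, ∀ k ∈ R.base, j ≠ τ → k ≠ τ → ⟪j, k⟫_ℝ < 0 → ⟪τ, j⟫_ℝ < 0 →
      τ + j + k ∈ R.pos := by
    intro j hj k hk hjτ hkτ hjk hτj
    refine hR.add_pos_of_inner_neg (hR.add_pos_of_inner_neg (hR.base_pos hτb) (hR.base_pos hj) hτj)
      (hR.base_pos hk) ?_
    have := hR.inner_base_nonpos hτb hk hkτ.symm
    rw [inner_add_left]; linarith
  -- In rank at least four, apply the structure theorem to T = S \ {τ}. Roots of R_T with color in I
  -- lie in span I, so for two elements j, k of I the supports of β j and β k would miss T \ I.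
  -- Hence I is a single {j} and T \ I has two elements.
  rcases lt_or_eq_of_le hcard with hcard4 | hcard3
  · have hTb : R.base \ {τ} ⊆ R.base := Set.sdiff_subset
    have hTcard : (R.base \ {τ}).ncard + 1 = R.base.ncard :=
      Set.ncard_sdiff_singleton_add_one hτb hR.base_finite
    have hTne : (R.base \ {τ}).Nonempty := by
      rw [← Set.ncard_pos (hR.base_finite.subset hTb)]; omega
    obtain ⟨I, hI, hU, hfib⟩ := hind _ hTb (fun h => by rw [h] at hTcard; omega) hTne
    change I ⊆ R.base \ {τ} at hI
    change ((R.base \ {τ}) \ I).ncard = 1 ∨ ((R.base \ {τ}) \ I).ncard = 2 at hU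
    have hIb := hI.trans hTb
    have hmemT : ∀ y ∈ R.pos, R.coef τ y = 0 → y ∈ Submodule.span ℝ (R.base \ {τ}) :=
      fun y hy h0 => (hR.mem_span_iff hTb hy).2 fun θ hθ hp => ⟨hθ, by
        rintro rfl
        rw [h0] at hp; exact lt_irrefl _ hp⟩
    have hcolI : ∀ j ∈ I, ∀ y ∈ R.pos, c y = j → R.coef τ y = 0 → y ∈ Submodule.span ℝ I := by
      intro j hj y hy hyc hyτ
      by_contra h
      have := hR.fibration_color hc hTb hI hfib hy (hmemT y hy hyτ) h
      rw [hyc] at this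
      exact this.2 hj
    have hcardI := Set.ncard_sdiff_add_ncard_of_subset hI (hR.base_finite.subset hTb)
    obtain ⟨u₀, hu₀⟩ : ((R.base \ {τ}) \ I).Nonempty := by
      rw [← Set.ncard_pos ((hR.base_finite.subset hTb).subset Set.sdiff_subset)]; omega
    have hI1 : I.ncard ≤ 1 := by
      rw [Set.ncard_le_one (hR.base_finite.subset hIb)]
      intro j hj k hk
      by_contra hjk
      rcases pair j (hIb hj) k (hIb hk) (hI hj).2 (hI hk).2 hjk u₀ hu₀.1.1 with h | h
      · exact hu₀.2 (hβsupp j (hIb hj) I (hcolI j hj) hIb u₀ hu₀.1.1 hu₀.1.2 h)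
      · exact hu₀.2 (hβsupp k (hIb hk) I (hcolI k hk) hIb u₀ hu₀.1.1 hu₀.1.2 h)
    obtain ⟨j, rfl⟩ := Set.ncard_eq_one.1 (show I.ncard = 1 by omega)
    obtain ⟨u, v, huv, hUe⟩ := Set.ncard_eq_two.1
      (show ((R.base \ {τ}) \ {j}).ncard = 2 by omega)
    have hj := hIb rfl
    have hjτ : j ≠ τ := (hI rfl).2
    have hstr := string j hj (hcolI j rfl)
    have hu : u ∈ (R.base \ {τ}) \ {j} := by rw [hUe]; simp
    have hv : v ∈ (R.base \ {τ}) \ {j} := by rw [hUe]; simp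
    -- If j were adjacent to u, then j + u, lying outside span I, would have color u, and
    -- `false_of_string` applies.
    have hnadj : ∀ u ∈ (R.base \ {τ}) \ {j}, ⟪j, u⟫_ℝ = 0 := by
      intro u hu
      by_contra hne
      have hlt := lt_of_le_of_ne (hR.inner_base_nonpos hj hu.1.1 (Ne.symm hu.2)) hne
      have hσ3 := hsum3 j hj u hu.1.1 hjτ hu.1.2 hlt
        (hR.inner_neg_of_string hc hτb hj hjτ.symm hstr)
      refine hR.false_of_string hc hτb hj hu.1.1 hjτ.symm (Ne.symm hu.1.2) (Ne.symm hu.2) hσ3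
        (hR.color_three hc hS hconn hτb hj hu.1.1 hjτ.symm (Ne.symm hu.1.2) (Ne.symm hu.2) hσ3 hτ)
        hlt ?_ hstr
      have hju := hR.add_pos_of_inner_neg (hR.base_pos hj) (hR.base_pos hu.1.1) hlt
      have h1 := hR.fibration_color hc hTb hI hfib hju (hmemT _ hju (by
        rw [map_add, hR.coef_of_ne hj hjτ, hR.coef_of_ne hu.1.1 hu.1.2, add_zero])) (fun h => by
          have := hR.coef_eq_zero_of_mem_span hIb h hu.2
          rw [map_add, hR.coef_self hu.1.1, hR.coef_of_ne hj (Ne.symm hu.2)] at this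
          norm_num at this)
      rcases hR.color_add hc (hR.base_pos hj) (hR.base_pos hu.1.1) hju.1 with h | h
      · rw [h, hc.base j hj] at h1
        exact absurd rfl h1.2
      · rw [h, hc.base u hu.1.1]
    have hUb : (R.base \ {τ}) \ {j} ⊆ R.base := Set.sdiff_subset.trans hTb
    have hcolU : ∀ u ∈ (R.base \ {τ}) \ {j}, ∀ y ∈ R.pos, c y = u → R.coef τ y = 0 →
        y ∈ Submodule.span ℝ ((R.base \ {τ}) \ {j}) := by
      intro u hu y hy hyc hyτ
      rcases hR.mem_span_or_mem_span hIb hUb (by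
        rintro a rfl b hb
        exact hnadj b hb) y hy (fun θ hθ hp => by
          by_cases h : θ = j
          · exact Or.inl h
          · exact Or.inr ⟨((hR.mem_span_iff hTb hy).1 (hmemT y hy hyτ) θ hθ hp), h⟩) with h | h
      · exfalso
        have h1 := hR.coef_color_pos hc hy
        rw [hyc, hR.coef_eq_zero_of_mem_span hIb h hu.2] at h1
        exact lt_irrefl _ h1
      · exact h
    -- Since j is orthogonal to u and v, the roots of these colors in R_T avoid j, so the supports
    -- of β u and β v do not cover j.
    rcases pair u hu.1.1 v hv.1.1 hu.1.2 hv.1.2 huv j hj with h | h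
    · exact (hβsupp u hu.1.1 _ (hcolU u hu) hUb j hj hjτ h).2 rfl
    · exact (hβsupp v hv.1.1 _ (hcolU v hv) hUb j hj hjτ h).2 rfl
  · have hTcard : (R.base \ {τ}).ncard + 1 = R.base.ncard :=
      Set.ncard_sdiff_singleton_add_one hτb hR.base_finite
    obtain ⟨j, k, hjk, hTe⟩ := Set.ncard_eq_two.1 (show (R.base \ {τ}).ncard = 2 by omega)
    have hj : j ∈ R.base \ {τ} := by rw [hTe]; simp
    have hk : k ∈ R.base \ {τ} := by rw [hTe]; simp
    have hbase : ∀ θ ∈ R.base, θ = τ ∨ θ = j ∨ θ = k := by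
      intro θ hθ
      by_cases h : θ = τ
      · exact Or.inl h
      · have : θ ∈ R.base \ {τ} := ⟨hθ, h⟩
        rw [hTe] at this
        exact Or.inr this
    -- Rank three with j and k adjacent. If a root of span {k, j} of color j involves k, then some k
    -- + n j has color j and the lexicographic argument gives β j the color τ. If not, some τ + s j
    -- has color j and `false_of_string` applies.
    have hjkcase : ∀ j k, j ∈ R.base → k ∈ R.base → j ≠ τ → k ≠ τ → j ≠ k →
        (∀ θ ∈ R.base, θ = τ ∨ θ = j ∨ θ = k) → ⟪j, k⟫_ℝ < 0 → τ + k + j ∈ R.pos →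
        c (τ + k + j) = τ → c (j + k) = k → False := by
      intro j k hj hk hjτ hkτ hjk hbase hlt hσ hcσ hcjk
      have hkj : ⟪k, j⟫_ℝ < 0 := by rwa [real_inner_comm]
      have hkjT : ({k, j} : Set E) ⊆ R.base := by
        rintro x (rfl | rfl) <;> assumption
      by_cases h : ∃ γ ∈ R.pos, γ ∈ Submodule.span ℝ {k, j} ∧ c γ = j ∧ 0 < R.coef k γ
      · obtain ⟨γ, hγ, hγs, hγc, hγk, -, hcl⟩ := hR.exists_color_sub_mem_closure hc hkjT h
        have h1 : γ - k ∈ AddSubmonoid.closure {j} := by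
          refine AddSubmonoid.closure_le.2 ?_ hcl
          rintro y ⟨hy, hys, hyc, hyi⟩
          refine hR.mem_closure_of_mem_span (by simpa using hj) hy.2
            ((hR.mem_span_iff (by simpa using hj) hy).2 fun θ hθ hp => ?_)
          rcases (hR.mem_span_iff hkjT hy).1 hys θ hθ hp with h | h
          · rw [h, hyi] at hp; exact absurd hp (lt_irrefl _)
          · exact h
        obtain ⟨n, hn⟩ := AddSubmonoid.mem_closure_singleton.1 h1
        have e : k + n • j = γ := by rw [hn]; abel
        have h2 := hR.color_eq_of_coef_eq_one hc hτb hk hj hkτ.symm hjτ.symm hjk.symm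
          (fun θ hθ => (hbase θ hθ).imp_right Or.symm) hσ hcσ hkj (by rwa [add_comm])
          ⟨n, by rwa [e], by rwa [e]⟩ (hβpos j hj) (hβτ j hj)
        rw [hβc j hj] at h2
        exact hjτ h2
      · push Not at h
        refine hR.false_of_string hc hτb hj hk hjτ.symm hkτ.symm hjk (by rwa [add_right_comm])
          (by rwa [add_right_comm]) hlt hcjk (string j hj fun y hy hyc hyτ => ?_)
        refine (hR.mem_span_iff (by simpa using hj) hy).2 fun θ hθ hp => ?_
        rcases hbase θ hθ with rfl | rfl | rfl
        · rw [hyτ] at hp; exact absurd hp (lt_irrefl _)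
        · rfl
        · refine absurd hp (not_lt.mpr (h y hy ?_ hyc))
          refine (hR.mem_span_iff hkjT hy).2 fun φ hφ hp => ?_
          rcases hbase φ hφ with rfl | rfl | rfl
          · rw [hyτ] at hp; exact absurd hp (lt_irrefl _)
          · simp
          · simp
    have e : ∑ x ∈ S, x = τ + k + j := by
      have : S = {τ, k, j} := by
        ext x
        rw [hS]
        constructor
        · intro hx
          rcases hbase x hx with rfl | rfl | rfl <;> simp
        · intro hx
          simp only [Finset.mem_insert, Finset.mem_singleton] at hx
          rcases hx with rfl | rfl | rfl
          · exact hτb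
          · exact hk.1
          · exact hj.1
      rw [this, Finset.sum_insert (by simp [Ne.symm hj.2, Ne.symm hk.2]), Finset.sum_pair hjk.symm,
        add_assoc]
    rw [e] at hσS hτ
    rcases lt_or_eq_of_le (hR.inner_base_nonpos hj.1 hk.1 hjk) with hlt | h0
    · rcases hR.color_add hc (hR.base_pos hj.1) (hR.base_pos hk.1)
        (hR.add_pos_of_inner_neg (hR.base_pos hj.1) (hR.base_pos hk.1) hlt).1 with h | h
      · exact hjkcase k j hk.1 hj.1 hk.2 hj.2 hjk.symm (fun θ hθ => (hbase θ hθ).imp_right Or.symm)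
          (by rwa [real_inner_comm]) (by rwa [add_right_comm]) (by rwa [add_right_comm])
          (by rw [add_comm, h, hc.base j hj.1])
      · exact hjkcase j k hj.1 hk.1 hj.2 hk.2 hjk hbase hlt hσS hτ (by rw [h, hc.base k hk.1])
    -- When j and k are orthogonal, a root not involving τ lies on the line of j or of k, so both
    -- strings from τ exist.
    · have horth : ∀ j k, j ∈ R.base → k ∈ R.base → ⟪j, k⟫_ℝ = 0 → j ≠ k →
          (∀ θ ∈ R.base, θ = τ ∨ θ = j ∨ θ = k) → ∃ s : ℕ, τ + s • j ∈ R.pos ∧ c (τ + s • j) = j := by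
        intro j k hj hk h0 hjk hbase
        refine string j hj fun y hy hyc hyτ => ?_
        refine (hR.mem_span_or_mem_span (A := {j}) (B := {k}) (by simpa using hj)
          (by simpa using hk) (by rintro a rfl b rfl; exact h0) y hy fun θ hθ hp => ?_).resolve_right
          fun h => ?_
        · rcases hbase θ hθ with rfl | rfl | rfl
          · rw [hyτ] at hp; exact absurd hp (lt_irrefl _)
          · simp
          · simp
        · have h1 := hR.coef_color_pos hc hy
          rw [hyc, hR.coef_eq_zero_of_mem_span (by simpa using hk) h hjk] at h1
          exact lt_irrefl _ h1
      have hk0 : ⟪k, j⟫_ℝ = 0 := by rw [real_inner_comm]; exact h0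
      have s1 := horth j k hj.1 hk.1 h0 hjk hbase
      have s2 := horth k j hk.1 hj.1 hk0 hjk.symm (fun θ hθ => (hbase θ hθ).imp_right Or.symm)
      exact hR.false_of_two_strings hc hτb hk.1 hj.1 (Ne.symm hk.2) (Ne.symm hj.2) hjk.symm hσS hτ
        hk0 (hR.inner_neg_of_string hc hτb hk.1 (Ne.symm hk.2) s2)
        (hR.inner_neg_of_string hc hτb hj.1 (Ne.symm hj.2) s1) s2 s1

end Coloring

end IsAdmissible
end BasedRoots

/-! ### Orthogonal projections -/

section Projection

variable (V : Submodule ℝ E)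

theorem sub_starProjection_mem (x : E) : x - Vᗮ.starProjection x ∈ V := by
  have := Vᗮ.sub_starProjection_mem_orthogonal x
  rwa [Submodule.orthogonal_orthogonal] at this

theorem starProjection_eq_iff {x u : E} :
    Vᗮ.starProjection x = u ↔ u ∈ Vᗮ ∧ x - u ∈ V := by
  constructor
  · rintro rfl
    exact ⟨Vᗮ.starProjection_apply_mem x, sub_starProjection_mem V x⟩
  · rintro ⟨h1, h2⟩
    exact (Submodule.eq_starProjection_of_mem_orthogonal h1
      (by rwa [Submodule.orthogonal_orthogonal]))

theorem starProjection_eq_zero_iff {x : E} : Vᗮ.starProjection x = 0 ↔ x ∈ V := by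
  rw [starProjection_eq_iff]
  simp

theorem inner_starProjection_of_mem {x u : E} (hu : u ∈ Vᗮ) :
    ⟪x, u⟫_ℝ = ⟪Vᗮ.starProjection x, u⟫_ℝ := by
  have := (Submodule.mem_orthogonal V u).1 hu _ (sub_starProjection_mem V x)
  rw [inner_sub_left] at this
  linarith

theorem starProjection_mem_iff {I : Submodule ℝ E} (hI : I ≤ Vᗮ) {x : E} :
    Vᗮ.starProjection x ∈ I ↔ x ∈ V ⊔ I := by
  constructor
  · intro h
    have : x = (x - Vᗮ.starProjection x) + Vᗮ.starProjection x := by abel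
    rw [this]
    exact Submodule.add_mem_sup (sub_starProjection_mem V x) h
  · intro h
    obtain ⟨v, hv, i, hi, rfl⟩ := Submodule.mem_sup.1 h
    have : Vᗮ.starProjection (v + i) = i :=
      (starProjection_eq_iff V).2 ⟨hI hi, by simpa using hv⟩
    rwa [this]

/-- Successive quotients are a single quotient, which keeps quotients of quotients inside the class
`IsQuotOf`. -/
theorem starProjection_starProjection {I : Submodule ℝ E} (hI : I ≤ Vᗮ) (x : E) :
    Iᗮ.starProjection (Vᗮ.starProjection x) = (V ⊔ I)ᗮ.starProjection x := by
  symm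
  rw [starProjection_eq_iff]
  have h1 := Iᗮ.starProjection_apply_mem (Vᗮ.starProjection x)
  have h2 := sub_starProjection_mem I (Vᗮ.starProjection x)
  have h3 := sub_starProjection_mem V x
  constructor
  · rw [← Submodule.inf_orthogonal]
    refine ⟨?_, h1⟩
    have := sub_mem (Vᗮ.starProjection_apply_mem x) (hI h2)
    simpa using this
  · convert Submodule.add_mem_sup h3 h2 using 1
    abel

end Projection

theorem proj_eq_zero_iff {I : Set E} {x : E} : proj I x = 0 ↔ x ∈ Submodule.span ℝ I :=
  starProjection_eq_zero_iff _

theorem proj_eq_proj_iff {I : Set E} {x y : E} :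
    proj I x = proj I y ↔ x - y ∈ Submodule.span ℝ I := by
  rw [← sub_eq_zero, ← map_sub, proj_eq_zero_iff]

theorem proj_mem_span_image_iff {I K : Set E} {x : E} :
    proj I x ∈ Submodule.span ℝ (proj I '' K) ↔ x ∈ Submodule.span ℝ (I ∪ K) := by
  rw [← ContinuousLinearMap.coe_coe, Submodule.span_image, Submodule.span_union]
  constructor
  · rintro ⟨k, hk, h⟩
    have h1 := proj_eq_proj_iff.1 h.symm
    have : x = (x - k) + k := by abel
    rw [this]
    exact Submodule.add_mem_sup h1 hk
  · intro h
    obtain ⟨v, hv, k, hk, rfl⟩ := Submodule.mem_sup.1 h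
    refine ⟨k, hk, (proj_eq_proj_iff.2 ?_).symm⟩
    simpa using hv

/-! ### Root sets, fibers and quotients -/

/-- The properties of the set of roots of a root system in a Euclidean space that are inherited by
its quotients. -/
structure IsRootSet (D : Set E) : Prop where
  finite : D.Finite
  zero_notMem : (0 : E) ∉ D
  neg_mem_roots : ∀ α ∈ D, -α ∈ D
  reflect_mem : ∀ α ∈ D, ∀ β ∈ D, β - (2 * ⟪α, β⟫_ℝ / ⟪α, α⟫_ℝ) • α ∈ D
  add_mem_roots : ∀ α ∈ D, ∀ β ∈ D, ⟪α, β⟫_ℝ < 0 → α + β ≠ 0 → α + β ∈ D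

/-- The roots of `D` in `W` over `μ` with respect to the projection along `V`. -/
def fiber (D : Set E) (V W : Submodule ℝ E) (μ : E) : Set E :=
  {β | β ∈ D ∧ β ∈ W ∧ Vᗮ.starProjection β = μ}

namespace IsRootSet

variable {D : Set E} (hD : IsRootSet D) {V W : Submodule ℝ E} (hVW : V ≤ W)
  (hV : V = Submodule.span ℝ (D ∩ V))
include hD

theorem fiber_finite (μ : E) : (fiber D V W μ).Finite :=
  hD.finite.subset fun _ h => h.1

theorem sub_mem_roots {α β : E} (hα : α ∈ D) (hβ : β ∈ D) (h : 0 < ⟪α, β⟫_ℝ) (hne : α ≠ β) :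
    α - β ∈ D := by
  rw [sub_eq_add_neg]
  refine hD.add_mem_roots α hα (-β) (hD.neg_mem_roots β hβ) ?_ ?_
  · rw [inner_neg_right]; linarith
  · rwa [← sub_eq_add_neg, sub_ne_zero]

include hVW hV

/-- The average of a fiber is the point over which it lies. -/
theorem sum_inner_fiber (μ w : E) :
    ∑ β ∈ (hD.fiber_finite (V := V) (W := W) μ).toFinset, ⟪w, β⟫_ℝ =
      (hD.fiber_finite (V := V) (W := W) μ).toFinset.card * ⟪w, μ⟫_ℝ := by
  set F := (hD.fiber_finite (V := V) (W := W) μ).toFinset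
  have hF : ∀ β, β ∈ F ↔ β ∈ D ∧ β ∈ W ∧ Vᗮ.starProjection β = μ := fun β =>
    Set.Finite.mem_toFinset _
  -- The reflection in a root γ of V permutes the fiber and negates ⟪γ, β⟫. So the sum of the fiber
  -- is orthogonal to V, which is spanned by such γ.
  have hγ : ∀ γ ∈ D ∩ V, ⟪γ, ∑ β ∈ F, β⟫_ℝ = 0 := by
    rintro γ ⟨hγ, hγV⟩
    have hγ0 : ⟪γ, γ⟫_ℝ ≠ 0 := by
      rw [inner_self_ne_zero]
      rintro rfl
      exact hD.zero_notMem hγ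
    have hinv : ∀ β, ⟪γ, β - (2 * ⟪γ, β⟫_ℝ / ⟪γ, γ⟫_ℝ) • γ⟫_ℝ = -⟪γ, β⟫_ℝ := by
      intro β
      rw [inner_sub_right, inner_smul_right]
      field_simp
      ring
    have hmaps : ∀ β ∈ F, β - (2 * ⟪γ, β⟫_ℝ / ⟪γ, γ⟫_ℝ) • γ ∈ F := by
      intro β hβ
      rw [hF] at hβ ⊢
      refine ⟨hD.reflect_mem γ hγ β hβ.1, sub_mem hβ.2.1 (W.smul_mem _ (hVW hγV)), ?_⟩
      rw [map_sub, map_smul, (starProjection_eq_zero_iff V).2 hγV, smul_zero, sub_zero, hβ.2.2]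
    have hinvol : ∀ β, (β - (2 * ⟪γ, β⟫_ℝ / ⟪γ, γ⟫_ℝ) • γ) -
        (2 * ⟪γ, β - (2 * ⟪γ, β⟫_ℝ / ⟪γ, γ⟫_ℝ) • γ⟫_ℝ / ⟪γ, γ⟫_ℝ) • γ = β := by
      intro β
      rw [hinv, mul_neg, neg_div, neg_smul]
      abel
    have hsum : ∑ β ∈ F, ⟪γ, β⟫_ℝ = ∑ β ∈ F, -⟪γ, β⟫_ℝ := by
      refine Finset.sum_bij' (fun β _ => β - (2 * ⟪γ, β⟫_ℝ / ⟪γ, γ⟫_ℝ) • γ)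
        (fun β _ => β - (2 * ⟪γ, β⟫_ℝ / ⟪γ, γ⟫_ℝ) • γ) hmaps hmaps
        (fun β _ => hinvol β) (fun β _ => hinvol β) fun β _ => ?_
      rw [hinv, neg_neg]
    rw [Finset.sum_neg_distrib] at hsum
    rw [inner_sum]
    linarith
  have horth : ∑ β ∈ F, β ∈ Vᗮ := by
    rw [Submodule.mem_orthogonal]
    intro u hu
    rw [hV] at hu
    induction hu using Submodule.span_induction with
    | mem x hx => exact hγ x hx
    | zero => simp
    | add x y _ _ hx hy => rw [inner_add_left, hx, hy, add_zero]
    | smul a x _ hx => rw [inner_smul_left, hx, mul_zero]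
  have hs : ∑ β ∈ F, β = F.card • μ := by
    rw [← Vᗮ.starProjection_eq_self_iff.2 horth, map_sum,
      Finset.sum_congr rfl fun β hβ => ((hF β).1 hβ).2.2, Finset.sum_const]
  rw [← inner_sum, hs, ← Nat.cast_smul_eq_nsmul ℝ, inner_smul_right]

/-- A positive average has a positive term. -/
theorem exists_inner_pos_of_fiber {μ : E} (hμ : (fiber D V W μ).Nonempty) {w : E}
    (h : 0 < ⟪w, μ⟫_ℝ) : ∃ β ∈ fiber D V W μ, 0 < ⟪w, β⟫_ℝ := by
  by_contra! hcon
  have h1 := hD.sum_inner_fiber hVW hV μ w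
  have h2 : ∑ β ∈ (hD.fiber_finite (V := V) (W := W) μ).toFinset, ⟪w, β⟫_ℝ ≤ 0 :=
    Finset.sum_nonpos fun β hβ => hcon β (by simpa using hβ)
  have h3 : 0 < (hD.fiber_finite (V := V) (W := W) μ).toFinset.card := by
    rw [Finset.card_pos]; simpa using hμ
  have h4 : (0 : ℝ) < (hD.fiber_finite (V := V) (W := W) μ).toFinset.card := by exact_mod_cast h3
  nlinarith [mul_pos h4 h]

/-- A sum in the quotient lifts to a sum of roots. -/
theorem exists_fiber_add {μ ν : E} (hμ0 : μ ∈ Vᗮ) (hν0 : ν ∈ Vᗮ) (hμ1 : μ ≠ 0) (hν1 : ν ≠ 0)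
    (hμ : (fiber D V W μ).Nonempty) (hν : (fiber D V W ν).Nonempty)
    (hμν : (fiber D V W (μ + ν)).Nonempty) (hne : μ + ν ≠ 0) :
    ∃ α ∈ fiber D V W μ, ∃ β ∈ fiber D V W ν, α + β ∈ D := by
  -- One of ⟪μ + ν, μ⟫ and ⟪μ + ν, ν⟫ is positive. In the first case lift μ + ν to γ and pick α over
  -- μ with ⟪γ, α⟫ > 0; then γ - α is a root over ν.
  have key : ∀ μ ν : E, μ ∈ Vᗮ → ν ≠ 0 → (fiber D V W μ).Nonempty →
      (fiber D V W (μ + ν)).Nonempty → 0 < ⟪μ + ν, μ⟫_ℝ →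
      ∃ α ∈ fiber D V W μ, ∃ β ∈ fiber D V W ν, α + β ∈ D := by
    rintro μ ν hμ0 hν1 hμ ⟨γ, hγD, hγW, hγ⟩ hpos
    rw [← hγ, ← inner_starProjection_of_mem V hμ0] at hpos
    obtain ⟨α, ⟨hαD, hαW, hα⟩, hγα⟩ := hD.exists_inner_pos_of_fiber hVW hV hμ hpos
    have hp : Vᗮ.starProjection (γ - α) = ν := by rw [map_sub, hγ, hα]; abel
    refine ⟨α, ⟨hαD, hαW, hα⟩, γ - α, ⟨hD.sub_mem_roots hγD hαD hγα ?_, sub_mem hγW hαW, hp⟩,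
      by simpa using hγD⟩
    rintro rfl
    exact hν1 (by rw [← hp]; simp)
  have hpos : (0 : ℝ) < ⟪μ + ν, μ + ν⟫_ℝ := real_inner_self_pos.mpr hne
  rw [inner_add_right] at hpos
  by_cases h : 0 < ⟪μ + ν, μ⟫_ℝ
  · exact key μ ν hμ0 hν1 hμ hμν h
  · obtain ⟨β, hβ, α, hα, h⟩ := key ν μ hν0 hμ1 hν (by rwa [add_comm]) (by
      rw [add_comm ν μ]; linarith)
    exact ⟨α, hα, β, hβ, by rwa [add_comm]⟩

end IsRootSet

namespace BasedRoots

/-- `R` is obtained from the root set `D` by restricting to a subspace and then projecting along a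
subspace spanned by roots. -/
def IsQuotOf (D : Set E) (R : BasedRoots E) : Prop :=
  ∃ V W : Submodule ℝ E, V ≤ W ∧ V = Submodule.span ℝ (D ∩ V) ∧
    R.roots = Vᗮ.starProjection '' {α | α ∈ D ∧ α ∈ W ∧ α ∉ V} ∧ IsBase R.base R.roots

variable {D : Set E} {R : BasedRoots E}

/-- The Euclidean rules survive projection because fibers contain roots whose inner products have
the required sign. -/
theorem IsQuotOf.isAdmissible (hD : IsRootSet D) (h : R.IsQuotOf D) : R.IsAdmissible := by
  obtain ⟨V, W, hVW, hV, hroots, hbase⟩ := h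
  have hmem : ∀ μ, μ ∈ R.roots ↔ (fiber D V W μ).Nonempty ∧ μ ≠ 0 := by
    intro μ
    rw [hroots]
    constructor
    · rintro ⟨α, ⟨h1, h2, h3⟩, rfl⟩
      exact ⟨⟨α, h1, h2, rfl⟩, fun h => h3 ((starProjection_eq_zero_iff V).1 h)⟩
    · rintro ⟨⟨α, h1, h2, rfl⟩, h4⟩
      exact ⟨α, ⟨h1, h2, fun h => h4 ((starProjection_eq_zero_iff V).2 h)⟩, rfl⟩
  have horth : ∀ μ ∈ R.roots, μ ∈ Vᗮ := by
    intro μ hμ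
    rw [hroots] at hμ
    obtain ⟨α, -, rfl⟩ := hμ
    exact Vᗮ.starProjection_apply_mem α
  refine ⟨?_, ?_, ?_, ?_, ?_, hbase⟩
  · rw [hroots]
    exact (hD.finite.subset fun _ h => h.1).image _
  · intro h
    exact ((hmem 0).1 h).2 rfl
  · intro μ hμ
    obtain ⟨⟨α, h1, h2, h3⟩, h4⟩ := (hmem μ).1 hμ
    exact (hmem _).2 ⟨⟨-α, hD.neg_mem_roots α h1, neg_mem h2, by rw [map_neg, h3]⟩,
      neg_ne_zero.2 h4⟩
  · intro μ hμ ν hν hneg hne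
    obtain ⟨⟨α, h1, h2, h3⟩, -⟩ := (hmem μ).1 hμ
    obtain ⟨β, ⟨h4, h5, h6⟩, h7⟩ := hD.exists_inner_pos_of_fiber hVW hV ((hmem ν).1 hν).1
      (w := -α) (by
        rw [inner_neg_left, inner_starProjection_of_mem V (horth ν hν), h3]; linarith)
    have hp : Vᗮ.starProjection (α + β) = μ + ν := by rw [map_add, h3, h6]
    refine (hmem _).2 ⟨⟨α + β, hD.add_mem_roots α h1 β h4 ?_ ?_, add_mem h2 h5, hp⟩, hne⟩
    · rw [inner_neg_left] at h7; linarith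
    · intro h
      exact hne (by rw [← hp, h, map_zero])
  · intro μ hμ ν hν h0 hμν
    obtain ⟨hμF, hμ0⟩ := (hmem μ).1 hμ
    obtain ⟨hνF, hν0⟩ := (hmem ν).1 hν
    have hμpos : (0 : ℝ) < ⟪μ, μ⟫_ℝ := real_inner_self_pos.mpr hμ0
    have hne : μ - ν ≠ 0 := by
      intro h
      rw [← sub_eq_zero.1 h] at h0
      linarith
    obtain ⟨α, ⟨hα1, hα2, hα3⟩, β, ⟨hβ1, hβ2, hβ3⟩, hαβ⟩ := hD.exists_fiber_add hVW hV (horth μ hμ)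
      (horth ν hν) hμ0 hν0 hμF hνF ((hmem _).1 hμν).1 ((hmem _).1 hμν).2
    have hdiff : ∀ β ∈ fiber D V W ν, α - β ∈ D → μ - ν ∈ R.roots := by
      rintro β ⟨h1, h2, h3⟩ h
      exact (hmem _).2 ⟨⟨α - β, h, sub_mem hα2 h2, by rw [map_sub, hα3, h3]⟩, hne⟩
    -- If no root over ν has positive inner product with α, then all these inner products vanish,
    -- their average being ⟪μ, ν⟫ = 0. Reflecting α + β in β then gives α - β.
    by_cases hex : ∃ β ∈ fiber D V W ν, 0 < ⟪α, β⟫_ℝ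
    · obtain ⟨β', hβ', hpos⟩ := hex
      refine hdiff β' hβ' (hD.sub_mem_roots hα1 hβ'.1 hpos ?_)
      rintro rfl
      exact hne (by rw [← hα3, ← hβ'.2.2, sub_self])
    · push Not at hex
      have hsum := hD.sum_inner_fiber hVW hV ν α
      rw [inner_starProjection_of_mem V (horth ν hν), hα3, h0, mul_zero] at hsum
      have hz := (Finset.sum_eq_zero_iff_of_nonpos fun β hβ => hex β (by simpa using hβ)).1 hsum β
        ((Set.Finite.mem_toFinset _).2 ⟨hβ1, hβ2, hβ3⟩)
      refine hdiff β ⟨hβ1, hβ2, hβ3⟩ ?_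
      have hββ : ⟪β, β⟫_ℝ ≠ 0 := by
        rw [inner_self_ne_zero]
        rintro rfl
        exact hD.zero_notMem hβ1
      have h1 := hD.reflect_mem β hβ1 _ hαβ
      rw [inner_add_right, real_inner_comm, hz, zero_add, mul_div_assoc, div_self hββ, mul_one] at h1
      convert h1 using 1
      module

theorem IsQuotOf.sub (hD : IsRootSet D) (h : R.IsQuotOf D) {I : Set E} (hI : I ⊆ R.base) :
    (R.sub I).IsQuotOf D := by
  have hbase := ((h.isAdmissible hD).sub hI).isBase
  obtain ⟨V, W, hVW, hV, hroots, hb⟩ := h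
  have hIV : Submodule.span ℝ I ≤ Vᗮ := by
    rw [Submodule.span_le]
    intro x hx
    have := hb.subset (hI hx)
    rw [hroots] at this
    obtain ⟨α, -, rfl⟩ := this
    exact Vᗮ.starProjection_apply_mem α
  refine ⟨V, W ⊓ (V ⊔ Submodule.span ℝ I), le_inf hVW le_sup_left, hV, ?_, hbase⟩
  ext μ
  change μ ∈ R.roots ∧ μ ∈ Submodule.span ℝ I ↔ _
  rw [hroots]
  constructor
  · rintro ⟨⟨α, ⟨h1, h2, h3⟩, rfl⟩, h4⟩
    exact ⟨α, ⟨h1, ⟨h2, (starProjection_mem_iff V hIV).1 h4⟩, h3⟩, rfl⟩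
  · rintro ⟨α, ⟨h1, ⟨h2, h4⟩, h3⟩, rfl⟩
    exact ⟨⟨α, ⟨h1, h2, h3⟩, rfl⟩, (starProjection_mem_iff V hIV).2 h4⟩

theorem _root_.QRS.IsBase.quot {S R I : Set E} (h : IsBase S R) (hI : I ⊆ S) :
    IsBase (proj I '' (S \ I)) (quotientRoots R I) := by
  have hmap : ∀ α ∈ AddSubmonoid.closure S, proj I α ∈ AddSubmonoid.closure (proj I '' (S \ I)) := by
    intro α hα
    induction hα using AddSubmonoid.closure_induction with
    | mem x hx =>
      by_cases hxI : x ∈ I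
      · rw [proj_eq_zero_iff.2 (Submodule.subset_span hxI)]
        exact zero_mem _
      · exact AddSubmonoid.subset_closure ⟨x, ⟨hx, hxI⟩, rfl⟩
    | zero => rw [map_zero]; exact zero_mem _
    | add x y _ _ hx hy => rw [map_add]; exact add_mem hx hy
  have hdisj : Disjoint (Submodule.span ℝ (S \ I)) (Submodule.span ℝ I) := by
    have := h.linearIndepOn.linearIndependent.disjoint_span_image (s := (↑) ⁻¹' (S \ I))
      (t := (↑) ⁻¹' I) (by
        rw [Set.disjoint_left]
        rintro x hx hx'
        exact hx.2 hx')
    have e : ∀ J ⊆ S, (fun x : S => id (x : E)) '' ((↑) ⁻¹' J) = J := by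
      intro J hJ
      ext x
      constructor
      · rintro ⟨y, hy, rfl⟩
        exact hy
      · intro hx
        exact ⟨⟨x, hJ hx⟩, hx, rfl⟩
    rwa [e _ Set.sdiff_subset, e _ hI] at this
  have hsub : proj I '' (S \ I) ⊆ quotientRoots R I := by
    rintro _ ⟨θ, ⟨hθ, hθI⟩, rfl⟩
    refine ⟨θ, ⟨h.subset hθ, fun hs => ?_⟩, rfl⟩
    have h0 := Submodule.disjoint_def.1 hdisj θ (Submodule.subset_span ⟨hθ, hθI⟩) hs
    exact h.linearIndepOn.zero_notMem_image ⟨θ, hθ, h0⟩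
  refine ⟨hsub, ?_, ?_, ?_⟩
  · have := (h.linearIndepOn.mono (Set.sdiff_subset (t := I))).image
      (f := (proj I : E →ₗ[ℝ] E)) ?_
    · exact this
    · have hk : LinearMap.ker (proj I : E →ₗ[ℝ] E) = Submodule.span ℝ I := by
        ext x
        rw [LinearMap.mem_ker]
        exact proj_eq_zero_iff
      rw [hk]
      exact hdisj
  · refine le_antisymm (Submodule.span_mono hsub) ?_
    rw [Submodule.span_le]
    rintro _ ⟨α, ⟨hα, -⟩, rfl⟩
    have : α ∈ Submodule.span ℝ S := by
      rw [h.span_eq]; exact Submodule.subset_span hα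
    refine proj_mem_span_image_iff.2 ?_
    rwa [Set.union_sdiff_cancel hI]
  · rintro _ ⟨α, ⟨hα, -⟩, rfl⟩
    refine (h.mem_or_neg_mem α hα).imp (hmap α) fun h => ?_
    rw [← map_neg]
    exact hmap _ h

/-- The quotient of `R` by `I` as a quotient of the original root set. -/
theorem IsQuotOf.exists_quot (h : R.IsQuotOf D) {I : Set E} (hI : I ⊆ R.base) :
    ∃ V W : Submodule ℝ E, V ≤ W ∧ R.roots = Vᗮ.starProjection '' {α | α ∈ D ∧ α ∈ W ∧ α ∉ V} ∧
      Submodule.span ℝ I ≤ Vᗮ ∧ V ⊔ Submodule.span ℝ I ≤ W ∧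
      V ⊔ Submodule.span ℝ I = Submodule.span ℝ (D ∩ (V ⊔ Submodule.span ℝ I : Submodule ℝ E)) ∧
      (R.quot I).roots = (V ⊔ Submodule.span ℝ I)ᗮ.starProjection ''
        {α | α ∈ D ∧ α ∈ W ∧ α ∉ V ⊔ Submodule.span ℝ I} := by
  obtain ⟨V, W, hVW, hV, hroots, hb⟩ := h
  have hlift : ∀ x ∈ I, ∃ α ∈ D, α ∈ W ∧ Vᗮ.starProjection α = x := by
    intro x hx
    have := hb.subset (hI hx)
    rw [hroots] at this
    obtain ⟨α, ⟨h1, h2, h3⟩, rfl⟩ := this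
    exact ⟨α, h1, h2, rfl⟩
  have hIV : Submodule.span ℝ I ≤ Vᗮ := by
    rw [Submodule.span_le]
    intro x hx
    obtain ⟨α, -, -, rfl⟩ := hlift x hx
    exact Vᗮ.starProjection_apply_mem α
  refine ⟨V, W, hVW, hroots, hIV, ?_, ?_, ?_⟩
  · refine sup_le hVW ?_
    rw [Submodule.span_le]
    intro x hx
    obtain ⟨α, -, hα, rfl⟩ := hlift x hx
    have := sub_mem hα (hVW (sub_starProjection_mem V α))
    simpa using this
  · refine le_antisymm ?_ (Submodule.span_le.2 fun x hx => hx.2)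
    have h1 : V ≤ Submodule.span ℝ (D ∩ (V ⊔ Submodule.span ℝ I : Submodule ℝ E)) := by
      conv_lhs => rw [hV]
      exact Submodule.span_mono fun x hx => ⟨hx.1, Submodule.mem_sup_left hx.2⟩
    refine sup_le h1 ?_
    rw [Submodule.span_le]
    intro x hx
    obtain ⟨α, hα, -, hαx⟩ := hlift x hx
    have h2 := sub_starProjection_mem V α
    rw [hαx] at h2
    have h3 : α ∈ V ⊔ Submodule.span ℝ I := by
      have : α = (α - x) + x := by abel
      rw [this]
      exact Submodule.add_mem_sup h2 (Submodule.subset_span hx)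
    have h4 := sub_mem (Submodule.subset_span (R := ℝ)
      (s := D ∩ (V ⊔ Submodule.span ℝ I : Submodule ℝ E)) ⟨hα, h3⟩) (h1 h2)
    simpa using h4
  · ext μ
    change μ ∈ quotientRoots R.roots I ↔ _
    rw [quotientRoots, hroots]
    constructor
    · rintro ⟨_, ⟨⟨α, ⟨h1, h2, h3⟩, rfl⟩, h4⟩, rfl⟩
      exact ⟨α, ⟨h1, h2, fun h => h4 ((starProjection_mem_iff V hIV).2 h)⟩,
        (starProjection_starProjection V hIV α).symm⟩
    · rintro ⟨α, ⟨h1, h2, h3⟩, rfl⟩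
      exact ⟨_, ⟨⟨α, ⟨h1, h2, fun h => h3 (Submodule.mem_sup_left h)⟩, rfl⟩,
        fun h => h3 ((starProjection_mem_iff V hIV).1 h)⟩, starProjection_starProjection V hIV α⟩

theorem IsQuotOf.quot (h : R.IsQuotOf D) {I : Set E} (hI : I ⊆ R.base) :
    (R.quot I).IsQuotOf D := by
  have hb : IsBase R.base R.roots := by
    obtain ⟨-, -, -, -, -, hb⟩ := h
    exact hb
  obtain ⟨V, W, -, -, -, h1, h2, h3⟩ := h.exists_quot hI
  exact ⟨_, W, h1, h2, h3, hb.quot hI⟩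

/-- The sum is lifted to D by `exists_fiber_add` and then projected to R. This lets the coloring
rule descend to R/I. -/
theorem IsQuotOf.exists_lift_add (hD : IsRootSet D) (h : R.IsQuotOf D) {I : Set E} (hI : I ⊆ R.base)
    {μ ν : E} (hμ : μ ∈ (R.quot I).roots) (hν : ν ∈ (R.quot I).roots)
    (hμν : μ + ν ∈ (R.quot I).roots) :
    ∃ α ∈ R.roots, ∃ β ∈ R.roots, α + β ∈ R.roots ∧ proj I α = μ ∧ proj I β = ν := by
  obtain ⟨V, W, -, hroots, hIV, h1, h2, h3⟩ := h.exists_quot hI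
  have hq : ∀ μ ∈ (R.quot I).roots, μ ∈ (V ⊔ Submodule.span ℝ I)ᗮ ∧ μ ≠ 0 ∧
      (fiber D (V ⊔ Submodule.span ℝ I) W μ).Nonempty := by
    intro μ hμ
    rw [h3] at hμ
    obtain ⟨α, ⟨h4, h5, h6⟩, rfl⟩ := hμ
    exact ⟨Submodule.starProjection_apply_mem _ α,
      fun h => h6 ((starProjection_eq_zero_iff _).1 h), α, h4, h5, rfl⟩
  obtain ⟨hμ1, hμ2, hμ3⟩ := hq μ hμ
  obtain ⟨hν1, hν2, hν3⟩ := hq ν hν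
  obtain ⟨-, hμν2, hμν3⟩ := hq _ hμν
  obtain ⟨α, ⟨hα1, hα2, hα3⟩, β, ⟨hβ1, hβ2, hβ3⟩, hαβ⟩ :=
    hD.exists_fiber_add h1 h2 hμ1 hν1 hμ2 hν2 hμ3 hν3 hμν3 hμν2
  have hR : ∀ α ∈ D, α ∈ W → (V ⊔ Submodule.span ℝ I)ᗮ.starProjection α ≠ 0 →
      Vᗮ.starProjection α ∈ R.roots := by
    intro α h4 h5 h6
    rw [hroots]
    exact ⟨α, ⟨h4, h5, fun h => h6 ((starProjection_eq_zero_iff _).2 (Submodule.mem_sup_left h))⟩,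
      rfl⟩
  refine ⟨_, hR α hα1 hα2 (by rwa [hα3]), _, hR β hβ1 hβ2 (by rwa [hβ3]), ?_, ?_, ?_⟩
  · rw [← map_add]
    exact hR _ hαβ (add_mem hα2 hβ2) (by rwa [map_add, hα3, hβ3])
  · rw [← hα3]
    exact starProjection_starProjection V hIV α
  · rw [← hβ3]
    exact starProjection_starProjection V hIV β

end BasedRoots

/-! ### Colorings of quotients and the structure theorem -/

namespace BasedRoots

/-- The coloring of the quotient induced by a coloring that is constant along `I`. -/
def quotColor (R : BasedRoots E) (I : Set E) (c : E → E) (μ : E) : E :=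
  open Classical in
  if h : ∃ α ∈ R.pos, α ∉ Submodule.span ℝ I ∧ proj I α = μ then proj I (c h.choose) else 0

/-- The coloring built from a coloring of the quotient and a coloring of the subsystem. -/
def glueColor (R : BasedRoots E) (I : Set E) (q d : E → E) (α : E) : E :=
  open Classical in
  if α ∈ R.pos then
    if α ∈ Submodule.span ℝ I then d α else Function.invFunOn (proj I) (R.base \ I) (q (proj I α))
  else 0

variable {R : BasedRoots E} {I : Set E}

namespace IsAdmissible

variable (hR : R.IsAdmissible) (hI : I ⊆ R.base)
include hR hI

theorem proj_injOn : Set.InjOn (proj I) (R.base \ I) := by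
  intro θ hθ φ hφ h
  have h1 := hR.coef_eq_zero_of_mem_span hI (proj_eq_proj_iff.1 h) hθ.2
  by_contra hne
  rw [map_sub, hR.coef_self hθ.1, hR.coef_of_ne hφ.1 (Ne.symm hne)] at h1
  norm_num at h1

theorem notMem_span_of_mem_sdiff {θ : E} (hθ : θ ∈ R.base \ I) : θ ∉ Submodule.span ℝ I :=
  fun h => hθ.2 ((hR.base_mem_span_iff hI hθ.1).1 h)

theorem proj_mem_quot_pos {α : E} (hα : α ∈ R.pos) (h : α ∉ Submodule.span ℝ I) :
    proj I α ∈ (R.quot I).pos := by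
  refine ⟨⟨α, ⟨hα.1, h⟩, rfl⟩, ?_⟩
  have : ∀ α ∈ AddSubmonoid.closure R.base,
      proj I α ∈ AddSubmonoid.closure (proj I '' (R.base \ I)) := by
    intro α hα
    induction hα using AddSubmonoid.closure_induction with
    | mem x hx =>
      by_cases hxI : x ∈ I
      · rw [proj_eq_zero_iff.2 (Submodule.subset_span hxI)]
        exact zero_mem _
      · exact AddSubmonoid.subset_closure ⟨x, ⟨hx, hxI⟩, rfl⟩
    | zero => rw [map_zero]; exact zero_mem _
    | add x y _ _ hx hy => rw [map_add]; exact add_mem hx hy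
  exact this α hα.2

/-- If -α were positive, the quotient would contain two positive roots with sum zero. -/
theorem pos_of_proj_mem_quot_pos (hQ : (R.quot I).IsAdmissible) {α : E} (hα : α ∈ R.roots)
    (h : proj I α ∈ (R.quot I).pos) : α ∈ R.pos := by
  refine (hR.pos_or_neg_pos hα).resolve_right fun hneg => ?_
  have h1 : α ∉ Submodule.span ℝ I := fun hs => hQ.ne_zero h.1 (proj_eq_zero_iff.2 hs)
  have h2 := hR.proj_mem_quot_pos hI hneg fun hs => h1 (by simpa using neg_mem hs)
  refine hQ.add_ne_zero h h2 ?_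
  rw [map_neg, add_neg_cancel]

theorem quot_pos (hQ : (R.quot I).IsAdmissible) :
    (R.quot I).pos = proj I '' (R.pos \ (Submodule.span ℝ I : Set E)) := by
  ext μ
  constructor
  · intro h
    obtain ⟨⟨α, ⟨h1, h2⟩, rfl⟩, -⟩ := id h
    exact ⟨α, ⟨hR.pos_of_proj_mem_quot_pos hI hQ h1 h, h2⟩, rfl⟩
  · rintro ⟨α, ⟨h1, h2⟩, rfl⟩
    exact hR.proj_mem_quot_pos hI h1 h2

theorem quotColor_proj {c : E → E} (hc : R.IsColoring c) (hfib : R.FibConst c I) {α : E}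
    (hα : α ∈ R.pos) (h : α ∉ Submodule.span ℝ I) :
    R.quotColor I c (proj I α) = proj I (c α) := by
  have hex : ∃ β ∈ R.pos, β ∉ Submodule.span ℝ I ∧ proj I β = proj I α := ⟨α, hα, h, rfl⟩
  rw [quotColor, dif_pos hex]
  obtain ⟨h1, h2, h3⟩ := hex.choose_spec
  rw [hR.color_eq_of_sub_mem_span hc hI hfib h1 hα h2 (proj_eq_proj_iff.1 h3)]

theorem color_mem_sdiff {c : E → E} (hc : R.IsColoring c) (hfib : R.FibConst c I) {α : E}
    (hα : α ∈ R.pos) (h : α ∉ Submodule.span ℝ I) : c α ∈ R.base \ I :=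
  ⟨hR.color_mem hc hα, hR.color_notMem_of_notMem_span hc hI hfib α hα h⟩

end IsAdmissible

variable {D : Set E} (hD : IsRootSet D) (h : R.IsQuotOf D) (hI : I ⊆ R.base)
include hD h hI

theorem IsQuotOf.isColoring_quotColor {c : E → E} (hc : R.IsColoring c) (hfib : R.FibConst c I) :
    (R.quot I).IsColoring (R.quotColor I c) := by
  have hR := h.isAdmissible hD
  have hQ := (h.quot hI).isAdmissible hD
  constructor
  · rintro _ ⟨θ, hθ, rfl⟩
    rw [hR.quotColor_proj hI hc hfib (hR.base_pos hθ.1) (hR.notMem_span_of_mem_sdiff hI hθ),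
      hc.base θ hθ.1]
  · intro μ hμ ν hν hμν
    obtain ⟨α, hα, β, hβ, hαβ, rfl, rfl⟩ := h.exists_lift_add hD hI hμ.1 hν.1 hμν.1
    have hα' := hR.pos_of_proj_mem_quot_pos hI hQ hα hμ
    have hβ' := hR.pos_of_proj_mem_quot_pos hI hQ hβ hν
    have hαI : α ∉ Submodule.span ℝ I := fun hs => hQ.ne_zero hμ.1 (proj_eq_zero_iff.2 hs)
    have hβI : β ∉ Submodule.span ℝ I := fun hs => hQ.ne_zero hν.1 (proj_eq_zero_iff.2 hs)
    rw [← map_add, hR.quotColor_proj hI hc hfib (hR.add_pos hα' hβ' hαβ)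
      (hR.add_notMem_span hI hα' hβ' hαI), hR.quotColor_proj hI hc hfib hα' hαI,
      hR.quotColor_proj hI hc hfib hβ' hβI]
    rcases hR.color_add hc hα' hβ' hαβ with h | h
    · rw [h]; exact Or.inl rfl
    · rw [h]; exact Or.inr rfl

/-- Pulling back a set along which the quotient coloring is constant. -/
theorem IsQuotOf.fibConst_preimage {c : E → E} (hc : R.IsColoring c) (hfib : R.FibConst c I)
    {K : Set E}
    (hq : (R.quot I).FibConst (R.quotColor I c) (proj I '' K)) : R.FibConst c (I ∪ K) := by
  have hR := h.isAdmissible hD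
  have hQ := (h.quot hI).isAdmissible hD
  intro α hα hαK β hβ hβK hαβ
  have hαI : α ∉ Submodule.span ℝ I := fun h =>
    hαK (Submodule.span_mono Set.subset_union_left h)
  by_cases hβI : β ∈ Submodule.span ℝ I
  · exact hfib α hα hαI β hβ hβI hαβ
  have hαβpos := hR.add_pos hα hβ hαβ
  have hαβI := hR.add_notMem_span hI hα hβ hαI
  have h1 := hq _ (hR.proj_mem_quot_pos hI hα hαI) (fun h => hαK (proj_mem_span_image_iff.1 h)) _
    (hR.proj_mem_quot_pos hI hβ hβI) (proj_mem_span_image_iff.2 hβK)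
    (by rw [← map_add]; exact (hR.proj_mem_quot_pos hI hαβpos hαβI).1)
  rw [← map_add, hR.quotColor_proj hI hc hfib hαβpos hαβI, hR.quotColor_proj hI hc hfib hα hαI] at h1
  exact hR.proj_injOn hI (hR.color_mem_sdiff hI hc hfib hαβpos hαβI)
    (hR.color_mem_sdiff hI hc hfib hα hαI) h1

omit hI in
/-- The structure theorem: every coloring is constant along a set of all but one or two simple
roots. -/
theorem IsQuotOf.hasFibration {c : E → E} (hc : R.IsColoring c) (hne : R.base.Nonempty) :
    R.HasFibration c := by
  obtain ⟨n, hn⟩ : ∃ n, R.base.ncard = n := ⟨_, rfl⟩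
  induction n using Nat.strong_induction_on generalizing R c with
  | _ n ih =>
    have hR := h.isAdmissible hD
    have hfin := hR.base_finite
    have hpos : 0 < R.base.ncard := (Set.ncard_pos hfin).2 hne
    -- The support J of a suitable color is proper and contains that color, so R/J has smaller
    -- non-zero rank; a set found there is pulled back to J ∪ K. In rank one or two the empty set
    -- serves.
    by_cases h3 : 3 ≤ R.base.ncard
    · obtain ⟨ψ, hψ, hJ⟩ := hR.exists_supp_ne_base hc h3 fun T hT hTne hTn =>
        ih _ (by rw [← hn]; exact Set.ncard_lt_ncard (hT.ssubset_of_ne hTne) hfin) (h.sub hD hT)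
          (hR.isColoring_sub hc hT) hTn rfl
      set J := {θ ∈ R.base | ∃ α ∈ R.pos, c α = ψ ∧ 0 < R.coef θ α} with hJdef
      have hJb : J ⊆ R.base := fun θ h => h.1
      have hψJ : ψ ∈ J := ⟨hψ, ψ, hR.base_pos hψ, hc.base ψ hψ, by rw [hR.coef_self hψ]; norm_num⟩
      have hfib := hR.fibConst_supp hc ψ
      have hcardq : (R.quot J).base.ncard = (R.base \ J).ncard :=
        (hR.proj_injOn hJb).ncard_image
      have hlt : (R.base \ J).ncard < R.base.ncard :=
        Set.ncard_lt_ncard ⟨Set.sdiff_subset, fun h => (h hψ).2 hψJ⟩ hfin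
      have hne' : (R.quot J).base.Nonempty := by
        refine Set.Nonempty.image _ (Set.sdiff_nonempty.2 fun h => ?_)
        exact hJ (subset_antisymm hJb h)
      obtain ⟨K', hK', hcard, hq⟩ := ih _ (by rw [hcardq, ← hn]; exact hlt) (h.quot hJb)
        (h.isColoring_quotColor hD hJb hc hfib) hne' rfl
      obtain ⟨K, hK, rfl⟩ := Set.subset_image_iff.1 hK'
      refine ⟨J ∪ K, Set.union_subset hJb (hK.trans Set.sdiff_subset), ?_,
        h.fibConst_preimage hD hJb hc hfib hq⟩
      have e : (R.quot J).base \ (proj J '' K) = proj J '' (R.base \ (J ∪ K)) := by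
        change proj J '' (R.base \ J) \ proj J '' K = _
        rw [← (hR.proj_injOn hJb).image_sdiff_subset hK, Set.sdiff_sdiff]
      rw [e, ((hR.proj_injOn hJb).mono
        (Set.sdiff_subset_sdiff_right Set.subset_union_left)).ncard_image] at hcard
      exact hcard
    · refine ⟨∅, Set.empty_subset _, ?_, ?_⟩
      · rw [Set.sdiff_empty]; omega
      · intro α _ _ β hβ hβ0
        rw [Submodule.span_empty] at hβ0
        exact absurd hβ0 (hR.ne_zero hβ.1)

end BasedRoots

/-- Invariance of the inner product identifies the pairing of β with α as 2⟪α, β⟫ / ⟪α, α⟫, so a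
negative inner product is a negative integral pairing. -/
theorem isRootSet_range_root {ι N : Type*} [Finite ι] [AddCommGroup N] [Module ℝ N]
    (Δ : RootPairing ι ℝ E N) [Δ.IsCrystallographic]
    (hΔ : ∀ (i : ι) (x y : E), ⟪Δ.reflection i x, Δ.reflection i y⟫_ℝ = ⟪x, y⟫_ℝ) :
    IsRootSet (Set.range Δ.root) := by
  have hpair : ∀ i j, Δ.pairing j i * ⟪Δ.root i, Δ.root i⟫_ℝ = 2 * ⟪Δ.root i, Δ.root j⟫_ℝ := by
    intro i j
    have h := hΔ i (Δ.root j) (Δ.root i)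
    rw [Δ.reflection_apply_root, Δ.reflection_apply_root, Δ.pairing_same, inner_sub_left,
      inner_sub_right, inner_sub_right, inner_smul_left, inner_smul_left, inner_smul_right,
      inner_smul_right, real_inner_comm (Δ.root i) (Δ.root j)] at h
    simp only [conj_trivial] at h
    linarith
  have hpos : ∀ i, 0 < ⟪Δ.root i, Δ.root i⟫_ℝ := fun i => real_inner_self_pos.mpr (Δ.ne_zero i)
  refine ⟨Set.finite_range _, ?_, ?_, ?_, ?_⟩
  · rintro ⟨i, hi⟩
    exact Δ.ne_zero i hi
  · rintro _ ⟨i, rfl⟩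
    exact ⟨Δ.reflectionPerm i i, by rw [Δ.root_reflectionPerm, Δ.reflection_apply_self]⟩
  · rintro _ ⟨i, rfl⟩ _ ⟨j, rfl⟩
    refine ⟨Δ.reflectionPerm i j, ?_⟩
    rw [Δ.root_reflectionPerm, Δ.reflection_apply_root, ← hpair, mul_div_assoc,
      div_self (hpos i).ne', mul_one]
  · rintro _ ⟨i, rfl⟩ _ ⟨j, rfl⟩ h hne
    refine Δ.root_add_root_mem_of_pairingIn_neg ?_ fun h => hne (by rw [h, neg_add_cancel])
    have h1 := hpair j i
    have h2 : Δ.pairing i j < 0 := by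
      by_contra! h3
      have := mul_nonneg h3 (hpos j).le
      rw [h1, real_inner_comm] at this
      linarith
    rw [← Δ.algebraMap_pairingIn ℤ] at h2
    simpa using h2

/-! ### Fine decompositions as colorings -/

namespace BasedRoots

/-- The coloring attached to a fine decomposition: the simple root in the same part. -/
def partColor (R : BasedRoots E) (P : Set (Set E)) (α : E) : E :=
  open Classical in
  if h : ∃ θ ∈ R.base, ∃ Φ ∈ P, θ ∈ Φ ∧ α ∈ Φ then h.choose else 0

/-- The colorings, normalized to vanish outside of the positive roots. -/
def colorings (R : BasedRoots E) : Set (E → E) :=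
  {c | R.IsColoring c ∧ ∀ α ∉ R.pos, c α = 0}

/-- The color classes. -/
def colorClasses (R : BasedRoots E) (c : E → E) : Set (Set E) :=
  (fun θ => {α | α ∈ R.pos ∧ c α = θ}) '' R.base

namespace IsAdmissible

variable {R : BasedRoots E} (hR : R.IsAdmissible)
include hR

theorem rank_eq : R.rank = R.base.ncard := by
  have := hR.base_finite.fintype
  rw [rank, ← hR.isBase.span_eq, finrank_span_set_eq_card hR.isBase.linearIndepOn,
    Set.ncard_eq_toFinset_card']

/-- If α ∈ Φ splits as (α - θ) + θ, co-closedness puts one of the parts in Φ; descend on the height.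
-/
theorem exists_base_mem {Φ : Set E} (hΦ : R.IsInversionSet Φ) : ∀ α ∈ R.pos, α ∈ Φ →
    ∃ θ ∈ R.base, θ ∈ Φ := by
  refine hR.pos_induction fun α hα ih h => ?_
  by_cases hb : α ∈ R.base
  · exact ⟨α, hb, h⟩
  obtain ⟨θ, hθ, -, -, hpos⟩ := hR.exists_sub_base_pos hα hb
  by_cases h1 : θ ∈ Φ
  · exact ⟨θ, hθ, h1⟩
  by_cases h2 : α - θ ∈ Φ
  · exact ih _ hpos (by rw [map_sub, hR.ht_base hθ]; linarith) h2
  have := hΦ.coclosed _ ⟨hpos, h2⟩ θ ⟨hR.base_pos hθ, h1⟩ (by simpa using hα)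
  rw [sub_add_cancel] at this
  exact absurd h this.2

/-- Disjoint parts contain distinct simple roots and there are as many parts as simple roots, so
choosing one in each part is a bijection. -/
theorem exists_inter_base_eq {P : Set (Set E)} (hP : R.IsFineDecomposition P) :
    ∃ s : Set E → E, (∀ Φ ∈ P, Φ ∩ R.base = {s Φ}) ∧ s '' P = R.base := by
  have hex : ∀ Φ ∈ P, ∃ θ ∈ R.base, θ ∈ Φ := by
    intro Φ hΦ
    obtain ⟨α, hα⟩ := hP.nonempty Φ hΦ
    exact hR.exists_base_mem (hP.inversionSet Φ hΦ) α ((hP.inversionSet Φ hΦ).subset_pos hα) hα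
  choose! s hs hsΦ using hex
  have hdisj : ∀ Φ ∈ P, ∀ Φ' ∈ P, ∀ x, x ∈ Φ → x ∈ Φ' → Φ = Φ' := by
    intro Φ hΦ Φ' hΦ' x hx hx'
    by_contra hne
    exact Set.disjoint_left.1 (hP.pairwiseDisjoint hΦ hΦ' hne) hx hx'
  have hinj : Set.InjOn s P := fun Φ hΦ Φ' hΦ' h =>
    hdisj Φ hΦ Φ' hΦ' (s Φ) (hsΦ Φ hΦ) (h ▸ hsΦ Φ' hΦ')
  have himg : s '' P = R.base := by
    refine Set.eq_of_subset_of_ncard_le ?_ ?_ hR.base_finite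
    · rintro _ ⟨Φ, hΦ, rfl⟩
      exact hs Φ hΦ
    · rw [hinj.ncard_image, hP.ncard_eq, hR.rank_eq]
  refine ⟨s, fun Φ hΦ => ?_, himg⟩
  ext θ
  constructor
  · rintro ⟨h1, h2⟩
    rw [← himg] at h2
    obtain ⟨Φ', hΦ', rfl⟩ := h2
    rw [hdisj Φ hΦ Φ' hΦ' _ h1 (hsΦ Φ' hΦ')]
    rfl
  · rintro rfl
    exact ⟨hsΦ Φ hΦ, hs Φ hΦ⟩

theorem partColor_spec {P : Set (Set E)} (hP : R.IsFineDecomposition P) {α : E} (hα : α ∈ R.pos) :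
    R.partColor P α ∈ R.base ∧ ∀ Φ ∈ P, α ∈ Φ ↔ R.partColor P α ∈ Φ := by
  obtain ⟨s, hs, -⟩ := hR.exists_inter_base_eq hP
  have hα' := hα
  rw [← hP.sUnion_eq] at hα'
  obtain ⟨Φ, hΦ, hαΦ⟩ := hα'
  have hsΦ : s Φ ∈ Φ ∩ R.base := by rw [hs Φ hΦ]; rfl
  have hex : ∃ θ ∈ R.base, ∃ Φ ∈ P, θ ∈ Φ ∧ α ∈ Φ := ⟨s Φ, hsΦ.2, Φ, hΦ, hsΦ.1, hαΦ⟩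
  rw [partColor, dif_pos hex]
  obtain ⟨h1, Φ', hΦ', h2, h3⟩ := hex.choose_spec
  have hdisj : ∀ Φ ∈ P, ∀ Φ' ∈ P, ∀ x, x ∈ Φ → x ∈ Φ' → Φ = Φ' := by
    intro Φ hΦ Φ' hΦ' x hx hx'
    by_contra hne
    exact Set.disjoint_left.1 (hP.pairwiseDisjoint hΦ hΦ' hne) hx hx'
  refine ⟨h1, fun Ψ hΨ => ⟨fun h => ?_, fun h => ?_⟩⟩
  · rwa [hdisj Ψ hΨ Φ' hΦ' α h h3]
  · rwa [hdisj Ψ hΨ Φ' hΦ' _ h h2]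

theorem partColor_eq_iff {P : Set (Set E)} (hP : R.IsFineDecomposition P) {Φ : Set E} (hΦ : Φ ∈ P)
    {θ : E} (hθ : θ ∈ R.base) (hθΦ : θ ∈ Φ) {α : E} (hα : α ∈ R.pos) :
    R.partColor P α = θ ↔ α ∈ Φ := by
  obtain ⟨h1, h2⟩ := hR.partColor_spec hP hα
  rw [h2 Φ hΦ]
  constructor
  · intro h
    rwa [h]
  · intro h
    obtain ⟨s, hs, -⟩ := hR.exists_inter_base_eq hP
    have h3 : R.partColor P α ∈ Φ ∩ R.base := ⟨h, h1⟩
    have h4 : θ ∈ Φ ∩ R.base := ⟨hθΦ, hθ⟩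
    rw [hs Φ hΦ] at h3 h4
    exact h3.trans h4.symm

theorem partColor_mem_colorings {P : Set (Set E)} (hP : R.IsFineDecomposition P) :
    R.partColor P ∈ R.colorings := by
  have hmem : ∀ α ∈ R.pos, ∃ Φ ∈ P, α ∈ Φ := fun α hα => by
    rw [← hP.sUnion_eq] at hα
    exact hα
  refine ⟨⟨fun θ hθ => ?_, fun α hα β hβ hαβ => ?_⟩, fun α hα => ?_⟩
  · obtain ⟨Φ, hΦ, hθΦ⟩ := hmem θ (hR.base_pos hθ)
    exact (hR.partColor_eq_iff hP hΦ hθ hθΦ (hR.base_pos hθ)).2 hθΦ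
  · obtain ⟨Φ, hΦ, hmΦ⟩ := hmem _ hαβ
    have h1 := hR.partColor_spec hP hαβ
    have hc := (h1.2 Φ hΦ).1 hmΦ
    by_contra! hcon
    have h2 : α ∉ Φ := fun h => hcon.1 ((hR.partColor_eq_iff hP hΦ h1.1 hc hα).2 h).symm
    have h3 : β ∉ Φ := fun h => hcon.2 ((hR.partColor_eq_iff hP hΦ h1.1 hc hβ).2 h).symm
    exact ((hP.inversionSet Φ hΦ).coclosed α ⟨hα, h2⟩ β ⟨hβ, h3⟩ hαβ).2 hmΦ
  · rw [partColor, dif_neg]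
    rintro ⟨θ, -, Φ, hΦ, -, h⟩
    exact hα ((hP.inversionSet Φ hΦ).subset_pos h)

theorem colorClasses_partColor {P : Set (Set E)} (hP : R.IsFineDecomposition P) :
    R.colorClasses (R.partColor P) = P := by
  obtain ⟨s, hs, himg⟩ := hR.exists_inter_base_eq hP
  have key : ∀ Φ ∈ P, {α | α ∈ R.pos ∧ R.partColor P α = s Φ} = Φ := by
    intro Φ hΦ
    have hsΦ : s Φ ∈ Φ ∩ R.base := by rw [hs Φ hΦ]; rfl
    ext α
    constructor
    · rintro ⟨h1, h2⟩
      exact (hR.partColor_eq_iff hP hΦ hsΦ.2 hsΦ.1 h1).1 h2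
    · intro h
      have h1 := (hP.inversionSet Φ hΦ).subset_pos h
      exact ⟨h1, (hR.partColor_eq_iff hP hΦ hsΦ.2 hsΦ.1 h1).2 h⟩
  rw [colorClasses, ← himg, Set.image_image]
  ext Φ
  constructor
  · rintro ⟨Φ', hΦ', rfl⟩
    change {α | α ∈ R.pos ∧ R.partColor P α = s Φ'} ∈ P
    rwa [key Φ' hΦ']
  · intro hΦ
    exact ⟨Φ, hΦ, key Φ hΦ⟩

theorem isInversionSet_colorClass {c : E → E} (hc : R.IsColoring c) (T : Set E) :
    R.IsInversionSet {α | α ∈ R.pos ∧ c α ∈ T} := by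
  refine ⟨fun α h => h.1, ?_, ?_⟩
  · rintro α ⟨hα, h1⟩ β ⟨hβ, h2⟩ h
    refine ⟨h, ?_⟩
    rcases hc.add α hα β hβ h with h3 | h3 <;> rw [h3] <;> assumption
  · rintro α ⟨hα, h1⟩ β ⟨hβ, h2⟩ h
    refine ⟨h, fun h' => ?_⟩
    rcases hc.add α hα β hβ h with h3 | h3
    · exact h1 ⟨hα, h3 ▸ h'.2⟩
    · exact h2 ⟨hβ, h3 ▸ h'.2⟩

theorem isFineDecomposition_colorClasses {c : E → E} (hc : R.IsColoring c) :
    R.IsFineDecomposition (R.colorClasses c) := by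
  have hinj : Set.InjOn (fun θ => {α | α ∈ R.pos ∧ c α = θ}) R.base := by
    intro θ hθ φ hφ h
    have h1 : θ ∈ {α | α ∈ R.pos ∧ c α = θ} := ⟨hR.base_pos hθ, hc.base θ hθ⟩
    simp only at h
    rw [h] at h1
    exact (hc.base θ hθ).symm.trans h1.2
  refine ⟨⟨?_, ?_, ?_, ?_⟩, hR.base_finite.image _, ?_⟩
  · rintro _ ⟨θ, hθ, rfl⟩
    exact hR.isInversionSet_colorClass hc {θ}
  · rintro _ ⟨θ, hθ, rfl⟩
    exact ⟨θ, hR.base_pos hθ, hc.base θ hθ⟩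
  · rintro _ ⟨θ, hθ, rfl⟩ _ ⟨φ, hφ, rfl⟩ hne
    refine Set.disjoint_left.2 fun α h1 h2 => hne ?_
    have : θ = φ := h1.2.symm.trans h2.2
    rw [this]
  · ext α
    constructor
    · rintro ⟨_, ⟨θ, hθ, rfl⟩, h⟩
      exact h.1
    · intro h
      exact ⟨_, ⟨c α, hR.color_mem hc h, rfl⟩, h, rfl⟩
  · rw [colorClasses, hinj.ncard_image, hR.rank_eq]

theorem colorClasses_injOn : Set.InjOn R.colorClasses R.colorings := by
  intro c hc d hd h
  funext α
  by_cases hα : α ∈ R.pos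
  · have h1 : {β | β ∈ R.pos ∧ c β = c α} ∈ R.colorClasses d := by
      rw [← h]
      exact ⟨c α, hR.color_mem hc.1 hα, rfl⟩
    obtain ⟨θ, hθ, he⟩ := h1
    have hcα := hR.color_mem hc.1 hα
    have h2 : c α ∈ {β | β ∈ R.pos ∧ c β = c α} := ⟨hR.base_pos hcα, hc.1.base _ hcα⟩
    have h3 : α ∈ {β | β ∈ R.pos ∧ c β = c α} := ⟨hα, rfl⟩
    rw [← he] at h2 h3
    rw [← hd.1.base _ hcα]
    exact h2.2.trans h3.2.symm
  · rw [hc.2 α hα, hd.2 α hα]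

/-- Fine decompositions are counted by colorings. -/
theorem numFine_eq : R.numFine = R.colorings.ncard := by
  rw [numFine, ← hR.colorClasses_injOn.ncard_image]
  congr 1
  ext P
  constructor
  · intro hP
    exact ⟨_, hR.partColor_mem_colorings hP, hR.colorClasses_partColor hP⟩
  · rintro ⟨c, hc, rfl⟩
    exact hR.isFineDecomposition_colorClasses hc.1

theorem ncard_inter_base {P : Set (Set E)} (hP : R.IsFineDecomposition P) {Φ : Set E}
    (hΦ : Φ ∈ P) : (Φ ∩ R.base).ncard = 1 := by
  obtain ⟨s, hs, -⟩ := hR.exists_inter_base_eq hP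
  rw [hs Φ hΦ, Set.ncard_singleton]

end IsAdmissible

variable {D : Set E} {R : BasedRoots E}

/-- Let the coloring be constant along I. A part whose simple root is in I lies in span I; any other
part is a union of fibers of the projection. -/
theorem IsQuotOf.exists_inflation (hD : IsRootSet D) (h : R.IsQuotOf D) (hne : R.base.Nonempty)
    {P : Set (Set E)} (hP : R.IsFineDecomposition P) :
    ∃ I ⊆ R.base, ((R.quot I).rank = 1 ∨ (R.quot I).rank = 2) ∧
      ∀ Φ ∈ P, (∃ Ψ ⊆ (R.quot I).pos, Φ = R.inflation I Ψ ∅) ∨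
        (∃ X ⊆ (R.sub I).pos, Φ = R.inflation I ∅ X) := by
  have hR := h.isAdmissible hD
  have hc := (hR.partColor_mem_colorings hP).1
  obtain ⟨I, hI, hcard, hfib⟩ := h.hasFibration hD hc hne
  have hQ := (h.quot hI).isAdmissible hD
  refine ⟨I, hI, ?_, fun Φ hΦ => ?_⟩
  · rw [hQ.rank_eq]
    change (proj I '' (R.base \ I)).ncard = 1 ∨ (proj I '' (R.base \ I)).ncard = 2
    rwa [(hR.proj_injOn hI).ncard_image]
  have hΦpos := (hP.inversionSet Φ hΦ).subset_pos
  have hθ := hR.ncard_inter_base hP hΦ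
  obtain ⟨θ, hθ⟩ := Set.ncard_eq_one.1 hθ
  have hθ' : θ ∈ Φ ∩ R.base := by rw [hθ]; rfl
  have hiff := fun {α : E} (hα : α ∈ R.pos) => hR.partColor_eq_iff hP hΦ hθ'.2 hθ'.1 hα
  by_cases hθI : θ ∈ I
  · right
    refine ⟨Φ, fun α hα => ?_, ?_⟩
    · rw [hR.pos_sub hI]
      refine ⟨hΦpos hα, ?_⟩
      by_contra hn
      refine hR.color_notMem_of_notMem_span hc hI hfib α (hΦpos hα) hn ?_
      rwa [(hiff (hΦpos hα)).2 hα]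
    · simp [inflation]
  · left
    have hout : ∀ α ∈ Φ, α ∉ Submodule.span ℝ I := by
      intro α hα hs
      have := hR.color_mem_of_mem_span hc hI (hΦpos hα) hs
      rw [(hiff (hΦpos hα)).2 hα] at this
      exact hθI this
    refine ⟨proj I '' Φ, ?_, ?_⟩
    · rintro _ ⟨α, hα, rfl⟩
      exact hR.proj_mem_quot_pos hI (hΦpos hα) (hout α hα)
    · rw [inflation, Set.union_empty]
      ext α
      constructor
      · intro hα
        exact ⟨hΦpos hα, α, hα, rfl⟩
      · rintro ⟨hα, β, hβ, he⟩
        rw [← hiff hα, ← (hiff (hΦpos hβ)).2 hβ]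
        exact (hR.color_eq_of_sub_mem_span hc hI hfib (hΦpos hβ) hα (hout β hβ)
          (proj_eq_proj_iff.1 he)).symm

end BasedRoots

/-! ### Counting colorings constant along a set of simple roots -/

namespace BasedRoots

/-- The restriction of a coloring to a subsystem. -/
def subColor (R : BasedRoots E) (I : Set E) (c : E → E) (α : E) : E :=
  open Classical in
  if α ∈ (R.sub I).pos then c α else 0

variable {R : BasedRoots E} {I : Set E}

theorem IsAdmissible.colorings_finite (hR : R.IsAdmissible) : R.colorings.Finite := by
  refine Set.Finite.of_finite_image ((hR.pos_finite.finite_subsets.finite_subsets).subset ?_)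
    hR.colorClasses_injOn
  rintro _ ⟨c, hc, rfl⟩ _ ⟨θ, hθ, rfl⟩ α hα
  exact hα.1

theorem IsColoring.congr {c d : E → E} (hR : R.IsAdmissible) (hc : R.IsColoring c)
    (h : ∀ α ∈ R.pos, d α = c α) : R.IsColoring d where
  base θ hθ := by rw [h θ (hR.base_pos hθ), hc.base θ hθ]
  add α hα β hβ hαβ := by
    rw [h _ hα, h _ hβ, h _ hαβ]
    exact hc.add α hα β hβ hαβ

namespace IsAdmissible

variable (hR : R.IsAdmissible) (hI : I ⊆ R.base)
include hR hI

theorem subColor_mem_colorings {c : E → E} (hc : R.IsColoring c) :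
    R.subColor I c ∈ (R.sub I).colorings := by
  refine ⟨(hR.isColoring_sub hc hI).congr (hR.sub hI) fun α hα => ?_, fun α hα => ?_⟩
  · rw [subColor, if_pos hα]
  · rw [subColor, if_neg hα]

section Glue

variable (hQ : (R.quot I).IsAdmissible) {q d : E → E} (hq : (R.quot I).IsColoring q)
  (hd : (R.sub I).IsColoring d)

theorem glueColor_of_mem {α : E} (hα : α ∈ R.pos) (h : α ∈ Submodule.span ℝ I) :
    R.glueColor I q d α = d α := by
  rw [glueColor, if_pos hα, if_pos h]

include hQ hq

theorem glueColor_of_notMem {α : E} (hα : α ∈ R.pos) (h : α ∉ Submodule.span ℝ I) :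
    R.glueColor I q d α ∈ R.base \ I ∧ proj I (R.glueColor I q d α) = q (proj I α) := by
  rw [glueColor, if_pos hα, if_neg h]
  have hex : ∃ θ ∈ R.base \ I, proj I θ = q (proj I α) :=
    hQ.color_mem hq (hR.proj_mem_quot_pos hI hα h)
  exact ⟨Function.invFunOn_mem hex, Function.invFunOn_eq hex⟩

include hd

theorem glueColor_mem_colorings : R.glueColor I q d ∈ R.colorings := by
  have hin : ∀ {α : E}, α ∈ R.pos → α ∈ Submodule.span ℝ I → α ∈ (R.sub I).pos := fun h h' => by
    rw [hR.pos_sub hI]; exact ⟨h, h'⟩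
  have hmix : ∀ α ∈ R.pos, ∀ β ∈ R.pos, α + β ∈ R.pos → α ∉ Submodule.span ℝ I →
      β ∈ Submodule.span ℝ I → R.glueColor I q d (α + β) = R.glueColor I q d α := by
    intro α hα β hβ hαβ hαI hβI
    obtain ⟨h1, h2⟩ := hR.glueColor_of_notMem hI hQ hq (d := d) hα hαI
    obtain ⟨h3, h4⟩ := hR.glueColor_of_notMem hI hQ hq (d := d) hαβ
      (hR.add_notMem_span hI hα hβ hαI)
    refine hR.proj_injOn hI h3 h1 ?_
    rw [h2, h4, map_add, proj_eq_zero_iff.2 hβI, add_zero]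
  refine ⟨⟨fun θ hθ => ?_, fun α hα β hβ hαβ => ?_⟩, fun α hα => ?_⟩
  · by_cases hθI : θ ∈ I
    · rw [hR.glueColor_of_mem hI (hR.base_pos hθ) (Submodule.subset_span hθI), hd.base θ hθI]
    · obtain ⟨h1, h2⟩ := hR.glueColor_of_notMem hI hQ hq (d := d) (hR.base_pos hθ)
        (hR.notMem_span_of_mem_sdiff hI ⟨hθ, hθI⟩)
      refine hR.proj_injOn hI h1 ⟨hθ, hθI⟩ ?_
      rw [h2]
      exact hq.base _ ⟨θ, ⟨hθ, hθI⟩, rfl⟩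
  · by_cases hαI : α ∈ Submodule.span ℝ I
    · by_cases hβI : β ∈ Submodule.span ℝ I
      · rw [hR.glueColor_of_mem hI hα hαI, hR.glueColor_of_mem hI hβ hβI,
          hR.glueColor_of_mem hI hαβ (add_mem hαI hβI)]
        exact hd.add α (hin hα hαI) β (hin hβ hβI) (hin hαβ (add_mem hαI hβI))
      · right
        rw [add_comm] at hαβ ⊢
        exact hmix β hβ α hα hαβ hβI hαI
    · by_cases hβI : β ∈ Submodule.span ℝ I
      · exact Or.inl (hmix α hα β hβ hαβ hαI hβI)
      · have hαβI := hR.add_notMem_span hI hα hβ hαI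
        obtain ⟨h1, h2⟩ := hR.glueColor_of_notMem hI hQ hq (d := d) hα hαI
        obtain ⟨h3, h4⟩ := hR.glueColor_of_notMem hI hQ hq (d := d) hβ hβI
        obtain ⟨h5, h6⟩ := hR.glueColor_of_notMem hI hQ hq (d := d) hαβ hαβI
        have h7 := hq.add _ (hR.proj_mem_quot_pos hI hα hαI) _ (hR.proj_mem_quot_pos hI hβ hβI)
          (by rw [← map_add]; exact hR.proj_mem_quot_pos hI hαβ hαβI)
        rw [← map_add] at h7
        refine h7.imp (fun h => hR.proj_injOn hI h5 h1 ?_) (fun h => hR.proj_injOn hI h5 h3 ?_)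
        · rw [h6, h2, h]
        · rw [h6, h4, h]
  · rw [glueColor, if_neg hα]

theorem fibConst_glueColor : R.FibConst (R.glueColor I q d) I := by
  intro α hα hαI β hβ hβI hαβ
  obtain ⟨h1, h2⟩ := hR.glueColor_of_notMem hI hQ hq (d := d) hα hαI
  obtain ⟨h3, h4⟩ := hR.glueColor_of_notMem hI hQ hq (d := d) (hR.add_pos hα hβ hαβ)
    (hR.add_notMem_span hI hα hβ hαI)
  refine hR.proj_injOn hI h3 h1 ?_
  rw [h2, h4, map_add, proj_eq_zero_iff.2 hβI, add_zero]

end Glue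

end IsAdmissible

variable {D : Set E} (hD : IsRootSet D) (h : R.IsQuotOf D) (hI : I ⊆ R.base)
include hD h hI

theorem IsQuotOf.quotColor_mem_colorings {c : E → E} (hc : R.IsColoring c)
    (hfib : R.FibConst c I) : R.quotColor I c ∈ (R.quot I).colorings := by
  refine ⟨h.isColoring_quotColor hD hI hc hfib, fun μ hμ => ?_⟩
  rw [quotColor, dif_neg]
  rintro ⟨α, hα, hαI, rfl⟩
  exact hμ ((h.isAdmissible hD).proj_mem_quot_pos hI hα hαI)

/-- Colorings that are constant along `I` are pairs of a coloring of the quotient and a coloring of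
the subsystem. -/
theorem IsQuotOf.ncard_fibConst (Q : Set (E → E)) :
    {c ∈ R.colorings | R.FibConst c I ∧ R.quotColor I c ∈ Q}.ncard =
      ((R.quot I).colorings ∩ Q).ncard * (R.sub I).colorings.ncard := by
  have hR := h.isAdmissible hD
  have hQ := (h.quot hI).isAdmissible hD
  -- The inverse of this map is `glueColor`. The set Q leaves room for a further condition on the
  -- quotient coloring, needed for the rank two count.
  rw [← Set.ncard_prod, ← Set.InjOn.ncard_image (f := fun c => (R.quotColor I c, R.subColor I c))]
  · congr 1
    ext ⟨q, d⟩
    constructor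
    · rintro ⟨c, ⟨hc, hfib, hcQ⟩, he⟩
      simp only [Prod.mk.injEq] at he
      obtain ⟨rfl, rfl⟩ := he
      exact ⟨⟨h.quotColor_mem_colorings hD hI hc.1 hfib, hcQ⟩,
        hR.subColor_mem_colorings hI hc.1⟩
    · rintro ⟨⟨hq, hqQ⟩, hd⟩
      simp only at hq hqQ hd
      have hc := hR.glueColor_mem_colorings hI hQ hq.1 hd.1
      have hfib := hR.fibConst_glueColor hI hQ hq.1 hd.1
      have e1 : R.quotColor I (R.glueColor I q d) = q := by
        funext μ
        by_cases hμ : μ ∈ (R.quot I).pos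
        · rw [hR.quot_pos hI hQ] at hμ
          obtain ⟨α, ⟨hα, hαI⟩, rfl⟩ := hμ
          rw [hR.quotColor_proj hI hc.1 hfib hα hαI,
            (hR.glueColor_of_notMem hI hQ hq.1 hα hαI).2]
        · rw [hq.2 μ hμ, (h.quotColor_mem_colorings hD hI hc.1 hfib).2 μ hμ]
      have e2 : R.subColor I (R.glueColor I q d) = d := by
        funext α
        by_cases hα : α ∈ (R.sub I).pos
        · rw [subColor, if_pos hα]
          rw [hR.pos_sub hI] at hα
          exact hR.glueColor_of_mem hI hα.1 hα.2
        · rw [subColor, if_neg hα, hd.2 α hα]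
      exact ⟨_, ⟨hc, hfib, by rwa [e1]⟩, by simp only [e1, e2]⟩
  · rintro c ⟨hc, hfib, -⟩ c' ⟨hc', hfib', -⟩ he
    simp only [Prod.mk.injEq] at he
    funext α
    by_cases hα : α ∈ R.pos
    · by_cases hαI : α ∈ Submodule.span ℝ I
      · have hα' : α ∈ (R.sub I).pos := by rw [hR.pos_sub hI]; exact ⟨hα, hαI⟩
        have := congrFun he.2 α
        rwa [subColor, subColor, if_pos hα', if_pos hα'] at this
      · have := congrFun he.1 (proj I α)
        rw [hR.quotColor_proj hI hc.1 hfib hα hαI, hR.quotColor_proj hI hc'.1 hfib' hα hαI] at this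
        exact hR.proj_injOn hI (hR.color_mem_sdiff hI hc.1 hfib hα hαI)
          (hR.color_mem_sdiff hI hc'.1 hfib' hα hαI) this
    · rw [hc.2 α hα, hc'.2 α hα]

/-- Sums in R/I lift to sums in R, so constancy along a set containing I can be tested in the
quotient. -/
theorem IsQuotOf.fibConst_union_iff {c : E → E} (hc : R.IsColoring c) (hfib : R.FibConst c I)
    {K : Set E} :
    R.FibConst c (I ∪ K) ↔ (R.quot I).FibConst (R.quotColor I c) (proj I '' K) := by
  refine ⟨fun hK => ?_, h.fibConst_preimage hD hI hc hfib⟩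
  have hR := h.isAdmissible hD
  have hQ := (h.quot hI).isAdmissible hD
  intro μ hμ hμK ν hν hνK hμν
  obtain ⟨α, hα, β, hβ, hαβ, rfl, rfl⟩ := h.exists_lift_add hD hI hμ.1 hν.1 hμν
  have hα' := hR.pos_of_proj_mem_quot_pos hI hQ hα hμ
  have hβ' := hR.pos_of_proj_mem_quot_pos hI hQ hβ hν
  have hαI : α ∉ Submodule.span ℝ I := fun hs => hQ.ne_zero hμ.1 (proj_eq_zero_iff.2 hs)
  rw [← map_add, hR.quotColor_proj hI hc hfib (hR.add_pos hα' hβ' hαβ)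
    (hR.add_notMem_span hI hα' hβ' hαI), hR.quotColor_proj hI hc hfib hα' hαI,
    hK α hα' (fun h => hμK (proj_mem_span_image_iff.2 h)) β hβ' (proj_mem_span_image_iff.1 hνK) hαβ]

end BasedRoots

/-! ### Primitive inversion sets in rank two -/

namespace BasedRoots

variable {R : BasedRoots E}

namespace IsAdmissible

variable (hR : R.IsAdmissible)
include hR

theorem ncard_colorings_of_base_eq_singleton {a : E} (ha : R.base = {a}) :
    R.colorings.ncard = 1 := by
  classical
  rw [Set.ncard_eq_one]
  refine ⟨fun α => if α ∈ R.pos then a else 0, ?_⟩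
  ext c
  constructor
  · intro hc
    funext α
    by_cases hα : α ∈ R.pos
    · have := hR.color_mem hc.1 hα
      rw [ha] at this
      simpa [hα] using this
    · simpa [hα] using hc.2 α hα
  · rintro rfl
    refine ⟨⟨fun θ hθ => ?_, fun α hα β hβ hαβ => ?_⟩, fun α hα => by simp [hα]⟩
    · have h1 : θ = a := by rw [ha] at hθ; exact hθ
      have h2 := hR.base_pos hθ
      rw [h1] at h2
      simp only [h1, if_pos h2]
    · simp [hα, hαβ]

/-- `Φ` is an inflation along `I` if and only if it is a union of fibers outside of `span I`. -/
theorem exists_eq_inflation_iff {I : Set E} (hI : I ⊆ R.base) {Φ : Set E} (hΦ : Φ ⊆ R.pos) :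
    (∃ Ψ ⊆ (R.quot I).pos, ∃ X ⊆ (R.sub I).pos, Φ = R.inflation I Ψ X) ↔
      ∀ α ∈ R.pos, ∀ β ∈ R.pos, α ∉ Submodule.span ℝ I → proj I α = proj I β → α ∈ Φ → β ∈ Φ := by
  constructor
  · rintro ⟨Ψ, -, X, hX, rfl⟩ α hα β hβ hαI he hαΦ
    rcases hαΦ with h | h
    · refine Or.inl ⟨hβ, ?_⟩
      rw [← he]
      exact h.2
    · have := hX h
      rw [hR.pos_sub hI] at this
      exact absurd this.2 hαI
  · intro h
    refine ⟨proj I '' (Φ \ (Submodule.span ℝ I : Set E)), ?_,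
      Φ ∩ (Submodule.span ℝ I : Set E), ?_, ?_⟩
    · rintro _ ⟨α, ⟨hα, hαI⟩, rfl⟩
      exact hR.proj_mem_quot_pos hI (hΦ hα) hαI
    · rw [hR.pos_sub hI]
      exact Set.inter_subset_inter_left _ hΦ
    · ext α
      constructor
      · intro hα
        by_cases hαI : α ∈ Submodule.span ℝ I
        · exact Or.inr ⟨hα, hαI⟩
        · exact Or.inl ⟨hΦ hα, α, ⟨hα, hαI⟩, rfl⟩
      · rintro (⟨hα, β, ⟨hβ, hβI⟩, he⟩ | ⟨hα, -⟩)
        · exact h β (hΦ hβ) α hα hβI he hβ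
        · exact hα

/-- The complement is an inversion set without simple roots, hence empty. -/
theorem eq_pos_of_base_subset {Φ : Set E} (hΦ : R.IsInversionSet Φ) (h : R.base ⊆ Φ) :
    Φ = R.pos := by
  refine subset_antisymm hΦ.subset_pos fun α hα => ?_
  by_contra hn
  have hc : R.IsInversionSet (R.pos \ Φ) := ⟨Set.sdiff_subset, hΦ.coclosed, by
    rw [Set.sdiff_sdiff_cancel_left hΦ.subset_pos]
    exact hΦ.closed⟩
  obtain ⟨θ, hθ, hθ'⟩ := hR.exists_base_mem hc α hα ⟨hα, hn⟩
  exact hθ'.2 (h hθ)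

section RankTwo

variable {a b : E} (hab : a ≠ b) (hbase : R.base = {a, b})
include hab hbase

/-- The only proper non-empty subsets of the base are {a} and {b}, and being an inflation along one
of them is a condition on fibers. -/
theorem isPrimitive_iff_of_rank_two {Φ : Set E} (hΦ : R.IsInversionSet Φ) (ha : a ∈ Φ)
    (hb : b ∉ Φ) :
    R.IsPrimitive Φ ↔ ∀ I : Set E, I = {a} ∨ I = {b} →
      ¬ ∀ α ∈ R.pos, ∀ β ∈ R.pos, α ∉ Submodule.span ℝ I → proj I α = proj I β → α ∈ Φ → β ∈ Φ := by
  have hab' : ∀ I : Set E, I = {a} ∨ I = {b} → I ⊆ R.base ∧ I ≠ ∅ ∧ I ≠ R.base := by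
    rw [hbase]
    rintro I (rfl | rfl)
    · refine ⟨by simp, by simp, fun h => hab ?_⟩
      have : b ∈ ({a} : Set E) := by rw [h]; simp
      exact this.symm
    · refine ⟨by simp, by simp, fun h => hab ?_⟩
      have : a ∈ ({b} : Set E) := by rw [h]; simp
      exact this
  constructor
  · intro hp I hI hinf
    obtain ⟨h1, h2, h3⟩ := hab' I hI
    rw [← hR.exists_eq_inflation_iff h1 hΦ.subset_pos] at hinf
    obtain ⟨Ψ, hΨ, X, hX, he⟩ := hinf
    rcases hp.eq_empty_or_eq_base I h1 Ψ hΨ X hX he with h | h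
    · exact h2 h
    · exact h3 h
  · intro h
    refine ⟨hΦ.subset_pos, fun h0 => ?_, fun h0 => ?_, fun I hI Ψ hΨ X hX he => ?_⟩
    · rw [h0] at ha
      exact ha
    · rw [h0] at hb
      exact hb (hR.base_pos (by rw [hbase]; simp))
    · by_contra! hcon
      have hI' : I = {a} ∨ I = {b} := by
        rw [hbase, Set.subset_pair_iff_eq] at hI
        rw [hbase] at hcon
        rcases hI with h1 | h1 | h1 | h1
        · exact absurd h1 (Set.nonempty_iff_ne_empty.1 hcon.1)
        · exact Or.inl h1
        · exact Or.inr h1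
        · exact absurd h1 hcon.2
      exact h I hI' ((hR.exists_eq_inflation_iff hI hΦ.subset_pos).1 ⟨Ψ, hΨ, X, hX, he⟩)

/-- With only two colors, constancy on fibers is a property of the class of color a. -/
theorem fibConst_iff_of_rank_two {c : E → E} (hc : R.IsColoring c) {I : Set E} (hI : I ⊆ R.base) :
    R.FibConst c I ↔ ∀ α ∈ R.pos, ∀ β ∈ R.pos, α ∉ Submodule.span ℝ I → proj I α = proj I β →
      α ∈ {α | α ∈ R.pos ∧ c α ∈ ({a} : Set E)} → β ∈ {α | α ∈ R.pos ∧ c α ∈ ({a} : Set E)} := by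
  constructor
  · rintro hfib α hα β hβ hαI he ⟨-, h⟩
    refine ⟨hβ, ?_⟩
    rwa [← hR.color_eq_of_sub_mem_span hc hI hfib hα hβ hαI (proj_eq_proj_iff.1 he)]
  · intro h α hα hαI β hβ hβI hαβ
    have hαβ' := hR.add_pos hα hβ hαβ
    have hαβI := hR.add_notMem_span hI hα hβ hαI
    have he : proj I (α + β) = proj I α := by
      rw [map_add, proj_eq_zero_iff.2 hβI, add_zero]
    have h1 := hR.color_mem hc hα
    have h2 := hR.color_mem hc hαβ'
    rw [hbase] at h1 h2
    rcases h1 with h1 | h1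
    · rw [h1]
      exact (h α hα _ hαβ' hαI he.symm ⟨hα, h1⟩).2
    · rcases h2 with h2 | h2
      · have := (h _ hαβ' α hα hαβI he ⟨hαβ', h2⟩).2
        rw [h2]
        exact this.symm
      · rw [h1]
        exact h2

/-- A primitive inversion set containing a omits b, since otherwise it would be everything. It is
therefore the class of color a of a unique coloring. -/
theorem ncard_primitive_of_mem :
    {Φ | (R.IsPrimitive Φ ∧ R.IsInversionSet Φ) ∧ a ∈ Φ}.ncard =
      {c ∈ R.colorings | ¬ R.FibConst c {a} ∧ ¬ R.FibConst c {b}}.ncard := by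
  classical
  have haB : a ∈ R.base := by rw [hbase]; simp
  have hbB : b ∈ R.base := by rw [hbase]; simp
  have hIb : ∀ I : Set E, I = {a} ∨ I = {b} → I ⊆ R.base := by
    rintro I (rfl | rfl) <;> simpa
  have hprim : ∀ c, R.IsColoring c → (R.IsPrimitive {α | α ∈ R.pos ∧ c α ∈ ({a} : Set E)} ↔
      ¬ R.FibConst c {a} ∧ ¬ R.FibConst c {b}) := by
    intro c hc
    rw [hR.isPrimitive_iff_of_rank_two hab hbase (hR.isInversionSet_colorClass hc {a})
      ⟨hR.base_pos haB, hc.base a haB⟩ (fun h => hab (h.2.symm.trans (hc.base b hbB)))]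
    constructor
    · intro h
      exact ⟨fun hf => h {a} (Or.inl rfl)
          ((hR.fibConst_iff_of_rank_two hab hbase hc (hIb _ (Or.inl rfl))).1 hf),
        fun hf => h {b} (Or.inr rfl)
          ((hR.fibConst_iff_of_rank_two hab hbase hc (hIb _ (Or.inr rfl))).1 hf)⟩
    · rintro ⟨h1, h2⟩ I hI hinf
      rw [← hR.fibConst_iff_of_rank_two hab hbase hc (hIb I hI)] at hinf
      rcases hI with rfl | rfl
      · exact h1 hinf
      · exact h2 hinf
  symm
  rw [← Set.InjOn.ncard_image (f := fun c => {α | α ∈ R.pos ∧ c α ∈ ({a} : Set E)})]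
  · congr 1
    ext Φ
    constructor
    · rintro ⟨c, ⟨hc, hbad⟩, rfl⟩
      exact ⟨⟨(hprim c hc.1).2 hbad, hR.isInversionSet_colorClass hc.1 {a}⟩, hR.base_pos haB,
        hc.1.base a haB⟩
    · rintro ⟨⟨hp, hinv⟩, ha⟩
      have hb : b ∉ Φ := by
        intro hb
        refine hp.ne_pos (hR.eq_pos_of_base_subset hinv ?_)
        rw [hbase]
        rintro x (rfl | rfl) <;> assumption
      set c : E → E := fun α => if α ∈ R.pos then if α ∈ Φ then a else b else 0
      have hcin : ∀ α ∈ Φ, c α = a := fun α hα => by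
        simp only [c, if_pos hα, if_pos (hinv.subset_pos hα)]
      have hcout : ∀ α ∈ R.pos, α ∉ Φ → c α = b := fun α hα h => by
        simp only [c, if_pos hα, if_neg h]
      have hc : R.IsColoring c := by
        refine ⟨fun θ hθ => ?_, fun α hα β hβ hαβ => ?_⟩
        · rw [hbase] at hθ
          rcases hθ with rfl | rfl
          · exact hcin _ ha
          · exact hcout _ (hR.base_pos hbB) hb
        · by_cases h1 : α ∈ Φ
          · by_cases h2 : β ∈ Φ
            · left
              rw [hcin _ (hinv.closed α h1 β h2 hαβ), hcin _ h1]
            · rw [hcin _ h1, hcout _ hβ h2]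
              by_cases h3 : α + β ∈ Φ
              · exact Or.inl (hcin _ h3)
              · exact Or.inr (hcout _ hαβ h3)
          · by_cases h2 : β ∈ Φ
            · rw [hcin _ h2, hcout _ hα h1]
              by_cases h3 : α + β ∈ Φ
              · exact Or.inr (hcin _ h3)
              · exact Or.inl (hcout _ hαβ h3)
            · left
              rw [hcout _ hα h1, hcout _ hαβ (hinv.coclosed α ⟨hα, h1⟩ β ⟨hβ, h2⟩ hαβ).2]
      have he : {α | α ∈ R.pos ∧ c α ∈ ({a} : Set E)} = Φ := by
        ext α
        constructor
        · rintro ⟨hα, h⟩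
          by_contra hn
          rw [hcout α hα hn] at h
          exact hab h.symm
        · intro hα
          exact ⟨hinv.subset_pos hα, hcin α hα⟩
      refine ⟨c, ⟨⟨hc, fun α hα => by simp only [c, if_neg hα]⟩, (hprim c hc).1 ?_⟩, he⟩
      rw [he]
      exact hp
  · rintro c ⟨hc, -⟩ d ⟨hd, -⟩ he
    simp only at he
    funext α
    by_cases hα : α ∈ R.pos
    · have h1 := hR.color_mem hc.1 hα
      have h2 := hR.color_mem hd.1 hα
      have h3 : α ∈ {α | α ∈ R.pos ∧ c α ∈ ({a} : Set E)} ↔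
          α ∈ {α | α ∈ R.pos ∧ d α ∈ ({a} : Set E)} := by rw [he]
      simp only [Set.mem_ofPred_eq, hα, true_and, Set.mem_singleton_iff] at h3
      rw [hbase] at h1 h2
      rcases h1 with h1 | h1
      · rw [h1, h3.1 h1]
      · rcases h2 with h2 | h2
        · rw [h2, h3.2 h2]
        · exact h1.trans h2.symm
    · rw [hc.2 α hα, hd.2 α hα]

/-- In rank two, half the number of primitive inversion sets is the number of colorings that are
constant along neither of the simple roots. -/
theorem halfNumPrimitive_of_rank_two :
    R.halfNumPrimitive =
      ({c ∈ R.colorings | ¬ R.FibConst c {a} ∧ ¬ R.FibConst c {b}}.ncard : ℚ) := by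
  have hbase' : R.base = {b, a} := by rw [hbase, Set.pair_comm]
  have h1 := hR.ncard_primitive_of_mem hab hbase
  have h2 := hR.ncard_primitive_of_mem hab.symm hbase'
  simp only [and_comm (a := ¬ R.FibConst _ {b})] at h2
  have hfin : {Φ : Set E | R.IsPrimitive Φ ∧ R.IsInversionSet Φ}.Finite :=
    hR.pos_finite.finite_subsets.subset fun Φ h => h.1.subset_pos
  -- A primitive inversion set contains exactly one of a and b, and either kind is counted by the
  -- same colorings; this accounts for the factor one half.
  have hunion : {Φ : Set E | R.IsPrimitive Φ ∧ R.IsInversionSet Φ} =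
      {Φ | (R.IsPrimitive Φ ∧ R.IsInversionSet Φ) ∧ a ∈ Φ} ∪
        {Φ | (R.IsPrimitive Φ ∧ R.IsInversionSet Φ) ∧ b ∈ Φ} := by
    ext Φ
    constructor
    · intro hΦ
      obtain ⟨α, hα⟩ := Set.nonempty_iff_ne_empty.2 hΦ.1.ne_empty
      obtain ⟨θ, hθ, hθΦ⟩ := hR.exists_base_mem hΦ.2 α (hΦ.2.subset_pos hα) hα
      rw [hbase] at hθ
      rcases hθ with rfl | rfl
      · exact Or.inl ⟨hΦ, hθΦ⟩
      · exact Or.inr ⟨hΦ, hθΦ⟩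
    · rintro (h | h)
      · exact h.1
      · exact h.1
  have hdisj : Disjoint {Φ | (R.IsPrimitive Φ ∧ R.IsInversionSet Φ) ∧ a ∈ Φ}
      {Φ | (R.IsPrimitive Φ ∧ R.IsInversionSet Φ) ∧ b ∈ Φ} := by
    refine Set.disjoint_left.2 fun Φ h h' => ?_
    refine h.1.1.ne_pos (hR.eq_pos_of_base_subset h.1.2 ?_)
    rw [hbase]
    rintro x (rfl | rfl)
    · exact h.2
    · exact h'.2
  rw [halfNumPrimitive, hunion, Set.ncard_union_eq hdisj (hfin.subset fun _ h => h.1)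
    (hfin.subset fun _ h => h.1), h1, h2]
  push_cast
  ring

end RankTwo

/-! ### The type of a coloring -/

section Classification

variable {c : E → E} (hc : R.IsColoring c)
include hc

theorem color_mem_of_fibConst {K : Set E} (hK : K ⊆ R.base) (hfib : R.FibConst c (R.base \ K))
    {α t : E} (hα : α ∈ R.pos) (ht : t ∈ K) (h : 0 < R.coef t α) : c α ∈ K := by
  have h1 : α ∉ Submodule.span ℝ (R.base \ K) := by
    intro hs
    rw [hR.coef_eq_zero_of_mem_span Set.sdiff_subset hs (fun h => h.2 ht)] at h
    exact lt_irrefl _ h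
  have h2 := hR.color_mem_sdiff Set.sdiff_subset hc hfib hα h1
  rw [Set.sdiff_sdiff_cancel_left hK] at h2
  exact h2

/-- `c` is constant along all simple roots but `θ` and `φ`, and this cannot be improved. -/
def _root_.QRS.BasedRoots.FibType (R : BasedRoots E) (c : E → E) (θ φ : E) : Prop :=
  R.FibConst c (R.base \ {θ, φ}) ∧
    (θ ≠ φ → ¬ R.FibConst c (R.base \ {θ}) ∧ ¬ R.FibConst c (R.base \ {φ}))

/-- Since constancy along S \ {t} fails, some root involving t has a color other than t. That color
can only be φ, and likewise only φ'. -/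
theorem eq_of_fibConst_pair {t φ φ' : E} (ht : t ∈ R.base) (hφ : φ ∈ R.base) (hφ' : φ' ∈ R.base)
    (h : R.FibConst c (R.base \ {t, φ})) (h' : R.FibConst c (R.base \ {t, φ'}))
    (hn : ¬ R.FibConst c (R.base \ {t})) : φ = φ' := by
  have hex : ∃ α ∈ R.pos, 0 < R.coef t α ∧ c α ≠ t := by
    by_contra! hcon
    refine hn fun α hα hαt β hβ hβt hαβ => ?_
    obtain ⟨θ, hθ, h1, h2⟩ := hR.exists_of_notMem_span hα hαt
    have hθt : θ = t := by
      by_contra hne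
      exact h1 ⟨hθ, hne⟩
    subst hθt
    rw [hcon α hα h2, hcon _ (hR.add_pos hα hβ hαβ) (hR.pos_of_pos_add hβ h2)]
  obtain ⟨α, hα, hαt, hcα⟩ := hex
  have hsub : ∀ φ ∈ R.base, ({t, φ} : Set E) ⊆ R.base := by
    rintro φ hφ x (rfl | rfl) <;> assumption
  have h1 := hR.color_mem_of_fibConst hc (hsub φ hφ) h hα (by simp) hαt
  have h2 := hR.color_mem_of_fibConst hc (hsub φ' hφ') h' hα (by simp) hαt
  exact (h1.resolve_left hcα).symm.trans (h2.resolve_left hcα)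

/-- The color t of the full-support root σ lies in both types. A type {t} excludes a two-element
type containing t by minimality of the latter, and two-element types {t, ψ} and {t, ψ'} agree by
`eq_of_fibConst_pair`. -/
theorem pair_eq_of_fibType {σ : E} (hσ : σ ∈ R.pos) (hsupp : ∀ θ ∈ R.base, 0 < R.coef θ σ)
    {θ φ θ' φ' : E} (hθ : θ ∈ R.base) (hφ : φ ∈ R.base) (hθ' : θ' ∈ R.base) (hφ' : φ' ∈ R.base)
    (h : R.FibType c θ φ) (h' : R.FibType c θ' φ') : ({θ, φ} : Set E) = {θ', φ'} := by
  have hsub : ∀ θ ∈ R.base, ∀ φ ∈ R.base, ({θ, φ} : Set E) ⊆ R.base := by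
    rintro θ hθ φ hφ x (rfl | rfl) <;> assumption
  have h1 := hR.color_mem_of_fibConst hc (hsub θ hθ φ hφ) h.1 hσ (t := θ) (by simp) (hsupp θ hθ)
  have h2 := hR.color_mem_of_fibConst hc (hsub θ' hθ' φ' hφ') h'.1 hσ (t := θ') (by simp)
    (hsupp θ' hθ')
  have hmixed : ∀ θ θ' φ' : E, R.FibConst c (R.base \ {θ}) → R.FibType c θ' φ' → θ' ≠ φ' →
      θ ∈ ({θ', φ'} : Set E) → False := by
    rintro θ θ' φ' hf hft hne (rfl | rfl)
    · exact (hft.2 hne).1 hf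
    · exact (hft.2 hne).2 hf
  by_cases hd : θ = φ
  · subst hd
    rw [Set.pair_eq_singleton] at h1 ⊢
    by_cases hd' : θ' = φ'
    · subst hd'
      rw [Set.pair_eq_singleton] at h2 ⊢
      rw [Set.singleton_eq_singleton_iff]
      exact h1.symm.trans h2
    · have hf := h.1
      rw [Set.pair_eq_singleton] at hf
      rw [Set.mem_singleton_iff] at h1
      exact (hmixed _ _ _ hf h' hd' (h1 ▸ h2)).elim
  · by_cases hd' : θ' = φ'
    · subst hd'
      rw [Set.pair_eq_singleton] at h2
      have hf := h'.1
      rw [Set.pair_eq_singleton] at hf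
      rw [Set.mem_singleton_iff] at h2
      exact (hmixed _ _ _ hf h hd (h2 ▸ h1)).elim
    · obtain ⟨t, ht⟩ : ∃ t, c σ = t := ⟨_, rfl⟩
      rw [ht] at h1 h2
      have hother : ∀ θ φ : E, θ ∈ R.base → φ ∈ R.base → R.FibType c θ φ → θ ≠ φ →
          t ∈ ({θ, φ} : Set E) → ∃ ψ ∈ R.base, ({θ, φ} : Set E) = {t, ψ} ∧
            R.FibConst c (R.base \ {t, ψ}) ∧ ¬ R.FibConst c (R.base \ {t}) := by
        rintro θ φ hθ hφ hft hne (rfl | rfl)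
        · exact ⟨φ, hφ, rfl, hft.1, (hft.2 hne).1⟩
        · exact ⟨θ, hθ, Set.pair_comm _ _, by rw [Set.pair_comm]; exact hft.1, (hft.2 hne).2⟩
      obtain ⟨ψ, hψ, e1, f1, n1⟩ := hother θ φ hθ hφ h hd h1
      obtain ⟨ψ', hψ', e2, f2, -⟩ := hother θ' φ' hθ' hφ' h' hd' h2
      have htb : t ∈ R.base := ht ▸ hR.color_mem hc hσ
      rw [e1, e2, hR.eq_of_fibConst_pair hc htb hψ hψ' f1 f2 n1]

theorem exists_fibType (hf : R.HasFibration c) :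
    ∃ θ ∈ R.base, ∃ φ ∈ R.base, R.FibType c θ φ := by
  obtain ⟨I, hI, hcard, hfib⟩ := hf
  have hIe : I = R.base \ (R.base \ I) := (Set.sdiff_sdiff_cancel_left hI).symm
  have hsing : ∀ θ ∈ R.base, R.FibConst c (R.base \ {θ}) → R.FibType c θ θ := by
    intro θ _ h
    refine ⟨?_, fun hne => absurd rfl hne⟩
    rwa [Set.pair_eq_singleton]
  rcases hcard with hcard | hcard
  · obtain ⟨θ, hθ⟩ := Set.ncard_eq_one.1 hcard
    have hθb : θ ∈ R.base \ I := by rw [hθ]; rfl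
    rw [hIe, hθ] at hfib
    exact ⟨θ, hθb.1, θ, hθb.1, hsing θ hθb.1 hfib⟩
  · obtain ⟨θ, φ, -, hθ⟩ := Set.ncard_eq_two.1 hcard
    have hθb : θ ∈ R.base \ I := by rw [hθ]; simp
    have hφb : φ ∈ R.base \ I := by rw [hθ]; simp
    rw [hIe, hθ] at hfib
    by_cases h1 : R.FibConst c (R.base \ {θ})
    · exact ⟨θ, hθb.1, θ, hθb.1, hsing θ hθb.1 h1⟩
    · by_cases h2 : R.FibConst c (R.base \ {φ})
      · exact ⟨φ, hφb.1, φ, hφb.1, hsing φ hφb.1 h2⟩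
      · exact ⟨θ, hθb.1, φ, hφb.1, hfib, fun _ => ⟨h1, h2⟩⟩

end Classification

theorem cutConnected_of_connected (hconn : R.Connected) {S : Finset E}
    (hS : ∀ x, x ∈ S ↔ x ∈ R.base) : CutConnected S := by
  intro A hA hne hAS
  obtain ⟨a, ha⟩ := hne
  obtain ⟨b, hbS, hbA⟩ : ∃ b ∈ S, b ∉ A := by
    by_contra! h
    exact hAS (subset_antisymm hA h)
  obtain ⟨w⟩ := hconn.preconnected ⟨a, (hS a).1 (hA ha)⟩ ⟨b, (hS b).1 hbS⟩
  obtain ⟨d, -, h1, h2⟩ := w.exists_boundary_dart {x | (x : E) ∈ A} ha hbA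
  exact ⟨d.fst, h1, d.snd, (hS _).2 d.snd.2, h2, d.adj⟩

/-- This is where connectedness enters the recurrence: the sum of all simple roots is a root. -/
theorem exists_full_support (hconn : R.Connected) :
    ∃ σ ∈ R.pos, ∀ θ ∈ R.base, 0 < R.coef θ σ := by
  have hS : ∀ x, x ∈ hR.base_finite.toFinset ↔ x ∈ R.base := fun x => hR.base_finite.mem_toFinset
  obtain ⟨⟨θ₀, hθ₀⟩⟩ := hconn.nonempty
  refine ⟨∑ x ∈ hR.base_finite.toFinset, x, hR.sum_mem_pos (fun x hx => (hS x).1 hx)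
    ⟨θ₀, (hS _).2 hθ₀⟩ (hR.cutConnected_of_connected hconn hS), fun θ hθ => ?_⟩
  rw [map_sum, Finset.sum_eq_single θ, hR.coef_self hθ]
  · norm_num
  · intro x hx hne
    exact hR.coef_of_ne ((hS x).1 hx) hne
  · intro h
    exact absurd ((hS θ).2 hθ) h

end IsAdmissible

end BasedRoots

/-! ### The recurrence -/

namespace BasedRoots

variable {R : BasedRoots E} {D : Set E} (hD : IsRootSet D) (h : R.IsQuotOf D)
include hD h

/-- The quotient has rank one and so a single coloring. -/
theorem IsQuotOf.ncard_fibType_self {θ : E} (hθ : θ ∈ R.base) :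
    {c ∈ R.colorings | R.FibType c θ θ}.ncard = (R.sub (R.base \ {θ})).numFine := by
  have hR := h.isAdmissible hD
  have hI : R.base \ {θ} ⊆ R.base := Set.sdiff_subset
  have hQ := (h.quot hI).isAdmissible hD
  have h1 := h.ncard_fibConst hD hI Set.univ
  have hbase : (R.quot (R.base \ {θ})).base = {proj (R.base \ {θ}) θ} := by
    change proj (R.base \ {θ}) '' (R.base \ (R.base \ {θ})) = _
    rw [Set.sdiff_sdiff_cancel_left (Set.singleton_subset_iff.2 hθ), Set.image_singleton]
  rw [Set.inter_univ, hQ.ncard_colorings_of_base_eq_singleton hbase, one_mul] at h1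
  rw [(hR.sub hI).numFine_eq, ← h1]
  congr 1
  ext c
  simp [FibType]

/-- Minimality of the type says that the induced coloring of the rank two quotient is constant along
neither simple root; such colorings are counted by Π. -/
theorem IsQuotOf.ncard_fibType {θ φ : E} (hθ : θ ∈ R.base) (hφ : φ ∈ R.base) (hne : θ ≠ φ) :
    ({c ∈ R.colorings | R.FibType c θ φ}.ncard : ℚ) =
      (R.quot (R.base \ {θ, φ})).halfNumPrimitive * ((R.sub (R.base \ {θ, φ})).numFine : ℚ) := by
  have hR := h.isAdmissible hD
  set I := R.base \ {θ, φ} with hIdef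
  have hI : I ⊆ R.base := Set.sdiff_subset
  have hQ := (h.quot hI).isAdmissible hD
  have hK : ({θ, φ} : Set E) ⊆ R.base := by
    rintro x (rfl | rfl) <;> assumption
  have hbI : R.base \ I = {θ, φ} := Set.sdiff_sdiff_cancel_left hK
  have hbase : (R.quot I).base = {proj I θ, proj I φ} := by
    change proj I '' (R.base \ I) = _
    rw [hbI, Set.image_pair]
  have hne' : proj I θ ≠ proj I φ := by
    intro he
    refine hne (hR.proj_injOn hI ?_ ?_ he) <;> rw [hbI] <;> simp
  have hU : ∀ θ φ : E, θ ∈ R.base → φ ∈ R.base → θ ≠ φ →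
      R.base \ {θ, φ} ∪ {φ} = R.base \ {θ} := by
    intro θ φ hθ hφ hne
    ext x
    simp only [Set.mem_union, Set.mem_sdiff, Set.mem_insert_iff, Set.mem_singleton_iff]
    by_cases hx : x = φ
    · subst hx
      simp [hφ, hne.symm]
    · simp [hx]
  rw [hQ.halfNumPrimitive_of_rank_two hne' hbase, (hR.sub hI).numFine_eq, ← Nat.cast_mul]
  congr 1
  have e1 : {c ∈ (R.quot I).colorings | ¬ (R.quot I).FibConst c {proj I θ} ∧
      ¬ (R.quot I).FibConst c {proj I φ}} = (R.quot I).colorings ∩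
        {c | ¬ (R.quot I).FibConst c {proj I θ} ∧ ¬ (R.quot I).FibConst c {proj I φ}} := by
    ext c
    rfl
  rw [e1, ← h.ncard_fibConst hD hI]
  congr 1
  ext c
  simp only [Set.mem_ofPred_eq]
  refine and_congr_right fun hc => and_congr_right fun hfib => ?_
  rw [← Set.image_singleton, ← Set.image_singleton, ← h.fibConst_union_iff hD hI hc.1 hfib,
    ← h.fibConst_union_iff hD hI hc.1 hfib, hU θ φ hθ hφ hne, hIdef, Set.pair_comm θ φ,
    hU φ θ hφ hθ hne.symm]
  exact ⟨fun h => (h hne).symm, fun h _ => h.symm⟩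

/-- The recurrence for the number of fine decompositions. -/
theorem IsQuotOf.numFine_eq_sum (hconn : R.Connected) {n : ℕ} {θ : Fin n → E}
    (hinj : Function.Injective θ) (hrange : Set.range θ = R.base) :
    (R.numFine : ℚ) =
      ∑ i : Fin n, ((R.sub (R.base \ {θ i})).numFine : ℚ) +
      ∑ i : Fin n, ∑ j ∈ Finset.Ioi i,
        (R.quot (R.base \ {θ i, θ j})).halfNumPrimitive *
          ((R.sub (R.base \ {θ i, θ j})).numFine : ℚ) := by
  classical
  have hR := h.isAdmissible hD
  have hθ : ∀ i, θ i ∈ R.base := fun i => hrange ▸ Set.mem_range_self i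
  obtain ⟨σ, hσ, hsupp⟩ := hR.exists_full_support hconn
  set C := hR.colorings_finite.toFinset
  have hC : ∀ c, c ∈ C ↔ c ∈ R.colorings := fun c => hR.colorings_finite.mem_toFinset
  have hcount : ∀ i j, (C.filter fun c => R.FibType c (θ i) (θ j)).card =
      {c ∈ R.colorings | R.FibType c (θ i) (θ j)}.ncard := by
    intro i j
    rw [← Set.ncard_coe_finset]
    congr 1
    ext c
    simp [hC]
  -- Types are indexed by pairs i ≤ j, the diagonal i = j standing for the singleton {θ i}.
  have hcover : C = (Finset.univ.sigma fun i : Fin n => Finset.Ici i).biUnion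
      fun p => C.filter fun c => R.FibType c (θ p.1) (θ p.2) := by
    ext c
    simp only [Finset.mem_biUnion, Finset.mem_sigma, Finset.mem_univ, true_and, Finset.mem_Ici,
      Finset.mem_filter]
    refine ⟨fun hc => ?_, fun ⟨_, _, hc, _⟩ => hc⟩
    obtain ⟨φ, hφ, ψ, hψ, hft⟩ := hR.exists_fibType ((hC c).1 hc).1
      (h.hasFibration hD ((hC c).1 hc).1 ⟨_, hR.color_mem ((hC c).1 hc).1 hσ⟩)
    rw [← hrange] at hφ hψ
    obtain ⟨i, rfl⟩ := hφ
    obtain ⟨j, rfl⟩ := hψ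
    rcases le_total i j with hij | hij
    · exact ⟨⟨i, j⟩, hij, hc, hft⟩
    · refine ⟨⟨j, i⟩, hij, hc, ?_, fun hne => (hft.2 hne.symm).symm⟩
      rw [Set.pair_comm]
      exact hft.1
  have hdisj : ∀ p ∈ (Finset.univ.sigma fun i : Fin n => Finset.Ici i),
      ∀ q ∈ (Finset.univ.sigma fun i : Fin n => Finset.Ici i), p ≠ q →
      Disjoint (C.filter fun c => R.FibType c (θ p.1) (θ p.2))
        (C.filter fun c => R.FibType c (θ q.1) (θ q.2)) := by
    rintro ⟨i, j⟩ hp ⟨k, l⟩ hq hne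
    refine Finset.disjoint_left.2 fun c h1 h2 => hne ?_
    simp only [Finset.mem_sigma, Finset.mem_univ, true_and, Finset.mem_Ici,
      Finset.mem_filter] at hp hq h1 h2
    have he := hR.pair_eq_of_fibType ((hC c).1 h1.1).1 hσ hsupp (hθ i) (hθ j) (hθ k) (hθ l)
      h1.2 h2.2
    rw [← Set.image_pair, ← Set.image_pair, (Set.image_injective.2 hinj).eq_iff,
      Set.pair_eq_pair_iff] at he
    rcases he with ⟨rfl, rfl⟩ | ⟨rfl, rfl⟩
    · rfl
    · rw [le_antisymm hp hq]
  have hcard : R.colorings.ncard = C.card := Set.ncard_eq_toFinset_card _ _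
  rw [hR.numFine_eq, hcard, hcover, Finset.card_biUnion hdisj, Finset.sum_sigma,
    ← Finset.sum_add_distrib]
  push_cast
  refine Finset.sum_congr rfl fun i _ => ?_
  rw [← Finset.Ioi_insert, Finset.sum_insert (by simp), hcount,
    h.ncard_fibType_self hD (hθ i)]
  congr 1
  refine Finset.sum_congr rfl fun j hj => ?_
  rw [hcount, h.ncard_fibType hD (hθ i) (hθ j) (hinj.ne (Finset.mem_Ioi.1 hj).ne)]

end BasedRoots

end QRS

end

theorem mainTheorem6 {ι E N : Type*} [Finite ι]
    [NormedAddCommGroup E] [InnerProductSpace ℝ E] [FiniteDimensional ℝ E]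
    [AddCommGroup N] [Module ℝ N]
    -- a (reduced, crystallographic) root system `Δ` in the Euclidean space `E`, whose reflections
    -- are the orthogonal ones, with a base `b`
    (Δ : RootPairing ι ℝ E N) [Δ.IsRootSystem] [Δ.IsCrystallographic] [Δ.IsReduced]
    (hΔ : ∀ (i : ι) (x y : E), ⟪Δ.reflection i x, Δ.reflection i y⟫_ℝ = ⟪x, y⟫_ℝ)
    (b : Δ.Base)
    -- a proper subset `I₀` of the set of simple roots of `Δ`
    (I₀ : Set E) (hI₀ : I₀ ⊂ Δ.root '' (b.support : Set ι))
    -- the quotient root system `Δ / I₀` with an arbitrary base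
    (R : QRS.BasedRoots E) (hR : R.roots = QRS.quotientRoots (Set.range Δ.root) I₀)
    (hbase : QRS.IsBase R.base R.roots) :
    -- properties of every fine decomposition of `R⁺`
    (∀ P : Set (Set E), R.IsFineDecomposition P →
      (∀ Φ ∈ P, (Φ ∩ R.base).ncard = 1) ∧
      ∃ I ⊆ R.base, ((R.quot I).rank = 1 ∨ (R.quot I).rank = 2) ∧
        ∀ Φ ∈ P, (∃ Ψ ⊆ (R.quot I).pos, Φ = R.inflation I Ψ ∅) ∨
          (∃ X ⊆ (R.sub I).pos, Φ = R.inflation I ∅ X)) ∧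
    -- the recurrence
    (R.Connected → ∀ (n : ℕ) (θ : Fin n → E), Function.Injective θ → Set.range θ = R.base →
      (R.numFine : ℚ) =
        ∑ i : Fin n, ((R.sub (R.base \ {θ i})).numFine : ℚ) +
        ∑ i : Fin n, ∑ j ∈ Finset.Ioi i,
          (R.quot (R.base \ {θ i, θ j})).halfNumPrimitive *
            ((R.sub (R.base \ {θ i, θ j})).numFine : ℚ)) := by
  have hD := QRS.isRootSet_range_root Δ hΔ
  have hI₀D : I₀ ⊆ Set.range Δ.root := hI₀.1.trans (Set.image_subset_range _ _)
  have hq : R.IsQuotOf (Set.range Δ.root) := by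
    refine ⟨Submodule.span ℝ I₀, ⊤, le_top, le_antisymm ?_ ?_, ?_, hbase⟩
    · exact Submodule.span_mono fun x hx => ⟨hI₀D hx, Submodule.subset_span hx⟩
    · exact Submodule.span_le.2 fun x hx => hx.2
    · rw [hR]
      ext μ
      constructor
      · rintro ⟨α, ⟨h1, h2⟩, rfl⟩
        exact ⟨α, ⟨h1, Submodule.mem_top, h2⟩, rfl⟩
      · rintro ⟨α, ⟨h1, -, h2⟩, rfl⟩
        exact ⟨α, ⟨h1, h2⟩, rfl⟩
  have hadm := hq.isAdmissible hD
  -- A simple root of Δ outside I₀ has non-zero image, so R has a root and its base is not empty.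
  have hne : R.base.Nonempty := by
    obtain ⟨x, hx, hxI⟩ := Set.exists_of_ssubset hI₀
    have hind := b.linearIndepOn_root.id_image
    have hx' : x ∉ Submodule.span ℝ I₀ := fun hs => hxI
      ((hind.mono hI₀.1).mem_span_iff_id.1 hs (hind.mono (Set.insert_subset hx hI₀.1)))
    have hroot : QRS.proj I₀ x ∈ R.roots := by
      rw [hR]
      exact ⟨x, ⟨(Set.image_subset_range _ _) hx, hx'⟩, rfl⟩
    obtain h | h := hadm.pos_or_neg_pos hroot
    · by_contra hn
      rw [Set.not_nonempty_iff_eq_empty] at hn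
      have := h.2
      rw [hn, AddSubmonoid.closure_empty, AddSubmonoid.mem_bot] at this
      exact hadm.ne_zero h.1 this
    · by_contra hn
      rw [Set.not_nonempty_iff_eq_empty] at hn
      have := h.2
      rw [hn, AddSubmonoid.closure_empty, AddSubmonoid.mem_bot] at this
      exact hadm.ne_zero h.1 this
  exact ⟨fun P hP => ⟨fun Φ hΦ => hadm.ncard_inter_base hP hΦ, hq.exists_inflation hD hne hP⟩,
    fun hconn n θ hinj hrange => hq.numFine_eq_sum hD hconn hinj hrange⟩
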